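/- Let $G$ be a connected Lie group with Lie algebra $\mathfrak g$, acting smoothly, freely and properly on the left on a finite-dimensional smooth manifold $M$. For $\xi\in\mathfrak g$ let $\tilde\xi$ be the corresponding fundamental vector field on $M$, and let $\tau:TM\to M$ be the tangent bundle. Let $L:TM\to\mathbb R$ be a smooth Lagrangian which is invariant under the induced action of $G$ on $TM$. For $w\in TM$ and $u,v\in T_{\tau(w)}M$ write $v^V(L)$ for the derivative of $L$ along the vertical lift of $v$ and $g_w(u,v)=u^Vv^V(L)$ for the Hessian of $L$ at $w$. Assume that $L$ is regular ($g_w$ is non-singular for every $w\in TM$) and that for every $w\in TM$ the bilinear form $(\xi,\eta)\mapsto g_w(\tilde\xi,\tilde\eta)$ on $\mathfrak g$ is non-singular. Let $p:TM\to\mathfrak g^*$, $\langle\xi,p(w)\rangle=\tilde\xi^V(L)(w)$, be the momentum map. Let $\mu\in\mathfrak g^*$, $N_\mu=p^{-1}(\mu)$, $G_\mu=\{g\in G: \langle \mathrm{Ad}_g\xi,\mu\rangle=\langle\xi,\mu\rangle\ \forall\xi\in\mathfrak g\}$ and $\mathfrak g_\mu=\{\xi\in\mathfrak g:\langle[\xi,\eta],\mu\rangle=0\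 \forall\eta\in\mathfrak g\}$. Assume that the restriction of $g$ to $N_\mu\times\mathfrak g_\mu$ is non-singular, that is, for every $w\in N_\mu$ the form $(\xi,\eta)\mapsto g_w(\tilde\xi,\tilde\eta)$ on $\mathfrak g_\mu$ is non-singular. Then $N_\mu$ is an embedded submanifold of $TM$ of codimension $\dim G$, and the closed subgroup $G_\mu$ acts on it freely, properly and by diffeomorphisms. Call a tangent vector $W\in T_wN_\mu$ horizontal if $g_w(\tilde\xi,\tau_*W)=0$ for all $\xi\in\mathfrak g_\mu$. The horizontal vectors are those of a unique principal connection on $N_\mu\to N_\mu/G_\mu$: there is exactly one smooth type $(1,1)$ tensor field $\Omega^{\mathrm{mech}}$ on $N_\mu$ which is at each point a projection operator whose image is the tangent space to the fibre (the $G_\mu$-orbit) and whose kernel is the space of horizontal vectors, and which is invariant under $G_\mu$. -/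

import Mathlib

open scoped Manifold ContDiff

namespace Routh

noncomputable section

/-! ### Principal connections -/

section Connection

variable {F : Type*} [NormedAddCommGroup F] [NormedSpace ℝ F]
  {N : Type*} [TopologicalSpace N] [ChartedSpace F N]

/-- The tangent space at `n` to the orbit of `n` under a group `K`: the velocities at time `0`
of the curves through `n` which stay in the orbit. -/
def orbitTangent (K : Type*) [Group K] [MulAction K N] (n : N) :
    Set (TangentSpace 𝓘(ℝ, F) n) :=
  {v | ∃ γ : ℝ → N, γ 0 = n ∧ (∀ t, γ t ∈ MulAction.orbit K n) ∧
    HasMFDerivAt 𝓘(ℝ, ℝ) 𝓘(ℝ, F) γ 0 (ContinuousLinearMap.toSpanSingleton ℝ (v : F))}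

/-- A principal connection on `N → N/K`, seen as a smooth type `(1,1)` tensor field `Ω` on `N`:
pointwise a projection operator, with image the tangent space to the fibre of `N → N/K`
(the `K`-orbit), and invariant under the action of `K`. -/
structure IsPrincipalConnection [IsManifold 𝓘(ℝ, F) ∞ N] (K : Type*) [Group K] [MulAction K N]
    (Ω : ∀ n : N, TangentSpace 𝓘(ℝ, F) n →L[ℝ] TangentSpace 𝓘(ℝ, F) n) : Prop where
  smooth : ContMDiff 𝓘(ℝ, F).tangent 𝓘(ℝ, F).tangent ∞
    (fun W : TangentBundle 𝓘(ℝ, F) N =>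
      (⟨W.proj, Ω W.proj W.2⟩ : TangentBundle 𝓘(ℝ, F) N))
  projection : ∀ n W, Ω n (Ω n W) = Ω n W
  image : ∀ n, Set.range (Ω n) = orbitTangent K n
  invariant : ∀ (k : K) (n : N) (W : TangentSpace 𝓘(ℝ, F) n),
    mfderiv 𝓘(ℝ, F) 𝓘(ℝ, F) (fun x : N => k • x) n (Ω n W) =
      Ω (k • n) (mfderiv 𝓘(ℝ, F) 𝓘(ℝ, F) (fun x : N => k • x) n W)

end Connection

/-! ### The adjoint and coadjoint actions -/

section Adjoint

variable {EG : Type*} [NormedAddCommGroup EG] [NormedSpace ℝ EG]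
  {G : Type*} [TopologicalSpace G] [ChartedSpace EG G] [Group G]

/-- The adjoint action of `g` on the Lie algebra. -/
def Ad (g : G) : GroupLieAlgebra 𝓘(ℝ, EG) G →L[ℝ] GroupLieAlgebra 𝓘(ℝ, EG) G :=
  mfderiv 𝓘(ℝ, EG) 𝓘(ℝ, EG) (fun h : G => g * h * g⁻¹) 1

/-- The isotropy algebra `𝔤_μ`: all `ξ` with `⟨[ξ, η], μ⟩ = 0` for every `η`. -/
def isotropyAlgebra (μ : Module.Dual ℝ (GroupLieAlgebra 𝓘(ℝ, EG) G)) :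
    Set (GroupLieAlgebra 𝓘(ℝ, EG) G) :=
  {ξ | ∀ η : GroupLieAlgebra 𝓘(ℝ, EG) G, μ ⁅ξ, η⁆ = 0}

theorem Ad_one (ξ : GroupLieAlgebra 𝓘(ℝ, EG) G) : Ad (1 : G) ξ = ξ := by
  have h : (fun h : G => 1 * h * 1⁻¹) = id := by ext; simp
  rw [Ad, h, mfderiv_id]
  rfl

variable [LieGroup 𝓘(ℝ, EG) ∞ G]

theorem contMDiff_conj (g : G) :
    ContMDiff 𝓘(ℝ, EG) 𝓘(ℝ, EG) ∞ (fun h : G => g * h * g⁻¹) :=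
  (contMDiff_const.mul contMDiff_id).mul contMDiff_const

theorem Ad_mul (g k : G) (ξ : GroupLieAlgebra 𝓘(ℝ, EG) G) :
    Ad (g * k) ξ = Ad g (Ad k ξ) := by
  have h : (fun h : G => g * k * h * (g * k)⁻¹) =
      (fun h : G => g * h * g⁻¹) ∘ (fun h : G => k * h * k⁻¹) := by
    ext; simp [mul_assoc]
  have e : k * 1 * k⁻¹ = 1 := by simp
  rw [Ad, h, mfderiv_comp (I' := 𝓘(ℝ, EG)) (1 : G)
    ((contMDiff_conj g).mdifferentiable (by simp) _)
    ((contMDiff_conj k).mdifferentiable (by simp) _)]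
  have key : ∀ x : G, x = 1 → ∀ v : EG,
      (mfderiv 𝓘(ℝ, EG) 𝓘(ℝ, EG) (fun h : G => g * h * g⁻¹) x : EG →L[ℝ] EG) v =
        (mfderiv 𝓘(ℝ, EG) 𝓘(ℝ, EG) (fun h : G => g * h * g⁻¹) 1 : EG →L[ℝ] EG) v := by
    rintro x rfl v; rfl
  exact key _ e _

/-- The isotropy group `G_μ` of `μ` under the coadjoint action,
`⟨ξ, Ad*_g μ⟩ = ⟨Ad_g ξ, μ⟩`. -/
def isotropyGroup (μ : Module.Dual ℝ (GroupLieAlgebra 𝓘(ℝ, EG) G)) : Subgroup G where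
  carrier := {g | ∀ ξ, μ (Ad g ξ) = μ ξ}
  one_mem' ξ := by rw [Ad_one]
  mul_mem' {a b} ha hb ξ := by rw [Ad_mul, ha, hb]
  inv_mem' {a} ha ξ := by rw [← ha (Ad a⁻¹ ξ), ← Ad_mul, mul_inv_cancel, Ad_one]

end Adjoint

/-! ### Lagrangians on the tangent bundle -/

section Lagrangian

variable {EG : Type*} [NormedAddCommGroup EG] [NormedSpace ℝ EG]
  {G : Type*} [TopologicalSpace G] [ChartedSpace EG G] [Group G]
  {E : Type*} [NormedAddCommGroup E] [NormedSpace ℝ E]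
  {M : Type*} [TopologicalSpace M] [ChartedSpace E M] [IsManifold 𝓘(ℝ, E) ∞ M]

/-- The derivative of `f : TM → ℝ` at `w` along the vertical lift of `v ∈ T_m M`, `m = τ(w)`. -/
def verticalDeriv (f : TangentBundle 𝓘(ℝ, E) M → ℝ) (w : TangentBundle 𝓘(ℝ, E) M)
    (v : TangentSpace 𝓘(ℝ, E) w.proj) : ℝ :=
  deriv (fun t : ℝ => f ⟨w.proj, w.2 + t • v⟩) 0

/-- The Hessian `g_w(u, v) = u^V v^V (L)` of `L` at `w ∈ TM`, for `u, v ∈ T_m M`, `m = τ(w)`. -/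
def hessian (L : TangentBundle 𝓘(ℝ, E) M → ℝ) (w : TangentBundle 𝓘(ℝ, E) M)
    (u v : TangentSpace 𝓘(ℝ, E) w.proj) : ℝ :=
  deriv (fun s : ℝ => verticalDeriv L ⟨w.proj, w.2 + s • u⟩ v) 0

variable [MulAction G M]

/-- The value at `m` of the fundamental vector field of `ξ`, the infinitesimal generator of the
transformations `m ↦ exp(tξ) • m`. -/
def fundamentalField (E : Type*) [NormedAddCommGroup E] [NormedSpace ℝ E]
    {M : Type*} [TopologicalSpace M] [ChartedSpace E M] [MulAction G M]
    (ξ : GroupLieAlgebra 𝓘(ℝ, EG) G) (m : M) : TangentSpace 𝓘(ℝ, E) m :=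
  mfderiv 𝓘(ℝ, EG) 𝓘(ℝ, E) (fun g : G => g • m) 1 ξ

/-- The component along `ξ` of the momentum of `L` at `w`. -/
def momentum (L : TangentBundle 𝓘(ℝ, E) M → ℝ) (w : TangentBundle 𝓘(ℝ, E) M)
    (ξ : GroupLieAlgebra 𝓘(ℝ, EG) G) : ℝ :=
  verticalDeriv L w (fundamentalField E ξ w.proj)

/-- The level set `N_μ ⊆ TM` of the momentum. -/
def momentumLevel (L : TangentBundle 𝓘(ℝ, E) M → ℝ)
    (μ : Module.Dual ℝ (GroupLieAlgebra 𝓘(ℝ, EG) G)) : Set (TangentBundle 𝓘(ℝ, E) M) :=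
  {w | ∀ ξ, momentum L w ξ = μ ξ}

/-- Invariance of `L` under the induced action of `G` on `TM`. -/
def IsInvariant (G : Type*) [Group G] {E : Type*} [NormedAddCommGroup E] [NormedSpace ℝ E]
    {M : Type*} [TopologicalSpace M] [ChartedSpace E M] [MulAction G M]
    (L : TangentBundle 𝓘(ℝ, E) M → ℝ) : Prop :=
  ∀ (g : G) (w : TangentBundle 𝓘(ℝ, E) M),
    L (tangentMap 𝓘(ℝ, E) 𝓘(ℝ, E) (fun m : M => g • m) w) = L w

end Lagrangian

/-! ### The action of `G_μ` on `N_μ` -/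

section Action

variable {EG : Type*} [NormedAddCommGroup EG] [NormedSpace ℝ EG]
  {G : Type*} [TopologicalSpace G] [ChartedSpace EG G] [Group G] [LieGroup 𝓘(ℝ, EG) ∞ G]
  {E : Type*} [NormedAddCommGroup E] [NormedSpace ℝ E]
  {M : Type*} [TopologicalSpace M] [ChartedSpace E M] [IsManifold 𝓘(ℝ, E) ∞ M]
  [MulAction G M] [ContMDiffSMul 𝓘(ℝ, EG) 𝓘(ℝ, E) ∞ G M]

theorem mdifferentiable_smul (EG : Type*) [NormedAddCommGroup EG] [NormedSpace ℝ EG]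
    {G : Type*} [TopologicalSpace G] [ChartedSpace EG G] [Group G]
    {E : Type*} [NormedAddCommGroup E] [NormedSpace ℝ E]
    {M : Type*} [TopologicalSpace M] [ChartedSpace E M]
    [MulAction G M] [ContMDiffSMul 𝓘(ℝ, EG) 𝓘(ℝ, E) ∞ G M] (g : G) :
    MDifferentiable 𝓘(ℝ, E) 𝓘(ℝ, E) (fun m : M => g • m) :=
  (ContMDiffSMul.contMDiff_const_smul (I := 𝓘(ℝ, EG)) (n := ∞) g).mdifferentiable (by simp)

theorem mdifferentiable_orbit (EG : Type*) [NormedAddCommGroup EG] [NormedSpace ℝ EG]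
    {G : Type*} [TopologicalSpace G] [ChartedSpace EG G] [Group G]
    {E : Type*} [NormedAddCommGroup E] [NormedSpace ℝ E]
    {M : Type*} [TopologicalSpace M] [ChartedSpace E M]
    [MulAction G M] [ContMDiffSMul 𝓘(ℝ, EG) 𝓘(ℝ, E) ∞ G M] (m : M) :
    MDifferentiable 𝓘(ℝ, EG) 𝓘(ℝ, E) (fun g : G => g • m) :=
  (ContMDiff.smul (I := 𝓘(ℝ, EG)) (n := ∞) contMDiff_id contMDiff_const).mdifferentiable
    (by simp)

/-- `Tψ_g (ξ̃(m))` is the value at `g • m` of the fundamental vector field of `Ad_g ξ`. -/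
theorem mfderiv_fundamentalField (g : G) (ξ : GroupLieAlgebra 𝓘(ℝ, EG) G) (m : M) :
    mfderiv 𝓘(ℝ, E) 𝓘(ℝ, E) (fun x : M => g • x) m (fundamentalField E ξ m) =
      fundamentalField E (Ad g ξ) (g • m) := by
  have h : (fun x : M => g • x) ∘ (fun k : G => k • m) =
      (fun k : G => k • (g • m)) ∘ (fun k : G => g * k * g⁻¹) := by
    ext k; simp [mul_smul]
  have h1 := mfderiv_comp (I' := 𝓘(ℝ, E)) (1 : G)
    (mdifferentiable_smul (M := M) (E := E) EG g ((1 : G) • m))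
    (mdifferentiable_orbit (E := E) EG m (1 : G))
  have h2 := mfderiv_comp (I' := 𝓘(ℝ, EG)) (1 : G)
    (mdifferentiable_orbit (E := E) EG (g • m) (g * 1 * g⁻¹))
    ((contMDiff_conj (EG := EG) g).mdifferentiable (by simp) 1)
  have h0 : (mfderiv 𝓘(ℝ, EG) 𝓘(ℝ, E) ((fun x : M => g • x) ∘ (fun k : G => k • m)) 1 :
      EG →L[ℝ] E) = (mfderiv 𝓘(ℝ, EG) 𝓘(ℝ, E)
        ((fun k : G => k • (g • m)) ∘ (fun k : G => g * k * g⁻¹)) 1 : EG →L[ℝ] E) := by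
    rw [h]
  have h3 := Eq.trans (Eq.symm h1) (Eq.trans h0 h2)
  have k1 : ∀ x : M, x = m → ∀ v : E,
      (mfderiv 𝓘(ℝ, E) 𝓘(ℝ, E) (fun y : M => g • y) x : E →L[ℝ] E) v =
        (mfderiv 𝓘(ℝ, E) 𝓘(ℝ, E) (fun y : M => g • y) m : E →L[ℝ] E) v := by
    rintro x rfl v; rfl
  have k2 : ∀ x : G, x = 1 → ∀ v : EG,
      (mfderiv 𝓘(ℝ, EG) 𝓘(ℝ, E) (fun k : G => k • (g • m)) x : EG →L[ℝ] E) v =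
        (mfderiv 𝓘(ℝ, EG) 𝓘(ℝ, E) (fun k : G => k • (g • m)) 1 : EG →L[ℝ] E) v := by
    rintro x rfl v; rfl
  have h4 := DFunLike.congr_fun h3 ξ
  exact (k1 _ (one_smul G m) _).symm.trans (h4.trans (k2 _ (by simp) _))

/-- The level set `N_μ` is invariant under `G_μ`. -/
theorem tangentMap_mem_momentumLevel {L : TangentBundle 𝓘(ℝ, E) M → ℝ} (hL : IsInvariant G L)
    (μ : Module.Dual ℝ (GroupLieAlgebra 𝓘(ℝ, EG) G)) {g : G} (hg : g ∈ isotropyGroup μ)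
    {w : TangentBundle 𝓘(ℝ, E) M} (hw : w ∈ momentumLevel L μ) :
    tangentMap 𝓘(ℝ, E) 𝓘(ℝ, E) (fun m : M => g • m) w ∈ momentumLevel L μ := by
  intro ξ
  have h1 : ξ = Ad g (Ad g⁻¹ ξ) := by rw [← Ad_mul, mul_inv_cancel, Ad_one]
  have h2 : momentum L (tangentMap 𝓘(ℝ, E) 𝓘(ℝ, E) (fun m : M => g • m) w) ξ =
      momentum L w (Ad g⁻¹ ξ) := by
    unfold momentum verticalDeriv
    congr 1
    ext t
    refine Eq.trans ?_ (hL g _)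
    have h3 := mfderiv_fundamentalField (E := E) g (Ad g⁻¹ ξ) w.proj
    rw [← h1] at h3
    refine congrArg (fun v : E => L ⟨g • w.proj, v⟩) ?_
    let A : E →L[ℝ] E := mfderiv 𝓘(ℝ, E) 𝓘(ℝ, E) (fun x : M => g • x) w.proj
    have h4 : A w.2 + t • A (fundamentalField E (Ad g⁻¹ ξ) w.proj) =
        A (w.2 + t • fundamentalField E (Ad g⁻¹ ξ) w.proj) := by
      have h5 : ∀ a b : E, A a + t • A b = A (a + t • b) := fun a b => by
        rw [map_add, map_smul]
      exact h5 _ _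
    exact (congrArg (fun v : E => A w.2 + t • v) h3.symm).trans h4
  rw [h2, hw]
  exact (isotropyGroup μ).inv_mem hg ξ

/-- The action of `G_μ` on `N_μ`, the restriction of the induced action of `G` on `TM`. -/
@[reducible]
def isotropyAction (L : TangentBundle 𝓘(ℝ, E) M → ℝ) (hL : IsInvariant G L)
    (μ : Module.Dual ℝ (GroupLieAlgebra 𝓘(ℝ, EG) G)) :
    MulAction (isotropyGroup μ) (momentumLevel L μ) where
  smul g w := ⟨tangentMap 𝓘(ℝ, E) 𝓘(ℝ, E) (fun m : M => (g : G) • m) w,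
    tangentMap_mem_momentumLevel hL μ g.2 w.2⟩
  one_smul w := by
    apply Subtype.ext
    have h : (fun m : M => ((1 : isotropyGroup μ) : G) • m) = id := by ext; simp
    change tangentMap _ _ (fun m : M => ((1 : isotropyGroup μ) : G) • m) w.1 = w.1
    rw [h, tangentMap_id]
    rfl
  mul_smul a b w := by
    apply Subtype.ext
    have h : (fun m : M => ((a * b : isotropyGroup μ) : G) • m) =
        (fun m : M => (a : G) • m) ∘ (fun m : M => (b : G) • m) := by ext; simp [mul_smul]
    change tangentMap _ _ (fun m : M => ((a * b : isotropyGroup μ) : G) • m) w.1 =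
      tangentMap _ _ (fun m : M => (a : G) • m) (tangentMap _ _ (fun m : M => (b : G) • m) w.1)
    rw [h, tangentMap_comp_at (I' := 𝓘(ℝ, E)) w.1
      (mdifferentiable_smul EG (a : G) _) (mdifferentiable_smul EG (b : G) _)]

/-- A tangent vector `W` to `N_μ` at `n` is horizontal if `g(ξ̃, τ_* W) = 0` for all
`ξ ∈ 𝔤_μ`. -/
def IsHorizontal {F : Type*} [NormedAddCommGroup F] [NormedSpace ℝ F]
    (L : TangentBundle 𝓘(ℝ, E) M → ℝ) (μ : Module.Dual ℝ (GroupLieAlgebra 𝓘(ℝ, EG) G))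
    [ChartedSpace F (momentumLevel L μ)] (n : momentumLevel L μ)
    (W : TangentSpace 𝓘(ℝ, F) n) : Prop :=
  ∀ ξ ∈ isotropyAlgebra μ,
    hessian L n.1 (fundamentalField E ξ n.1.proj)
      (mfderiv 𝓘(ℝ, F) 𝓘(ℝ, E) (fun x : momentumLevel L μ => x.1.proj) n W) = 0

end Action

end

end Routh

/-! Along the vertical lift of `v` at `w` the component of the momentum along `ξ` changes at the
rate `g_w(v, ξ̃)`. Non-singularity of `g` on `𝔤` therefore makes the derivative of the momentum
surjective already on vertical lifts of fundamental vectors, and `N_μ` is a regular level set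
(`surjective_mfderiv_momentumMap`, `exists_isSmoothEmbedding_momentumLevel`). Freeness and
properness pass from `M` to `N_μ` because the projection to `M` is equivariant and `G_μ` is closed.

Let `w ∈ N_μ` lie over `m`. Since `g_w` is non-singular on `𝔤_μ`, each `u ∈ T_mM` determines a
unique `ξ ∈ 𝔤_μ` with `g_w(η̃, ξ̃) = g_w(η̃, u)` for all `η ∈ 𝔤_μ` (`isotropyComponent`). The
connection sends `W` to the fundamental vector on `TM` of the element attached to `τ_* W`. This
vanishes exactly when `W` is horizontal, because `ξ ↦ ξ̃` is injective. Solving the linear system by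
Cramer's rule shows smooth dependence on `W`. Invariance of `g` and of `𝔤_μ` under `G_μ` makes
horizontality invariant, and a projection is determined by its range and kernel, which gives both
invariance and uniqueness.

What remains is that the tangent space to a `G_μ`-orbit consists of the fundamental vectors of
`𝔤_μ`. This rests on the identity that `g ↦ Ad_g η` has derivative `ξ ↦ [ξ, η]` at the unit
(`mfderiv_Ad_apply`), proved by differentiating `L_g = R_g ∘ c_g` in a chart, where `c_g` is
conjugation by `g`. With it, integral curves of right invariant fields of elements of `𝔤_μ` stay in
`G_μ` (`exists_curve_isotropyGroup`). Conversely, a curve in an orbit lifts to a curve in `G_μ`: the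
lift is continuous because the orbit map of a free proper action is a closed embedding, and
differentiable because that map is an immersion (`exists_inclusionDeriv_of_mem_orbitTangent`). No
manifold structure on `G_μ` is used. -/

namespace Routh

open scoped Topology
open Set Filter Bundle Topology

/-! ### Partial tangent maps and smoothness along fibres of a tangent bundle. -/

section PartialTangent

variable {EX : Type*} [NormedAddCommGroup EX] [NormedSpace ℝ EX] {HX : Type*} [TopologicalSpace HX]
  {I : ModelWithCorners ℝ EX HX} {X : Type*} [TopologicalSpace X] [ChartedSpace HX X]
  {EY : Type*} [NormedAddCommGroup EY] [NormedSpace ℝ EY] {HY : Type*} [TopologicalSpace HY]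
  {J : ModelWithCorners ℝ EY HY} {Y : Type*} [TopologicalSpace Y] [ChartedSpace HY Y]
  {EZ : Type*} [NormedAddCommGroup EZ] [NormedSpace ℝ EZ] {HZ : Type*} [TopologicalSpace HZ]
  {K : ModelWithCorners ℝ EZ HZ} {Z : Type*} [TopologicalSpace Z] [ChartedSpace HZ Z]

/-- The tangent map of a smooth map of two variables, in the second variable, depends smoothly
on the first variable and on the tangent vector. -/
theorem contMDiff_tangentMap_right [IsManifold I ∞ X] [IsManifold J ∞ Y] [IsManifold K ∞ Z]
    {f : X × Y → Z} (hf : ContMDiff (I.prod J) K ∞ f) :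
    ContMDiff (I.prod J.tangent) K.tangent ∞
      (fun p : X × TangentBundle J Y => tangentMap J K (fun y => f (p.1, y)) p.2) := by
  have : IsManifold I 1 X := IsManifold.of_le (n := ∞) (by simp)
  have : IsManifold J 1 Y := IsManifold.of_le (n := ∞) (by simp)
  have : IsManifold K 1 Z := IsManifold.of_le (n := ∞) (by simp)
  -- The partial tangent map is the full tangent map of `f` evaluated on pairs `(0, v)`, so
  -- smoothness comes from the zero section of the first factor.
  have h1 : ContMDiff (I.prod J.tangent) (I.tangent.prod J.tangent) ∞
      (fun p : X × TangentBundle J Y => ((⟨p.1, 0⟩ : TangentBundle I X), p.2)) :=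
    ((contMDiff_zeroSection ℝ (TangentSpace I : X → Type _)).comp contMDiff_fst).prodMk
      contMDiff_snd
  have h2 := (contMDiff_equivTangentBundleProd_symm (I := I) (M := X) (I' := J) (M' := Y)
    (n := ∞)).comp h1
  have h3 : ContMDiff (I.prod J).tangent K.tangent ∞ (tangentMap (I.prod J) K f) :=
    hf.contMDiff_tangentMap (m := ∞) (by simp)
  refine (h3.comp h2).congr ?_
  rintro ⟨x, y, v⟩
  simp only [Function.comp_apply, tangentMap, equivTangentBundleProd]
  have hd : MDifferentiableAt (I.prod J) K f (x, y) := hf.mdifferentiableAt (by simp)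
  congr 1
  let A : EX →L[ℝ] EZ := mfderiv I K (fun z => f (z, y)) x
  let B : EY →L[ℝ] EZ := mfderiv J K (fun z => f (x, z)) y
  let C : EX × EY →L[ℝ] EZ := mfderiv (I.prod J) K f (x, y)
  have h4 : ∀ u : EX × EY, C u = A u.1 + B u.2 := fun u => mfderiv_prod_eq_add_apply hd
  have h5 : ∀ u : EY, B u = C (0, u) := fun u => by rw [h4, map_zero, zero_add]
  exact h5 v

/-- A smooth map to a tangent bundle with values in one fibre is smooth as a map to the fibre. -/
theorem contMDiff_snd_of_proj_eq [IsManifold J ∞ Y] {F : X → TangentBundle J Y}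
    (hF : ContMDiff I J.tangent ∞ F) (y : Y) (hy : ∀ x, (F x).proj = y) :
    ContMDiff I 𝓘(ℝ, EY) ∞ (fun x => (F x).2 : X → EY) := by
  have : IsManifold J 1 Y := IsManifold.of_le (n := ∞) (by simp)
  -- On the fibre over `y` itself the preferred trivialization at `y` is the identity.
  have key : ∀ w : TangentBundle J Y, w.proj = y →
      (trivializationAt EY (TangentSpace J) y w).2 = (w.2 : EY) := by
    rintro ⟨y', v⟩ rfl
    exact tangentCoordChange_self (I := J) (mem_extChartAt_source (I := J) y')
  intro x
  have h := (contMDiffAt_totalSpace (F := EY) (E := (TangentSpace J : Y → Type _))).1 (hF x)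
  refine h.2.congr_of_eventuallyEq (Eventually.of_forall fun x' => ?_)
  have h2 := key _ (hy x')
  rw [← hy x] at h2
  exact h2.symm

/-- A smooth curve of tangent vectors at one point. -/
theorem contMDiff_mk_fibre [IsManifold J ∞ Y] (y : Y) :
    ContMDiff 𝓘(ℝ, EY) J.tangent ∞ (fun v : EY => (⟨y, v⟩ : TangentBundle J Y)) := by
  have : IsManifold J 1 Y := IsManifold.of_le (n := ∞) (by simp)
  intro v
  refine (contMDiffAt_totalSpace (F := EY) (E := (TangentSpace J : Y → Type _))).2
    ⟨contMDiffAt_const, ?_⟩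
  refine contMDiffAt_id.congr_of_eventuallyEq (Eventually.of_forall fun v' => ?_)
  exact tangentCoordChange_self (I := J) (mem_extChartAt_source (I := J) y)

end PartialTangent

/-! ### The derivative of the adjoint action is the Lie bracket. -/

section LieGroupAd

variable {EG : Type*} [NormedAddCommGroup EG] [NormedSpace ℝ EG]
  {G : Type*} [TopologicalSpace G] [ChartedSpace EG G] [Group G] [LieGroup 𝓘(ℝ, EG) ∞ G]

theorem contMDiff_Ad_apply (ξ : GroupLieAlgebra 𝓘(ℝ, EG) G) :
    ContMDiff (M' := EG) 𝓘(ℝ, EG) 𝓘(ℝ, EG) ∞ (fun g : G => Ad g ξ) := by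
  have hf : ContMDiff (𝓘(ℝ, EG).prod 𝓘(ℝ, EG)) 𝓘(ℝ, EG) ∞
      (fun p : G × G => p.1 * p.2 * p.1⁻¹) :=
    (contMDiff_fst.mul contMDiff_snd).mul (contMDiff_fst.inv)
  have h := (contMDiff_tangentMap_right hf).comp
    ((contMDiff_id (M := G) (I := 𝓘(ℝ, EG))).prodMk
      (contMDiff_const (c := (⟨1, ξ⟩ : TangentBundle 𝓘(ℝ, EG) G))))
  exact contMDiff_snd_of_proj_eq h 1 (fun g => by simp [tangentMap])

end LieGroupAd

/-- The infinitesimal form of `L_x = R_x ∘ c_x` for a local product `m` with unit `x₀`: the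
derivative of the conjugation `c` is a bracket of left invariant vector fields. -/
theorem hasFDerivAt_conj_eq_sub {E : Type*} [NormedAddCommGroup E] [NormedSpace ℝ E]
    {m : E × E → E} {x₀ : E} (hm : ContDiffAt ℝ ∞ m (x₀, x₀))
    (hm1 : ∀ u, fderiv ℝ m (x₀, x₀) (u, 0) = u) {A : E → E} {A' : E →L[ℝ] E} {η : E}
    (hA : HasFDerivAt A A' x₀) (hA0 : A x₀ = η)
    (h : ∀ᶠ x in 𝓝 x₀, fderiv ℝ m (x, x₀) (0, η) = fderiv ℝ m (x₀, x) (A x, 0)) (ξ : E) :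
    A' ξ = fderiv ℝ (fun x => fderiv ℝ m (x, x₀) (0, η)) x₀ ξ -
      fderiv ℝ (fun x => fderiv ℝ m (x, x₀) (0, ξ)) x₀ η := by
  have hd : DifferentiableAt ℝ (fderiv ℝ m) (x₀, x₀) :=
    (hm.fderiv_right (m := 1) (by norm_cast)).differentiableAt (by simp)
  set D := fderiv ℝ (fderiv ℝ m) (x₀, x₀) with hD
  have hsymm : ∀ u v, D u v = D v u := (hm.isSymmSndFDerivAt (by simp only [minSmoothness_of_isRCLikeNormedField]; norm_cast)).eq
  have h1 : HasFDerivAt (fun x : E => (x, x₀)) (ContinuousLinearMap.inl ℝ E E) x₀ :=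
    hasFDerivAt_prodMk_left x₀ x₀
  have h2 : HasFDerivAt (fun x : E => (x₀, x)) (ContinuousLinearMap.inr ℝ E E) x₀ :=
    hasFDerivAt_prodMk_right x₀ x₀
  have hd1 : HasFDerivAt (fun x => fderiv ℝ m (x, x₀)) (D ∘L ContinuousLinearMap.inl ℝ E E) x₀ :=
    HasFDerivAt.comp (g := fderiv ℝ m) (f := fun x : E => (x, x₀)) x₀ hd.hasFDerivAt h1
  have hd2 : HasFDerivAt (fun x => fderiv ℝ m (x₀, x)) (D ∘L ContinuousLinearMap.inr ℝ E E) x₀ :=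
    HasFDerivAt.comp (g := fderiv ℝ m) (f := fun x : E => (x₀, x)) x₀ hd.hasFDerivAt h2
  have e1 : ∀ u v : E, fderiv ℝ (fun x => fderiv ℝ m (x, x₀) (0, u)) x₀ v = D (v, 0) (0, u) := by
    intro u v
    rw [(hd1.clm_apply (hasFDerivAt_const (0, u) x₀)).fderiv]
    simp
  have hA1 : HasFDerivAt (fun x => (A x, (0 : E))) (A'.prod (0 : E →L[ℝ] E)) x₀ :=
    hA.prodMk (hasFDerivAt_const 0 x₀)
  -- Product rule on the right side of `h`: one term differentiates `A`, with `∂₁m` equal to the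
  -- identity at the unit; the other differentiates `∂₁m`.
  have e2 : fderiv ℝ (fun x => fderiv ℝ m (x, x₀) (0, η)) x₀ ξ = A' ξ + D (0, ξ) (η, 0) := by
    rw [Filter.EventuallyEq.fderiv_eq h, (hd2.clm_apply hA1).fderiv]
    simp [hm1, hA0]
  -- Symmetry of the second derivative identifies the leftover mixed term with the derivative of `x
  -- ↦ ∂₂m(x, x₀) ξ` along `η`.
  rw [e2, e1, hsymm (η, 0)]
  simp

section Bracket

variable {EG : Type*} [NormedAddCommGroup EG] [NormedSpace ℝ EG]
  {G : Type*} [TopologicalSpace G] [ChartedSpace EG G] [Group G] [LieGroup 𝓘(ℝ, EG) ∞ G]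

/-- The product of a Lie group in the chart at the unit. -/
noncomputable def chartMul (EG G : Type*) [NormedAddCommGroup EG] [NormedSpace ℝ EG]
    [TopologicalSpace G] [ChartedSpace EG G] [Group G] (p : EG × EG) : EG :=
  extChartAt 𝓘(ℝ, EG) (1 : G)
    ((extChartAt 𝓘(ℝ, EG) (1 : G)).symm p.1 * (extChartAt 𝓘(ℝ, EG) (1 : G)).symm p.2)

theorem contDiffAt_chartMul :
    ContDiffAt ℝ ∞ (chartMul EG G)
      (extChartAt 𝓘(ℝ, EG) (1 : G) 1, extChartAt 𝓘(ℝ, EG) (1 : G) 1) := by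
  have : IsManifold 𝓘(ℝ, EG) ∞ G := inferInstance
  rw [← contMDiffAt_iff_contDiffAt]
  have h1 : ContMDiffAt 𝓘(ℝ, EG) 𝓘(ℝ, EG) ∞ (extChartAt 𝓘(ℝ, EG) (1 : G)).symm
      (extChartAt 𝓘(ℝ, EG) (1 : G) 1) :=
    (contMDiffOn_extChartAt_symm (1 : G)).contMDiffAt
      (extChartAt_target_mem_nhds (I := 𝓘(ℝ, EG)) (1 : G))
  have h2 : ContMDiffAt 𝓘(ℝ, EG) 𝓘(ℝ, EG) ∞ (extChartAt 𝓘(ℝ, EG) (1 : G)) 1 :=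
    contMDiffAt_extChartAt
  have e : (extChartAt 𝓘(ℝ, EG) (1 : G)).symm (extChartAt 𝓘(ℝ, EG) (1 : G) 1) = 1 :=
    extChartAt_to_inv (I := 𝓘(ℝ, EG)) (1 : G)
  have h3 : ContMDiffAt 𝓘(ℝ, EG × EG) 𝓘(ℝ, EG) ∞
      (fun p : EG × EG => (extChartAt 𝓘(ℝ, EG) (1 : G)).symm p.1 *
        (extChartAt 𝓘(ℝ, EG) (1 : G)).symm p.2)
      (extChartAt 𝓘(ℝ, EG) (1 : G) 1, extChartAt 𝓘(ℝ, EG) (1 : G) 1) := by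
    refine ContMDiffAt.mul ?_ ?_
    · exact ContMDiffAt.comp _ h1 (contDiff_fst.contMDiff _)
    · exact ContMDiffAt.comp _ h1 (contDiff_snd.contMDiff _)
  refine ContMDiffAt.comp _ ?_ h3
  simpa [e] using h2

/-- For `g` in the domain of the chart `φ` at the unit, with coordinates `x`, the vector
`Tφ(TL_g η)` is a partial derivative of the product in coordinates. -/
theorem fderiv_chartMul_right {η : EG} :
    ∀ᶠ x in 𝓝 (extChartAt 𝓘(ℝ, EG) (1 : G) 1),
      fderiv ℝ (chartMul EG G) (x, extChartAt 𝓘(ℝ, EG) (1 : G) 1) (0, η) =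
        (mfderiv 𝓘(ℝ, EG) 𝓘(ℝ, EG) (fun h : G => extChartAt 𝓘(ℝ, EG) (1 : G)
          ((extChartAt 𝓘(ℝ, EG) (1 : G)).symm x * h)) 1 : EG →L[ℝ] EG) η := by
  have : IsManifold 𝓘(ℝ, EG) ∞ G := inferInstance
  have : IsManifold 𝓘(ℝ, EG) 1 G := IsManifold.of_le (n := ∞) (by simp)
  set φ := extChartAt 𝓘(ℝ, EG) (1 : G)
  have hc : Tendsto (fun x : EG => (x, φ 1)) (𝓝 (φ 1)) (𝓝 (φ 1, φ 1)) :=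
    (Continuous.prodMk_left (φ 1)).tendsto _
  have hev : ∀ᶠ x in 𝓝 (φ 1), DifferentiableAt ℝ (chartMul EG G) (x, φ 1) :=
    hc.eventually (((contDiffAt_chartMul (EG := EG) (G := G)).of_le
      (m := 1) (by simp)).eventually (by simp) |>.mono fun p hp => hp.differentiableAt (by simp))
  filter_upwards [hev] with x hx
  have h1 : HasFDerivAt (fun y => chartMul EG G (x, y))
      (fderiv ℝ (chartMul EG G) (x, φ 1) ∘L ContinuousLinearMap.inr ℝ EG EG) (φ 1) :=
    HasFDerivAt.comp (g := chartMul EG G) (f := fun y => (x, y)) (φ 1) hx.hasFDerivAt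
      (hasFDerivAt_prodMk_right x (φ 1))
  have h2 : MDifferentiableAt 𝓘(ℝ, EG) 𝓘(ℝ, EG) φ (1 : G) :=
    mdifferentiableAt_extChartAt (mem_chart_source EG (1 : G))
  -- Left translation by `φ.symm x`, read in the chart on the target, is a partial map of `chartMul`
  -- after `φ`; the derivative of `φ` at the unit is the identity.
  have h3 : (fun h : G => φ (φ.symm x * h)) =ᶠ[𝓝 1] (fun y => chartMul EG G (x, y)) ∘ φ := by
    filter_upwards [extChartAt_source_mem_nhds (I := 𝓘(ℝ, EG)) (1 : G)] with h hh
    simp only [chartMul, Function.comp_apply]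
    rw [(extChartAt 𝓘(ℝ, EG) (1 : G)).left_inv hh]
  rw [h3.mfderiv_eq]
  have h4 := mfderiv_comp (1 : G) h1.differentiableAt.mdifferentiableAt h2
  have h5 : mfderiv 𝓘(ℝ, EG) 𝓘(ℝ, EG) φ (1 : G) = ContinuousLinearMap.id ℝ _ :=
    mfderiv_extChartAt_self
  rw [h5, mfderiv_eq_fderiv, h1.fderiv] at h4
  refine Eq.trans ?_ (DFunLike.congr_fun h4 η).symm
  rfl

/-- Writing `g h = (g h g⁻¹) g` factors left translation through conjugation followed by right
translation; the derivative of the former at the unit is `Ad g`. Together with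
`fderiv_chartMul_right` this supplies the hypothesis `h` of `hasFDerivAt_conj_eq_sub`. -/
theorem fderiv_chartMul_left {η : EG} :
    ∀ᶠ x in 𝓝 (extChartAt 𝓘(ℝ, EG) (1 : G) 1),
      fderiv ℝ (chartMul EG G) (extChartAt 𝓘(ℝ, EG) (1 : G) 1, x)
          ((Ad ((extChartAt 𝓘(ℝ, EG) (1 : G)).symm x) η : EG), 0) =
        (mfderiv 𝓘(ℝ, EG) 𝓘(ℝ, EG) (fun h : G => extChartAt 𝓘(ℝ, EG) (1 : G)
          ((extChartAt 𝓘(ℝ, EG) (1 : G)).symm x * h)) 1 : EG →L[ℝ] EG) η := by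
  have : IsManifold 𝓘(ℝ, EG) ∞ G := inferInstance
  have : IsManifold 𝓘(ℝ, EG) 1 G := IsManifold.of_le (n := ∞) (by simp)
  set φ := extChartAt 𝓘(ℝ, EG) (1 : G)
  have hc : Tendsto (fun x : EG => (φ 1, x)) (𝓝 (φ 1)) (𝓝 (φ 1, φ 1)) :=
    (Continuous.prodMk_right (φ 1)).tendsto _
  have hev : ∀ᶠ x in 𝓝 (φ 1), DifferentiableAt ℝ (chartMul EG G) (φ 1, x) :=
    hc.eventually (((contDiffAt_chartMul (EG := EG) (G := G)).of_le
      (m := 1) (by simp)).eventually (by simp) |>.mono fun p hp => hp.differentiableAt (by simp))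
  filter_upwards [hev] with x hx
  set g := φ.symm x
  have h1 : HasFDerivAt (fun y => chartMul EG G (y, x))
      (fderiv ℝ (chartMul EG G) (φ 1, x) ∘L ContinuousLinearMap.inl ℝ EG EG) (φ 1) :=
    HasFDerivAt.comp (g := chartMul EG G) (f := fun y => (y, x)) (φ 1) hx.hasFDerivAt
      (hasFDerivAt_prodMk_left (φ 1) x)
  have h2 : MDifferentiableAt 𝓘(ℝ, EG) 𝓘(ℝ, EG) φ (1 : G) :=
    mdifferentiableAt_extChartAt (mem_chart_source EG (1 : G))
  have hcg : MDifferentiableAt 𝓘(ℝ, EG) 𝓘(ℝ, EG) (fun h : G => g * h * g⁻¹) 1 :=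
    (contMDiff_conj g).mdifferentiable (by simp) 1
  have e1 : g * 1 * g⁻¹ = 1 := by simp
  have h3 : (fun h : G => φ (g * h)) =ᶠ[𝓝 1]
      (fun y => chartMul EG G (y, x)) ∘ (φ ∘ (fun h : G => g * h * g⁻¹)) := by
    have : Tendsto (fun h : G => g * h * g⁻¹) (𝓝 1) (𝓝 1) := by
      have := hcg.continuousAt.tendsto
      rwa [e1] at this
    filter_upwards [this (extChartAt_source_mem_nhds (I := 𝓘(ℝ, EG)) (1 : G))] with h hh
    simp only [chartMul, Function.comp_apply]
    rw [(extChartAt 𝓘(ℝ, EG) (1 : G)).left_inv hh]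
    change _ = φ (g * h * g⁻¹ * g)
    simp
  have h2' : MDifferentiableAt 𝓘(ℝ, EG) 𝓘(ℝ, EG) φ (g * 1 * g⁻¹) := by rwa [e1]
  have h6 : mfderiv 𝓘(ℝ, EG) 𝓘(ℝ, EG) (φ ∘ (fun h : G => g * h * g⁻¹)) 1 η = Ad g η := by
    have h7 := mfderiv_comp_apply_of_eq (1 : G) h2 hcg e1 η
    refine h7.trans ?_
    have h5 : mfderiv 𝓘(ℝ, EG) 𝓘(ℝ, EG) φ (1 : G) = ContinuousLinearMap.id ℝ _ :=
      mfderiv_extChartAt_self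
    rw [h5]
    rfl
  rw [h3.mfderiv_eq]
  have h4 := mfderiv_comp_apply_of_eq (x := (1 : G)) (y := φ 1)
    (f := φ ∘ (fun h : G => g * h * g⁻¹)) (g := fun y => chartMul EG G (y, x))
    (I := 𝓘(ℝ, EG)) (I' := 𝓘(ℝ, EG)) (I'' := 𝓘(ℝ, EG))
    h1.differentiableAt.mdifferentiableAt (MDifferentiableAt.comp (g := φ) (f := fun h : G => g * h * g⁻¹) (1 : G) h2' hcg) (by simp) η
  rw [mfderiv_eq_fderiv, h1.fderiv] at h4
  refine Eq.trans ?_ h4.symm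
  have h8 : ∀ u v : EG, u = v → fderiv ℝ (chartMul EG G) (φ 1, x) (u, 0) =
    (fderiv ℝ (chartMul EG G) (φ 1, x) ∘L ContinuousLinearMap.inl ℝ EG EG) v := by
    rintro u v rfl; rfl
  exact h8 _ _ h6.symm

theorem fderiv_chartMul_unit (u : EG) :
    fderiv ℝ (chartMul EG G) (extChartAt 𝓘(ℝ, EG) (1 : G) 1, extChartAt 𝓘(ℝ, EG) (1 : G) 1)
      (u, 0) = u := by
  set φ := extChartAt 𝓘(ℝ, EG) (1 : G)
  have hx : DifferentiableAt ℝ (chartMul EG G) (φ 1, φ 1) :=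
    (contDiffAt_chartMul (EG := EG) (G := G)).differentiableAt (by simp)
  have h1 : HasFDerivAt (fun y => chartMul EG G (y, φ 1))
      (fderiv ℝ (chartMul EG G) (φ 1, φ 1) ∘L ContinuousLinearMap.inl ℝ EG EG) (φ 1) :=
    HasFDerivAt.comp (g := chartMul EG G) (f := fun y => (y, φ 1)) (φ 1) hx.hasFDerivAt
      (hasFDerivAt_prodMk_left (φ 1) (φ 1))
  have h2 : (fun y => chartMul EG G (y, φ 1)) =ᶠ[𝓝 (φ 1)] id := by
    filter_upwards [extChartAt_target_mem_nhds (I := 𝓘(ℝ, EG)) (1 : G)] with y hy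
    simp only [chartMul, id]
    rw [extChartAt_to_inv (I := 𝓘(ℝ, EG)) (1 : G), mul_one,
      (extChartAt 𝓘(ℝ, EG) (1 : G)).right_inv hy]
  have h3 := (hasFDerivAt_id (𝕜 := ℝ) (φ 1)).congr_of_eventuallyEq h2
  exact DFunLike.congr_fun (h1.unique h3) u

/-- The derivative of `g ↦ Ad_g η` at the unit is `ξ ↦ [ξ, η]`. -/
theorem mfderiv_Ad_apply (ξ η : GroupLieAlgebra 𝓘(ℝ, EG) G) :
    mfderiv (M' := EG) 𝓘(ℝ, EG) 𝓘(ℝ, EG) (fun g : G => Ad g η) 1 ξ = ⁅ξ, η⁆ := by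
  revert ξ η
  suffices H : ∀ ξ η : EG, (mfderiv (M' := EG) 𝓘(ℝ, EG) 𝓘(ℝ, EG) (fun g : G => Ad g η) 1 ξ : EG) =
      (⁅(show GroupLieAlgebra 𝓘(ℝ, EG) G from ξ), (show GroupLieAlgebra 𝓘(ℝ, EG) G from η)⁆ :
        GroupLieAlgebra 𝓘(ℝ, EG) G) from H
  intro ξ η
  have : IsManifold 𝓘(ℝ, EG) ∞ G := inferInstance
  have : IsManifold 𝓘(ℝ, EG) 1 G := IsManifold.of_le (n := ∞) (by simp)
  set φ := extChartAt 𝓘(ℝ, EG) (1 : G) with hφ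
  have hAd : MDifferentiableAt (M' := EG) 𝓘(ℝ, EG) 𝓘(ℝ, EG) (fun g : G => Ad g η) 1 :=
    (contMDiff_Ad_apply η).mdifferentiable (by simp) 1
  have hA : HasFDerivAt (F := EG) (fun x => Ad (φ.symm x) η)
      (mfderiv (M' := EG) 𝓘(ℝ, EG) 𝓘(ℝ, EG) (fun g : G => Ad g η) 1 : EG →L[ℝ] EG) (φ 1) := by
    have := hAd.hasMFDerivAt.2
    rw [modelWithCornersSelf_coe, range_id] at this
    exact hasFDerivWithinAt_univ.1 this
  have e : φ.symm (φ 1) = 1 := extChartAt_to_inv (I := 𝓘(ℝ, EG)) (1 : G)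
  have key := hasFDerivAt_conj_eq_sub (contDiffAt_chartMul (EG := EG) (G := G))
    fderiv_chartMul_unit hA (η := η) (by rw [e]; exact Ad_one η)
    (by
      filter_upwards [fderiv_chartMul_right (G := G) (η := η),
        fderiv_chartMul_left (G := G) (η := η)] with x h1 h2
      exact h1.trans h2.symm) ξ
  refine key.trans ?_
  -- In coordinates the left invariant field of `ζ` is `x ↦ ∂₂m(x, φ 1) ζ`, so the Lie bracket of
  -- two such fields is the right side of `key`.
  have hV : ∀ ζ : EG,
      (VectorField.mpullbackWithin 𝓘(ℝ, EG) 𝓘(ℝ, EG) φ.symm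
        (mulInvariantVectorField (G := G) (I := 𝓘(ℝ, EG)) ζ) (range 𝓘(ℝ, EG)) : EG → EG) =ᶠ[𝓝 (φ 1)]
      fun x => fderiv ℝ (chartMul EG G) (x, φ 1) (0, ζ) := by
    intro ζ
    filter_upwards [fderiv_chartMul_right (G := G) (η := ζ),
      extChartAt_target_mem_nhds (I := 𝓘(ℝ, EG)) (1 : G)] with x h1 hx
    refine Eq.trans ?_ h1.symm
    -- The pullback along `φ.symm` involves the inverse of its derivative, which is the derivative
    -- of `φ`.
    have hi := ContinuousLinearMap.inverse_eq
      (mfderivWithin_extChartAt_symm_comp_mfderiv_extChartAt hx)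
      (mfderiv_extChartAt_comp_mfderivWithin_extChartAt_symm hx)
    rw [VectorField.mpullbackWithin_apply]
    refine (DFunLike.congr_fun hi _).trans ?_
    have hs : φ.symm x ∈ (chartAt EG (1 : G)).source := by
      have := φ.map_target hx
      rwa [hφ, extChartAt_source] at this
    have h2 : MDifferentiableAt 𝓘(ℝ, EG) 𝓘(ℝ, EG) φ (φ.symm x) :=
      mdifferentiableAt_extChartAt hs
    exact (mfderiv_comp_apply_of_eq (f := fun h : G => φ.symm x * h) (1 : G) h2
      ((contMDiff_mul_left (I := 𝓘(ℝ, EG)) (n := ∞) (a := φ.symm x)).mdifferentiable (by simp) 1)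
      (by simp) ζ).symm
  have hV0 : ∀ ζ : EG,
      (VectorField.mpullbackWithin 𝓘(ℝ, EG) 𝓘(ℝ, EG) φ.symm
        (mulInvariantVectorField (G := G) (I := 𝓘(ℝ, EG)) ζ) (range 𝓘(ℝ, EG)) (φ 1) : EG) = ζ := by
    intro ζ
    have h : ∀ g : G, g = 1 → ((mfderivWithin 𝓘(ℝ, EG) 𝓘(ℝ, EG) φ.symm (range 𝓘(ℝ, EG))
        (φ 1)).inverse : EG →L[ℝ] EG)
        (mulInvariantVectorField (I := 𝓘(ℝ, EG)) ζ g) = ζ := by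
      rintro g rfl
      have h1 : mulInvariantVectorField (I := 𝓘(ℝ, EG)) ζ (1 : G) = ζ := by
        have : (fun h : G => 1 * h) = id := by ext; simp
        change mfderiv 𝓘(ℝ, EG) 𝓘(ℝ, EG) (fun h : G => 1 * h) 1 ζ = ζ
        rw [this, mfderiv_id]
        rfl
      exact (congrArg _ h1).trans (mfderivWithin_extChartAt_symm_inverse_apply (x := (1 : G)) ζ)
    exact h _ e
  rw [GroupLieAlgebra.bracket_def, VectorField.mlieBracket, VectorField.mlieBracketWithin_apply]
  rw [mfderiv_extChartAt_self]
  simp only [preimage_univ, univ_inter]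
  have hid : ∀ v : EG, (ContinuousLinearMap.id ℝ EG).inverse v = v := by simp
  refine Eq.symm ((hid _).trans ?_)
  rw [← hφ]
  have hl : ∀ V W : EG → EG, VectorField.lieBracketWithin ℝ V W (range 𝓘(ℝ, EG)) (φ 1) =
      fderiv ℝ W (φ 1) (V (φ 1)) - fderiv ℝ V (φ 1) (W (φ 1)) := by
    intro V W
    simp [VectorField.lieBracketWithin]
  refine (hl _ _).trans ?_
  rw [(hV ξ).fderiv_eq, (hV η).fderiv_eq]
  exact congrArg₂ (fun a b => fderiv ℝ (fun x => fderiv ℝ (chartMul EG G) (x, φ 1) (0, η))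
    (φ 1) a - fderiv ℝ (fun x => fderiv ℝ (chartMul EG G) (x, φ 1) (0, ξ)) (φ 1) b)
    (hV0 ξ) (hV0 η)

end Bracket

/-! ### Velocities of curves in manifolds. -/

section Velocity

variable {EX : Type*} [NormedAddCommGroup EX] [NormedSpace ℝ EX] {HX : Type*} [TopologicalSpace HX]
  {I : ModelWithCorners ℝ EX HX} {X : Type*} [TopologicalSpace X] [ChartedSpace HX X]
  {EY : Type*} [NormedAddCommGroup EY] [NormedSpace ℝ EY] {HY : Type*} [TopologicalSpace HY]
  {J : ModelWithCorners ℝ EY HY} {Y : Type*} [TopologicalSpace Y] [ChartedSpace HY Y]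

/-- The curve `γ` has velocity `v` at time `t`. -/
def HasVelocityAt (I : ModelWithCorners ℝ EX HX) (γ : ℝ → X) (t : ℝ) (v : EX) : Prop :=
  HasMFDerivAt 𝓘(ℝ, ℝ) I γ t (ContinuousLinearMap.toSpanSingleton ℝ v)

theorem HasVelocityAt.comp {γ : ℝ → X} {t : ℝ} {v : EX} (hγ : HasVelocityAt I γ t v) {x : X}
    (hx : γ t = x) {f : X → Y} (hf : MDifferentiableAt I J f x) :
    HasVelocityAt J (fun s => f (γ s)) t (mfderiv I J f x v) := by
  subst hx
  have h : HasMFDerivAt 𝓘(ℝ, ℝ) J (f ∘ γ) t _ := hf.hasMFDerivAt.comp t hγ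
  refine h.congr_mfderiv ?_
  let A : EX →L[ℝ] EY := mfderiv I J f (γ t)
  have h2 : A ∘L ContinuousLinearMap.toSpanSingleton ℝ v =
      ContinuousLinearMap.toSpanSingleton ℝ (A v) := by ext; simp
  exact h2

theorem HasVelocityAt.unique {γ : ℝ → X} {t : ℝ} {v v' : EX} (h : HasVelocityAt I γ t v)
    (h' : HasVelocityAt I γ t v') : v = v' := by
  have h1 := hasMFDerivAt_unique h h'
  have h2 : ContinuousLinearMap.toSpanSingleton ℝ v = ContinuousLinearMap.toSpanSingleton ℝ v' := h1
  simpa using DFunLike.congr_fun h2 1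

theorem HasVelocityAt.congr_of_eventuallyEq {γ γ' : ℝ → X} {t : ℝ} {v : EX}
    (h : HasVelocityAt I γ t v) (h' : γ' =ᶠ[𝓝 t] γ) : HasVelocityAt I γ' t v :=
  HasMFDerivAt.congr_of_eventuallyEq (f := γ) (f₁ := γ') h h'

theorem HasVelocityAt.continuousAt {γ : ℝ → X} {t : ℝ} {v : EX} (h : HasVelocityAt I γ t v) :
    ContinuousAt γ t :=
  HasMFDerivAt.continuousAt (f := γ) h

theorem hasVelocityAt_iff_hasDerivAt {γ : ℝ → EX} {t : ℝ} {v : EX} :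
    HasVelocityAt 𝓘(ℝ, EX) γ t v ↔ HasDerivAt γ v t :=
  hasMFDerivAt_iff_hasFDerivAt

end Velocity

/-! ### The isotropy group and the isotropy algebra as its space of velocities. -/

section Isotropy

variable {EG : Type*} [NormedAddCommGroup EG] [NormedSpace ℝ EG]
  {G : Type*} [TopologicalSpace G] [ChartedSpace EG G] [Group G] [LieGroup 𝓘(ℝ, EG) ∞ G]

/-- The value at `g` of the right invariant vector field of `ξ`. -/
noncomputable def rightInvariantField (ξ : GroupLieAlgebra 𝓘(ℝ, EG) G) (g : G) :
    TangentSpace 𝓘(ℝ, EG) g :=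
  mfderiv 𝓘(ℝ, EG) 𝓘(ℝ, EG) (fun h : G => h * g) 1 ξ

theorem contMDiff_rightInvariantField (ξ : GroupLieAlgebra 𝓘(ℝ, EG) G) :
    ContMDiff 𝓘(ℝ, EG) 𝓘(ℝ, EG).tangent ∞
      (fun g : G => (⟨g, rightInvariantField ξ g⟩ : TangentBundle 𝓘(ℝ, EG) G)) := by
  have hf : ContMDiff (𝓘(ℝ, EG).prod 𝓘(ℝ, EG)) 𝓘(ℝ, EG) ∞ (fun p : G × G => p.2 * p.1) :=
    contMDiff_snd.mul contMDiff_fst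
  refine ((contMDiff_tangentMap_right hf).comp
    ((contMDiff_id (M := G) (I := 𝓘(ℝ, EG))).prodMk
      (contMDiff_const (c := (⟨1, ξ⟩ : TangentBundle 𝓘(ℝ, EG) G))))).congr fun g => ?_
  have h : ∀ g' : G, g' = g → (⟨g, rightInvariantField ξ g⟩ : TangentBundle 𝓘(ℝ, EG) G) =
      ⟨g', (rightInvariantField ξ g : EG)⟩ := by
    rintro g' rfl; rfl
  exact h _ (one_mul g)

variable [FiniteDimensional ℝ EG] (μ : Module.Dual ℝ (GroupLieAlgebra 𝓘(ℝ, EG) G))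

theorem contDiff_dual : ContDiff ℝ ∞ (E := EG) (fun v => μ v) :=
  let μ' : EG →ₗ[ℝ] ℝ := μ
  (LinearMap.toContinuousLinearMap μ').contDiff

theorem contMDiff_dual_Ad (η : GroupLieAlgebra 𝓘(ℝ, EG) G) :
    ContMDiff 𝓘(ℝ, EG) 𝓘(ℝ, ℝ) ∞ (fun g : G => μ (Ad g η)) :=
  (contDiff_dual μ).contMDiff.comp (contMDiff_Ad_apply η)

theorem mfderiv_dual_Ad (ξ η : GroupLieAlgebra 𝓘(ℝ, EG) G) :
    mfderiv 𝓘(ℝ, EG) 𝓘(ℝ, ℝ) (fun g : G => μ (Ad g η)) 1 ξ = μ ⁅ξ, η⁆ := by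
  have h := mfderiv_comp_apply (M' := EG) (M'' := ℝ) (I := 𝓘(ℝ, EG)) (I' := 𝓘(ℝ, EG))
    (I'' := 𝓘(ℝ, ℝ)) (f := fun g : G => Ad g η) (g := fun v => μ v) 1
    ((contDiff_dual μ).contMDiff.mdifferentiable (by simp) _)
    ((contMDiff_Ad_apply η).mdifferentiable (by simp) 1) ξ
  refine h.trans ?_
  rw [mfderiv_Ad_apply ξ η]
  let μ' : EG →ₗ[ℝ] ℝ := μ
  have h1 := mfderiv_eq_fderiv (𝕜 := ℝ) (E := EG) (E' := ℝ) (f := fun v => μ' v) (x := (Ad (1 : G) η : EG))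
  exact DFunLike.congr_fun
    (h1.trans (LinearMap.toContinuousLinearMap μ').hasFDerivAt.fderiv) _

/-- Since `Ad (h * g) = Ad h ∘ Ad g`, the derivative at `g` along a right translate reduces to the
one at the unit with `η` replaced by `Ad g η`. -/
theorem mfderiv_dual_Ad_rightInvariantField (ξ η : GroupLieAlgebra 𝓘(ℝ, EG) G) (g : G) :
    mfderiv 𝓘(ℝ, EG) 𝓘(ℝ, ℝ) (fun g : G => μ (Ad g η)) g (rightInvariantField ξ g) =
      μ ⁅ξ, Ad g η⁆ := by
  have h := mfderiv_comp_apply_of_eq (I := 𝓘(ℝ, EG)) (I' := 𝓘(ℝ, EG)) (I'' := 𝓘(ℝ, ℝ))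
    (f := fun h : G => h * g) (g := fun g : G => μ (Ad g η)) (1 : G)
    ((contMDiff_dual_Ad μ η).mdifferentiable (by simp) g)
    ((contMDiff_mul_right (I := 𝓘(ℝ, EG)) (n := ∞) (a := g)).mdifferentiable (by simp) 1)
    (one_mul g) ξ
  have e : (fun g : G => μ (Ad g η)) ∘ (fun h : G => h * g) = fun h => μ (Ad h (Ad g η)) := by
    ext h; simp [Ad_mul]
  refine Eq.trans h.symm ?_
  rw [e]
  exact mfderiv_dual_Ad μ ξ (Ad g η)

theorem isClosed_isotropyGroup : IsClosed (isotropyGroup μ : Set G) := by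
  have : (isotropyGroup μ : Set G) = ⋂ ξ, {g | μ (Ad g ξ) = μ ξ} := by
    ext g; simp [isotropyGroup]
  rw [this]
  exact isClosed_iInter fun ξ => isClosed_eq (contMDiff_dual_Ad μ ξ).continuous continuous_const

/-- The isotropy algebra as a subspace. -/
noncomputable def isotropySubmodule : Submodule ℝ (GroupLieAlgebra 𝓘(ℝ, EG) G) where
  carrier := isotropyAlgebra μ
  -- For fixed `η`, the map `ξ ↦ μ ⁅ξ, η⁆` is the derivative of a function at the unit, hence
  -- linear.
  zero_mem' η := by exact (mfderiv_dual_Ad μ 0 η).symm.trans (map_zero _)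
  add_mem' {a b} ha hb η := by
    rw [← mfderiv_dual_Ad, map_add, mfderiv_dual_Ad, mfderiv_dual_Ad, ha, hb]
    exact add_zero (0 : ℝ)
  smul_mem' c a ha η := by
    rw [← mfderiv_dual_Ad, map_smul, mfderiv_dual_Ad, ha]
    exact mul_zero c

/-- The velocity at the unit of a curve in `G_μ` lies in `𝔤_μ`. -/
theorem mem_isotropyAlgebra_of_hasVelocityAt {γ : ℝ → G} {ξ : GroupLieAlgebra 𝓘(ℝ, EG) G}
    (h0 : γ 0 = 1) (hγ : ∀ᶠ t in 𝓝 0, γ t ∈ isotropyGroup μ)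
    (hd : HasVelocityAt 𝓘(ℝ, EG) γ 0 ξ) :
    ξ ∈ isotropyAlgebra μ := by
  intro η
  have h1 := hd.comp h0 ((contMDiff_dual_Ad μ η).mdifferentiable (by simp) 1)
  have h2 : HasVelocityAt 𝓘(ℝ, ℝ) (fun t => μ (Ad (γ t) η)) 0 0 :=
    (hasVelocityAt_iff_hasDerivAt.2 (hasDerivAt_const 0 (μ η))).congr_of_eventuallyEq (by
      filter_upwards [hγ] with t ht using ht η)
  rw [← mfderiv_dual_Ad]
  exact h1.unique h2

/-- Every element of `𝔤_μ` is the velocity at the unit of a curve in `G_μ`. -/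
theorem exists_curve_isotropyGroup {ξ : GroupLieAlgebra 𝓘(ℝ, EG) G}
    (hξ : ξ ∈ isotropyAlgebra μ) :
    ∃ γ : ℝ → G, γ 0 = 1 ∧ (∀ t, γ t ∈ isotropyGroup μ) ∧
      HasVelocityAt 𝓘(ℝ, EG) γ 0 ξ := by
  have : IsManifold 𝓘(ℝ, EG) ∞ G := inferInstance
  have : IsManifold 𝓘(ℝ, EG) 1 G := IsManifold.of_le (n := ∞) (by simp)
  have : CompleteSpace EG := FiniteDimensional.complete ℝ EG
  -- The right invariant field is chosen so that `ξ` stays in the first slot of the bracket: the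
  -- derivative of `μ (Ad (γ t) η)` is `μ ⁅ξ, Ad (γ t) η⁆`, which vanishes before it is known that
  -- `γ t` lies in `G_μ`.
  obtain ⟨γ, hγ0, hγ⟩ := exists_isMIntegralCurveAt_of_contMDiffAt_boundaryless (t₀ := 0)
    (((contMDiff_rightInvariantField ξ).of_le (m := 1) (by simp)).contMDiffAt (x := (1 : G)))
  obtain ⟨ε, hε, hball⟩ := Metric.eventually_nhds_iff_ball.1 hγ
  have hv : ∀ t ∈ Metric.ball (0 : ℝ) ε,
      HasVelocityAt 𝓘(ℝ, EG) γ t (rightInvariantField ξ (γ t)) := fun t ht =>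
    (hball t ht).congr_mfderiv (ContinuousLinearMap.ext_ring (by
      exact (one_smul ℝ _).trans (one_smul ℝ (rightInvariantField ξ (γ t) : EG)).symm))
  have h00 : (0 : ℝ) ∈ Metric.ball (0 : ℝ) ε := by simp [hε]
  have hmem : ∀ t ∈ Metric.ball (0 : ℝ) ε, γ t ∈ isotropyGroup μ := by
    intro t ht η
    have hder : ∀ t ∈ Metric.ball (0 : ℝ) ε, HasDerivAt (fun t => μ (Ad (γ t) η)) 0 t := by
      intro t ht
      have h1 := (hv t ht).comp rfl ((contMDiff_dual_Ad μ η).mdifferentiable (by simp) (γ t))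
      have h2 := (mfderiv_dual_Ad_rightInvariantField μ ξ η (γ t)).trans (hξ _)
      rw [← hasVelocityAt_iff_hasDerivAt]
      exact h2 ▸ h1
    have h3 := Metric.isOpen_ball.is_const_of_deriv_eq_zero (convex_ball (0 : ℝ) ε).isPreconnected
      (f := fun t => μ (Ad (γ t) η))
      (fun t ht => (hder t ht).differentiableAt.differentiableWithinAt)
      (fun t ht => (hder t ht).deriv) ht h00
    simpa [hγ0, Ad_one] using h3
  have hR : rightInvariantField ξ (γ 0) = (ξ : EG) := by
    rw [hγ0]
    have h1 : (fun h : G => h * 1) = id := by ext; simp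
    change mfderiv 𝓘(ℝ, EG) 𝓘(ℝ, EG) (fun h : G => h * 1) 1 ξ = ξ
    rw [h1, mfderiv_id]
    rfl
  classical
  -- The integral curve is only local; setting it to `1` elsewhere keeps all values in `G_μ` and
  -- leaves the velocity at `0` unchanged.
  refine ⟨fun t => if t ∈ Metric.ball (0 : ℝ) ε then γ t else 1, ?_, ?_, ?_⟩
  · simp [hε, hγ0]
  · intro t
    dsimp only
    split_ifs with h
    · exact hmem t h
    · exact one_mem _
  · have h1 := hv 0 h00
    rw [hR] at h1
    refine h1.congr_of_eventuallyEq ?_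
    filter_upwards [Metric.ball_mem_nhds (0 : ℝ) hε] with t ht
    exact if_pos ht

/-- Conjugation by `k` maps curves in `G_μ` through the unit to such curves, and acts on their
velocities by `Ad k`. -/
theorem Ad_mem_isotropyAlgebra {k : G} (hk : k ∈ isotropyGroup μ)
    {ξ : GroupLieAlgebra 𝓘(ℝ, EG) G} (hξ : ξ ∈ isotropyAlgebra μ) :
    Ad k ξ ∈ isotropyAlgebra μ := by
  obtain ⟨γ, h0, hmem, hd⟩ := exists_curve_isotropyGroup μ hξ
  exact mem_isotropyAlgebra_of_hasVelocityAt μ (γ := fun t => k * γ t * k⁻¹) (by simp [h0])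
    (Eventually.of_forall fun t => mul_mem (mul_mem hk (hmem t)) (inv_mem hk))
    (hd.comp h0 ((contMDiff_conj (EG := EG) k).mdifferentiable (by simp) 1))

end Isotropy

/-! ### Proper actions and separation. -/

/-- A closed subgroup acts properly on any Hausdorff space with an equivariant continuous map to a
space with a proper action. -/
theorem properSMul_of_equivariant {G M X : Type*} [Group G] [TopologicalSpace G]
    [TopologicalSpace M] [TopologicalSpace X] [MulAction G M] [ProperSMul G M] [T2Space X]
    {K : Subgroup G} (hK : IsClosed (K : Set G)) [MulAction K X] [ContinuousSMul K X] {f : X → M}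
    (hf : Continuous f) (hequiv : ∀ (k : K) (x : X), f (k • x) = (k : G) • f x) :
    ProperSMul K X := by
  rw [properSMul_iff_continuousSMul_ultrafilter_tendsto_t2]
  refine ⟨inferInstance, fun 𝒰 x₁ x₂ h => ?_⟩
  have hG := (properSMul_iff_continuousSMul_ultrafilter_tendsto (G := G) (X := M)).1 inferInstance
  have hm : Continuous (fun p : K × X => ((p.1 : G), f p.2)) := by fun_prop
  -- Pushing the ultrafilter to `G × M` and using properness there gives a limit of the group
  -- components; closedness of `K` keeps it in `K`.
  obtain ⟨g, -, hg⟩ := hG.2 (𝒰.map fun p : K × X => ((p.1 : G), f p.2)) (f x₁) (f x₂) (by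
    rw [Ultrafilter.coe_map, tendsto_map'_iff]
    have h2 := ((hf.prodMap hf).tendsto (x₁, x₂)).comp h
    refine h2.congr fun p => ?_
    simp [hequiv])
  rw [Ultrafilter.coe_map, tendsto_map'_iff] at hg
  have hgK : g ∈ K := hK.mem_of_tendsto hg (Eventually.of_forall fun p => p.1.2)
  exact ⟨⟨g, hgK⟩, tendsto_subtype_rng.2 hg⟩

/-- The orbit map of a free proper action is a closed embedding. -/
theorem isClosedEmbedding_orbitMap {G M : Type*} [Group G] [TopologicalSpace G]
    [TopologicalSpace M] [T1Space M] [MulAction G M] [ProperSMul G M]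
    (hfree : ∀ (g : G) (m : M), g • m = m → g = 1) (m : M) :
    IsClosedEmbedding (fun g : G => g • m) := by
  have h1 : IsProperMap (fun g : G => (g, m)) := by
    refine Topology.IsClosedEmbedding.isProperMap ⟨isEmbedding_prodMkLeft m, ?_⟩
    have : range (fun g : G => (g, m)) = univ ×ˢ {m} := by
      ext ⟨a, b⟩; simp [eq_comm]
    rw [this]
    exact isClosed_univ.prod isClosed_singleton
  have h2 := (ProperSMul.isProperMap_smul_pair (G := G) (X := M)).comp h1
  have hinj : Function.Injective (fun g : G => (g • m, m)) := by
    intro a b hab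
    have h3 : a • m = b • m := congrArg Prod.fst hab
    have h4 : (b⁻¹ * a) • m = m := by rw [mul_smul, h3, inv_smul_smul]
    exact (inv_mul_eq_one.1 (hfree _ _ h4)).symm
  have h5 : IsClosedEmbedding (fun g : G => (g • m, m)) :=
    .of_continuous_injective_isClosedMap h2.continuous hinj h2.isClosedMap
  -- Freeness and properness handle `g ↦ (g • m, m)`; its second coordinate is constant and can be
  -- dropped by composing with `x ↦ (x, m)`.
  have h6 : IsEmbedding (fun g : G => g • m) :=
    IsEmbedding.of_comp (h2.continuous.fst) (Continuous.prodMk_left m) h5.isEmbedding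
  refine ⟨h6, ?_⟩
  have h7 : range (fun g : G => g • m) = (fun x => (x, m)) ⁻¹' range (fun g : G => (g • m, m)) := by
    ext x; simp
  rw [h7]
  exact h5.isClosed_range.preimage (Continuous.prodMk_left m)

/-- Vectors over distinct points are separated by the base; vectors over the same point lie in one
trivialization, whose target is Hausdorff. -/
theorem t2Space_tangentBundle {E : Type*} [NormedAddCommGroup E] [NormedSpace ℝ E]
    {H : Type*} [TopologicalSpace H] {I : ModelWithCorners ℝ E H}
    {M : Type*} [TopologicalSpace M] [ChartedSpace H M] [IsManifold I 1 M] [T2Space M] :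
    T2Space (TangentBundle I M) := by
  refine ⟨fun w w' hne => ?_⟩
  have hπ : Continuous (fun w : TangentBundle I M => w.proj) :=
    FiberBundle.continuous_proj E (TangentSpace I)
  by_cases h : w.proj = w'.proj
  · let e := trivializationAt E (TangentSpace I) w.proj
    have hw : w ∈ e.source := e.mem_source.2 (mem_baseSet_trivializationAt E _ _)
    have hw' : w' ∈ e.source := e.mem_source.2 (h ▸ mem_baseSet_trivializationAt E _ _)
    have hne' : e w ≠ e w' := fun h' => hne (e.injOn hw hw' h')
    obtain ⟨u, v, hu, hv, hxu, hyv, huv⟩ := t2_separation hne'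
    exact ⟨_, _, e.continuousOn.isOpen_inter_preimage e.open_source hu,
      e.continuousOn.isOpen_inter_preimage e.open_source hv, ⟨hw, hxu⟩, ⟨hw', hyv⟩,
      (huv.preimage e).mono inter_subset_right inter_subset_right⟩
  · obtain ⟨u, v, hu, hv, hxu, hyv, huv⟩ := t2_separation h
    exact ⟨_, _, hu.preimage hπ, hv.preimage hπ, hxu, hyv, huv.preimage _⟩

/-! ### The induced action on `TM` and its fundamental fields. -/

section Action

set_option linter.unusedSectionVars false

variable {EG : Type*} [NormedAddCommGroup EG] [NormedSpace ℝ EG]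
  {G : Type*} [TopologicalSpace G] [ChartedSpace EG G] [Group G] [LieGroup 𝓘(ℝ, EG) ∞ G]
  {E : Type*} [NormedAddCommGroup E] [NormedSpace ℝ E]
  {M : Type*} [TopologicalSpace M] [ChartedSpace E M] [IsManifold 𝓘(ℝ, E) ∞ M]
  [MulAction G M] [ContMDiffSMul 𝓘(ℝ, EG) 𝓘(ℝ, E) ∞ G M]

/-- The induced action on `TM` of an action on `M`. -/
noncomputable def tangentSMul (E : Type*) [NormedAddCommGroup E] [NormedSpace ℝ E] {M : Type*}
    [TopologicalSpace M] [ChartedSpace E M] {G : Type*} [Group G] [MulAction G M] (g : G)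
    (w : TangentBundle 𝓘(ℝ, E) M) : TangentBundle 𝓘(ℝ, E) M :=
  tangentMap 𝓘(ℝ, E) 𝓘(ℝ, E) (fun m : M => g • m) w

theorem one_tangentSMul (w : TangentBundle 𝓘(ℝ, E) M) : tangentSMul E (1 : G) w = w := by
  have h : (fun m : M => (1 : G) • m) = id := by ext; simp
  rw [tangentSMul, h, tangentMap_id]
  rfl

theorem contMDiff_tangentSMul :
    ContMDiff (𝓘(ℝ, EG).prod 𝓘(ℝ, E).tangent) 𝓘(ℝ, E).tangent ∞
      (fun p : G × TangentBundle 𝓘(ℝ, E) M => tangentSMul E p.1 p.2) :=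
  contMDiff_tangentMap_right (f := fun p : G × M => p.1 • p.2) contMDiff_smul

/-- The value at `w` of the fundamental vector field of `ξ` for the action on `TM`. -/
noncomputable def tangentFundamentalField (ξ : GroupLieAlgebra 𝓘(ℝ, EG) G)
    (w : TangentBundle 𝓘(ℝ, E) M) : TangentSpace 𝓘(ℝ, E).tangent w :=
  (mfderiv 𝓘(ℝ, EG) 𝓘(ℝ, E).tangent (fun g : G => tangentSMul E g w) 1 ξ : E × E)

theorem contMDiff_tangentSMul_left (w : TangentBundle 𝓘(ℝ, E) M) :
    ContMDiff 𝓘(ℝ, EG) 𝓘(ℝ, E).tangent ∞ (fun g : G => tangentSMul E g w) :=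
  contMDiff_tangentSMul.comp (contMDiff_id.prodMk contMDiff_const)

theorem contMDiff_tangentSMul_right (EG : Type*) [NormedAddCommGroup EG] [NormedSpace ℝ EG]
    {G : Type*} [TopologicalSpace G] [ChartedSpace EG G] [Group G] [LieGroup 𝓘(ℝ, EG) ∞ G]
    [MulAction G M] [ContMDiffSMul 𝓘(ℝ, EG) 𝓘(ℝ, E) ∞ G M] (g : G) :
    ContMDiff 𝓘(ℝ, E).tangent 𝓘(ℝ, E).tangent ∞
      (fun w : TangentBundle 𝓘(ℝ, E) M => tangentSMul E g w) :=
  (contMDiff_tangentSMul (EG := EG) (G := G) (E := E) (M := M)).comp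
    (contMDiff_const.prodMk contMDiff_id)

/-- Smoothness is needed jointly in the point and in `ξ`, because the connection inserts a Lie
algebra element that varies with the point. -/
theorem contMDiff_tangentFundamentalField :
    ContMDiff (𝓘(ℝ, E).tangent.prod 𝓘(ℝ, EG)) 𝓘(ℝ, E).tangent.tangent ∞
      (fun p : TangentBundle 𝓘(ℝ, E) M × EG =>
        (⟨p.1, tangentFundamentalField (G := G) p.2 p.1⟩ :
          TangentBundle 𝓘(ℝ, E).tangent (TangentBundle 𝓘(ℝ, E) M))) := by
  have h1 : ContMDiff (𝓘(ℝ, E).tangent.prod 𝓘(ℝ, EG)) 𝓘(ℝ, E).tangent ∞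
      (fun p : TangentBundle 𝓘(ℝ, E) M × G => tangentSMul E p.2 p.1) :=
    contMDiff_tangentSMul.comp (contMDiff_snd.prodMk contMDiff_fst)
  have h2 : ContMDiff (𝓘(ℝ, E).tangent.prod 𝓘(ℝ, EG)) (𝓘(ℝ, E).tangent.prod 𝓘(ℝ, EG).tangent) ∞
      (fun p : TangentBundle 𝓘(ℝ, E) M × EG =>
        (p.1, (⟨1, p.2⟩ : TangentBundle 𝓘(ℝ, EG) G))) :=
    contMDiff_fst.prodMk ((contMDiff_mk_fibre (1 : G)).comp contMDiff_snd)
  refine ((contMDiff_tangentMap_right h1).comp h2).congr fun p => ?_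
  have h : ∀ w' : TangentBundle 𝓘(ℝ, E) M, w' = p.1 →
      (⟨p.1, tangentFundamentalField (G := G) p.2 p.1⟩ :
        TangentBundle 𝓘(ℝ, E).tangent (TangentBundle 𝓘(ℝ, E) M)) =
      ⟨w', (tangentFundamentalField (G := G) p.2 p.1 : E × E)⟩ := by
    rintro w' rfl; rfl
  exact h _ (one_tangentSMul p.1)

theorem contMDiff_fundamentalField (ξ : GroupLieAlgebra 𝓘(ℝ, EG) G) :
    ContMDiff 𝓘(ℝ, E) 𝓘(ℝ, E).tangent ∞
      (fun m : M => (⟨m, fundamentalField E ξ m⟩ : TangentBundle 𝓘(ℝ, E) M)) := by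
  have h1 : ContMDiff (𝓘(ℝ, E).prod 𝓘(ℝ, EG)) 𝓘(ℝ, E) ∞ (fun p : M × G => p.2 • p.1) :=
    contMDiff_snd.smul contMDiff_fst
  refine ((contMDiff_tangentMap_right h1).comp ((contMDiff_id (M := M) (I := 𝓘(ℝ, E))).prodMk
      (contMDiff_const (c := (⟨1, ξ⟩ : TangentBundle 𝓘(ℝ, EG) G))))).congr fun m => ?_
  have h : ∀ m' : M, m' = m → (⟨m, fundamentalField E ξ m⟩ : TangentBundle 𝓘(ℝ, E) M) =
      ⟨m', (fundamentalField E ξ m : E)⟩ := by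
    rintro m' rfl; rfl
  exact h _ (one_smul G m)

/-- This is the derivative at the unit of the equivariance `τ(g w) = g τ(w)`. -/
theorem mfderiv_proj_tangentFundamentalField (ξ : GroupLieAlgebra 𝓘(ℝ, EG) G)
    (w : TangentBundle 𝓘(ℝ, E) M) :
    mfderiv 𝓘(ℝ, E).tangent 𝓘(ℝ, E) (fun w : TangentBundle 𝓘(ℝ, E) M => w.proj) w
      (tangentFundamentalField ξ w) = fundamentalField E ξ w.proj := by
  have h1 := mfderiv_comp_apply_of_eq (I := 𝓘(ℝ, EG)) (I' := 𝓘(ℝ, E).tangent) (I'' := 𝓘(ℝ, E))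
    (f := fun g : G => tangentSMul E g w) (g := fun w : TangentBundle 𝓘(ℝ, E) M => w.proj) (1 : G)
    ((contMDiff_proj (TangentSpace 𝓘(ℝ, E)) (n := ∞)).mdifferentiable (by simp) w)
    ((contMDiff_tangentSMul_left w).mdifferentiable (by simp) 1)
    (one_tangentSMul w) ξ
  exact h1.symm

theorem HasVelocityAt.tangentSMul {γ : ℝ → G} {t : ℝ} {ξ : GroupLieAlgebra 𝓘(ℝ, EG) G}
    (hγ : HasVelocityAt 𝓘(ℝ, EG) γ t ξ) (h0 : γ t = 1) (w : TangentBundle 𝓘(ℝ, E) M) :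
    HasVelocityAt 𝓘(ℝ, E).tangent (fun s => tangentSMul E (γ s) w) t
      (tangentFundamentalField (EG := EG) (G := G) ξ w) :=
  hγ.comp h0 ((contMDiff_tangentSMul_left w).mdifferentiable (by simp) 1)

end Action

/-! ### Vertical derivatives and the Hessian in tangent bundle charts. -/

section Lagrangian

set_option linter.unusedSectionVars false

variable {E : Type*} [NormedAddCommGroup E] [NormedSpace ℝ E]
  {M : Type*} [TopologicalSpace M] [ChartedSpace E M] [IsManifold 𝓘(ℝ, E) ∞ M]

/-- The vertical part of a tangent vector in the trivialization of `TM` at `m₀`. -/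
noncomputable def vertCoord (m₀ : M) (m : M) : E →L[ℝ] E :=
  (trivializationAt E (TangentSpace 𝓘(ℝ, E)) m₀).continuousLinearMapAt ℝ m

/-- `L` in the chart of `TM` at `w₀`. -/
noncomputable def chartLagrangian (L : TangentBundle 𝓘(ℝ, E) M → ℝ)
    (w₀ : TangentBundle 𝓘(ℝ, E) M) (p : E × E) : ℝ :=
  L ((extChartAt 𝓘(ℝ, E).tangent w₀).symm p)

theorem mem_extChartAt_tangent_source {w₀ w : TangentBundle 𝓘(ℝ, E) M} :
    w ∈ (extChartAt 𝓘(ℝ, E).tangent w₀).source ↔ w.proj ∈ (chartAt E w₀.proj).source := by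
  rw [extChartAt_source, TangentBundle.mem_chart_source_iff]

theorem extChartAt_tangent_apply {w₀ : TangentBundle 𝓘(ℝ, E) M} {m : M}
    (hm : m ∈ (chartAt E w₀.proj).source) (a : E) :
    extChartAt 𝓘(ℝ, E).tangent w₀ ⟨m, a⟩ =
      (extChartAt 𝓘(ℝ, E) w₀.proj m, vertCoord w₀.proj m a) := by
  have hb : m ∈ (trivializationAt E (TangentSpace 𝓘(ℝ, E)) w₀.proj).baseSet := by
    rwa [TangentBundle.trivializationAt_baseSet]
  have h1 : vertCoord w₀.proj m a = (trivializationAt E (TangentSpace 𝓘(ℝ, E)) w₀.proj ⟨m, a⟩).2 :=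
    Trivialization.continuousLinearMapAt_apply_of_mem ℝ _ hb _
  rw [h1]
  rfl

theorem extChartAt_tangent_add_smul {w₀ w : TangentBundle 𝓘(ℝ, E) M}
    (hw : w ∈ (extChartAt 𝓘(ℝ, E).tangent w₀).source) (v : E) (t : ℝ) :
    extChartAt 𝓘(ℝ, E).tangent w₀ ⟨w.proj, (show E from w.2) + t • v⟩ =
        extChartAt 𝓘(ℝ, E).tangent w₀ w + t • ((0 : E), vertCoord w₀.proj w.proj v) := by
  rw [mem_extChartAt_tangent_source] at hw
  obtain ⟨m, a⟩ := w
  refine (extChartAt_tangent_apply hw _).trans ?_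
  rw [extChartAt_tangent_apply hw a]
  have h : ∀ a v : E, vertCoord w₀.proj m (a + t • v) =
      vertCoord w₀.proj m a + t • vertCoord w₀.proj m v := fun a v => by simp
  exact Prod.ext (by simp) (h a v)

theorem contDiffOn_chartLagrangian {L : TangentBundle 𝓘(ℝ, E) M → ℝ}
    (hL : ContMDiff 𝓘(ℝ, E).tangent 𝓘(ℝ, ℝ) ∞ L) (w₀ : TangentBundle 𝓘(ℝ, E) M) :
    ContDiffOn ℝ ∞ (chartLagrangian L w₀) (extChartAt 𝓘(ℝ, E).tangent w₀).target := by
  rw [← contMDiffOn_iff_contDiffOn]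
  have h := hL.comp_contMDiffOn (contMDiffOn_extChartAt_symm (n := ∞) (I := 𝓘(ℝ, E).tangent) w₀)
  exact h

theorem contDiffAt_chartLagrangian {L : TangentBundle 𝓘(ℝ, E) M → ℝ}
    (hL : ContMDiff 𝓘(ℝ, E).tangent 𝓘(ℝ, ℝ) ∞ L) {w₀ w : TangentBundle 𝓘(ℝ, E) M}
    (hw : w ∈ (extChartAt 𝓘(ℝ, E).tangent w₀).source) :
    ContDiffAt ℝ ∞ (chartLagrangian L w₀) (extChartAt 𝓘(ℝ, E).tangent w₀ w) :=
  (contDiffOn_chartLagrangian hL w₀).contDiffAt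
    ((isOpen_extChartAt_target w₀).mem_nhds ((extChartAt 𝓘(ℝ, E).tangent w₀).map_source hw))

/-- In a chart of `TM` the curve `t ↦ w + t v` is a straight line in the second factor, so the
vertical derivative is an ordinary directional derivative. This gives linearity in `v` and smooth
dependence on all data. -/
theorem verticalDeriv_eq_fderiv {L : TangentBundle 𝓘(ℝ, E) M → ℝ}
    (hL : ContMDiff 𝓘(ℝ, E).tangent 𝓘(ℝ, ℝ) ∞ L) {w₀ w : TangentBundle 𝓘(ℝ, E) M}
    (hw : w ∈ (extChartAt 𝓘(ℝ, E).tangent w₀).source) (v : E) :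
    verticalDeriv L w v = fderiv ℝ (chartLagrangian L w₀) (extChartAt 𝓘(ℝ, E).tangent w₀ w)
      (0, vertCoord w₀.proj w.proj v) := by
  have h1 : HasDerivAt (fun t : ℝ => extChartAt 𝓘(ℝ, E).tangent w₀ w +
      t • ((0 : E), vertCoord w₀.proj w.proj v)) ((0 : E), vertCoord w₀.proj w.proj v) 0 := by
    simpa using ((hasDerivAt_id (0 : ℝ)).smul_const
      ((0 : E), vertCoord w₀.proj w.proj v)).const_add (extChartAt 𝓘(ℝ, E).tangent w₀ w)
  have h2 := (((contDiffAt_chartLagrangian hL hw).differentiableAt (by simp)).hasFDerivAt)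
  have h3 := h2.comp_hasDerivAt_of_eq (0 : ℝ) h1 (by simp)
  refine Eq.trans ?_ h3.deriv
  unfold verticalDeriv
  congr 1
  ext t
  have h5 : (⟨w.proj, (show E from w.2) + t • v⟩ : TangentBundle 𝓘(ℝ, E) M) ∈
      (extChartAt 𝓘(ℝ, E).tangent w₀).source :=
    mem_extChartAt_tangent_source.2 (mem_extChartAt_tangent_source.1 hw)
  refine (congrArg L ((extChartAt 𝓘(ℝ, E).tangent w₀).left_inv h5)).symm.trans ?_
  exact congrArg (fun p => L ((extChartAt 𝓘(ℝ, E).tangent w₀).symm p))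
    (extChartAt_tangent_add_smul hw v t)

theorem hessian_eq_fderiv {L : TangentBundle 𝓘(ℝ, E) M → ℝ}
    (hL : ContMDiff 𝓘(ℝ, E).tangent 𝓘(ℝ, ℝ) ∞ L) {w₀ w : TangentBundle 𝓘(ℝ, E) M}
    (hw : w ∈ (extChartAt 𝓘(ℝ, E).tangent w₀).source) (u v : E) :
    hessian L w u v =
      fderiv ℝ (fderiv ℝ (chartLagrangian L w₀)) (extChartAt 𝓘(ℝ, E).tangent w₀ w)
        (0, vertCoord w₀.proj w.proj u) (0, vertCoord w₀.proj w.proj v) := by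
  have h1 : HasDerivAt (fun t : ℝ => extChartAt 𝓘(ℝ, E).tangent w₀ w +
      t • ((0 : E), vertCoord w₀.proj w.proj u)) ((0 : E), vertCoord w₀.proj w.proj u) 0 := by
    simpa using ((hasDerivAt_id (0 : ℝ)).smul_const
      ((0 : E), vertCoord w₀.proj w.proj u)).const_add (extChartAt 𝓘(ℝ, E).tangent w₀ w)
  have h2 := ((((contDiffAt_chartLagrangian hL hw).fderiv_right (m := 1)
    (by norm_cast)).differentiableAt (by simp)).hasFDerivAt)
  have h3 := (h2.comp_hasDerivAt_of_eq (0 : ℝ) h1 (by simp)).clm_apply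
    (hasDerivAt_const (0 : ℝ) ((0 : E), vertCoord w₀.proj w.proj v))
  refine Eq.trans ?_ (h3.deriv.trans (by simp))
  unfold hessian
  congr 1
  ext t
  have h5 : (⟨w.proj, (show E from w.2) + t • u⟩ : TangentBundle 𝓘(ℝ, E) M) ∈
      (extChartAt 𝓘(ℝ, E).tangent w₀).source :=
    mem_extChartAt_tangent_source.2 (mem_extChartAt_tangent_source.1 hw)
  refine (verticalDeriv_eq_fderiv hL h5 v).trans ?_
  exact congrArg (fun p => fderiv ℝ (chartLagrangian L w₀) p (0, vertCoord w₀.proj w.proj v))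
    (extChartAt_tangent_add_smul hw u t)

/-- The Hessian is a symmetric bilinear form. -/
theorem exists_hessian_eq {L : TangentBundle 𝓘(ℝ, E) M → ℝ}
    (hL : ContMDiff 𝓘(ℝ, E).tangent 𝓘(ℝ, ℝ) ∞ L) (w : TangentBundle 𝓘(ℝ, E) M) :
    ∃ B : E →L[ℝ] E →L[ℝ] ℝ, (∀ u v : E, hessian L w u v = B u v) ∧ ∀ u v, B u v = B v u := by
  have hw := mem_extChartAt_source (I := 𝓘(ℝ, E).tangent) w
  let A : E →L[ℝ] E × E := ContinuousLinearMap.inr ℝ E E ∘L vertCoord w.proj w.proj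
  refine ⟨ContinuousLinearMap.bilinearComp (fderiv ℝ (fderiv ℝ (chartLagrangian L w))
    (extChartAt 𝓘(ℝ, E).tangent w w)) A A, fun u v => hessian_eq_fderiv hL hw u v, fun u v => ?_⟩
  exact ((contDiffAt_chartLagrangian hL hw).isSymmSndFDerivAt
    (by simp only [minSmoothness_of_isRCLikeNormedField]; norm_cast)).eq _ _

theorem exists_verticalDeriv_eq {L : TangentBundle 𝓘(ℝ, E) M → ℝ}
    (hL : ContMDiff 𝓘(ℝ, E).tangent 𝓘(ℝ, ℝ) ∞ L) (w : TangentBundle 𝓘(ℝ, E) M) :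
    ∃ B : E →L[ℝ] ℝ, ∀ v : E, verticalDeriv L w v = B v := by
  have hw := mem_extChartAt_source (I := 𝓘(ℝ, E).tangent) w
  exact ⟨fderiv ℝ (chartLagrangian L w) (extChartAt 𝓘(ℝ, E).tangent w w) ∘L
    (ContinuousLinearMap.inr ℝ E E ∘L vertCoord w.proj w.proj),
    fun v => verticalDeriv_eq_fderiv hL hw v⟩

variable {EY : Type*} [NormedAddCommGroup EY] [NormedSpace ℝ EY] {HY : Type*} [TopologicalSpace HY]
  {J : ModelWithCorners ℝ EY HY} {Y : Type*} [TopologicalSpace Y] [ChartedSpace HY Y]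

theorem contMDiffAt_vertCoord {f : Y → M} {u : Y → E} {y : Y}
    (hu : ContMDiffAt J 𝓘(ℝ, E).tangent ∞ (fun y => (⟨f y, u y⟩ : TangentBundle 𝓘(ℝ, E) M)) y) :
    ContMDiffAt J 𝓘(ℝ, E) ∞ (fun y' => vertCoord (f y) (f y') (u y')) y := by
  have h := ((contMDiffAt_totalSpace (F := E) (E := (TangentSpace 𝓘(ℝ, E) : M → Type _))).1 hu)
  refine h.2.congr_of_eventuallyEq ?_
  filter_upwards [h.1.continuousAt.eventually
    ((trivializationAt E (TangentSpace 𝓘(ℝ, E)) (f y)).open_baseSet.mem_nhds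
      (mem_baseSet_trivializationAt E (TangentSpace 𝓘(ℝ, E)) (f y)))] with y' hy'
  exact Trivialization.continuousLinearMapAt_apply_of_mem ℝ _ hy' _

end Lagrangian

section Lagrangian

set_option linter.unusedSectionVars false

variable {E : Type*} [NormedAddCommGroup E] [NormedSpace ℝ E]
  {M : Type*} [TopologicalSpace M] [ChartedSpace E M] [IsManifold 𝓘(ℝ, E) ∞ M]
  {EY : Type*} [NormedAddCommGroup EY] [NormedSpace ℝ EY] {HY : Type*} [TopologicalSpace HY]
  {J : ModelWithCorners ℝ EY HY} {Y : Type*} [TopologicalSpace Y] [ChartedSpace HY Y]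

theorem contMDiffAt_extChartAt_comp {f : Y → TangentBundle 𝓘(ℝ, E) M}
    {y : Y} (hf : ContMDiffAt J 𝓘(ℝ, E).tangent ∞ f y) :
    ContMDiffAt J 𝓘(ℝ, E × E) ∞ (fun y' => extChartAt 𝓘(ℝ, E).tangent (f y) (f y')) y :=
  (contMDiffAt_extChartAt (I := 𝓘(ℝ, E).tangent) (n := ∞) (x := f y)).comp y hf

theorem contDiffAt_fderiv_inr {ℓ : E × E → ℝ} {p : E × E} (hℓ : ContDiffAt ℝ ∞ ℓ p) (a : E) :
    ContDiffAt ℝ ∞ (fun q : (E × E) × E => fderiv ℝ ℓ q.1 ((0 : E), q.2)) (p, a) := by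
  have h1 : ContDiffAt ℝ ∞ (fderiv ℝ ℓ) p := hℓ.fderiv_right (m := ∞) (by simp)
  have h2 : ContDiffAt ℝ ∞ (fun q : (E × E) × E => fderiv ℝ ℓ q.1) (p, a) :=
    h1.comp (p, a) contDiffAt_fst
  exact h2.clm_apply (contDiffAt_const.prodMk contDiffAt_snd)

theorem contDiffAt_fderiv_fderiv_inr {ℓ : E × E → ℝ} {p : E × E} (hℓ : ContDiffAt ℝ ∞ ℓ p)
    (a b : E) :
    ContDiffAt ℝ ∞ (fun q : (E × E) × E × E =>
      fderiv ℝ (fderiv ℝ ℓ) q.1 ((0 : E), q.2.1) ((0 : E), q.2.2)) (p, a, b) := by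
  have h1 : ContDiffAt ℝ ∞ (fderiv ℝ (fderiv ℝ ℓ)) p :=
    (hℓ.fderiv_right (m := ∞) (by simp)).fderiv_right (m := ∞) (by simp)
  have h2 : ContDiffAt ℝ ∞ (fun q : (E × E) × E × E => fderiv ℝ (fderiv ℝ ℓ) q.1) (p, a, b) :=
    h1.comp (p, a, b) contDiffAt_fst
  exact (h2.clm_apply (contDiffAt_const.prodMk contDiffAt_snd.fst)).clm_apply
    (contDiffAt_const.prodMk contDiffAt_snd.snd)

theorem contMDiffAt_verticalDeriv {L : TangentBundle 𝓘(ℝ, E) M → ℝ}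
    (hL : ContMDiff 𝓘(ℝ, E).tangent 𝓘(ℝ, ℝ) ∞ L) {f : Y → TangentBundle 𝓘(ℝ, E) M} {u : Y → E}
    {y : Y} (hf : ContMDiffAt J 𝓘(ℝ, E).tangent ∞ f y)
    (hu : ContMDiffAt J 𝓘(ℝ, E).tangent ∞
      (fun y => (⟨(f y).proj, u y⟩ : TangentBundle 𝓘(ℝ, E) M)) y) :
    ContMDiffAt J 𝓘(ℝ, ℝ) ∞ (fun y => verticalDeriv L (f y) (u y)) y := by
  have hw := mem_extChartAt_source (I := 𝓘(ℝ, E).tangent) (f y)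
  have h := ContMDiffAt.comp y
    (contDiffAt_fderiv_inr (contDiffAt_chartLagrangian hL hw)
      (vertCoord (f y).proj (f y).proj (u y))).contMDiffAt
    ((contMDiffAt_extChartAt_comp hf).prodMk_space (contMDiffAt_vertCoord hu))
  refine h.congr_of_eventuallyEq ?_
  filter_upwards [hf.continuousAt.eventually
    ((isOpen_extChartAt_source (I := 𝓘(ℝ, E).tangent) (f y)).mem_nhds hw)] with y' hy'
  exact verticalDeriv_eq_fderiv hL hy' (u y')

theorem contMDiffAt_hessian {L : TangentBundle 𝓘(ℝ, E) M → ℝ}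
    (hL : ContMDiff 𝓘(ℝ, E).tangent 𝓘(ℝ, ℝ) ∞ L) {f : Y → TangentBundle 𝓘(ℝ, E) M} {u v : Y → E}
    {y : Y} (hf : ContMDiffAt J 𝓘(ℝ, E).tangent ∞ f y)
    (hu : ContMDiffAt J 𝓘(ℝ, E).tangent ∞
      (fun y => (⟨(f y).proj, u y⟩ : TangentBundle 𝓘(ℝ, E) M)) y)
    (hv : ContMDiffAt J 𝓘(ℝ, E).tangent ∞
      (fun y => (⟨(f y).proj, v y⟩ : TangentBundle 𝓘(ℝ, E) M)) y) :
    ContMDiffAt J 𝓘(ℝ, ℝ) ∞ (fun y => hessian L (f y) (u y) (v y)) y := by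
  have hw := mem_extChartAt_source (I := 𝓘(ℝ, E).tangent) (f y)
  have h := ContMDiffAt.comp y
    (contDiffAt_fderiv_fderiv_inr (contDiffAt_chartLagrangian hL hw)
      (vertCoord (f y).proj (f y).proj (u y)) (vertCoord (f y).proj (f y).proj (v y))).contMDiffAt
    ((contMDiffAt_extChartAt_comp hf).prodMk_space
      ((contMDiffAt_vertCoord hu).prodMk_space (contMDiffAt_vertCoord hv)))
  refine h.congr_of_eventuallyEq ?_
  filter_upwards [hf.continuousAt.eventually
    ((isOpen_extChartAt_source (I := 𝓘(ℝ, E).tangent) (f y)).mem_nhds hw)] with y' hy'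
  exact hessian_eq_fderiv hL hy' (u y') (v y')

end Lagrangian

/-! ### Invariance of vertical derivatives and of the Hessian. -/

section Invariance

set_option linter.unusedSectionVars false

variable {EG : Type*} [NormedAddCommGroup EG] [NormedSpace ℝ EG]
  {G : Type*} [TopologicalSpace G] [ChartedSpace EG G] [Group G] [LieGroup 𝓘(ℝ, EG) ∞ G]
  {E : Type*} [NormedAddCommGroup E] [NormedSpace ℝ E]
  {M : Type*} [TopologicalSpace M] [ChartedSpace E M] [IsManifold 𝓘(ℝ, E) ∞ M]
  [MulAction G M] [ContMDiffSMul 𝓘(ℝ, EG) 𝓘(ℝ, E) ∞ G M]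

/-- The action on `TM` is linear on fibres, so it carries the line `w + t v` to the line through `g
w` in the direction of the image of `v`, and `L` takes equal values along both. -/
theorem verticalDeriv_tangentSMul {L : TangentBundle 𝓘(ℝ, E) M → ℝ} (hL : IsInvariant G L) (g : G)
    (w : TangentBundle 𝓘(ℝ, E) M) (v : TangentSpace 𝓘(ℝ, E) w.proj) :
    verticalDeriv L (tangentSMul E g w)
      (mfderiv 𝓘(ℝ, E) 𝓘(ℝ, E) (fun x : M => g • x) w.proj v) = verticalDeriv L w v := by
  unfold verticalDeriv
  congr 1
  ext t
  refine Eq.trans ?_ (hL g _)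
  refine congrArg (fun v : E => L ⟨g • w.proj, v⟩) ?_
  let A : E →L[ℝ] E := mfderiv 𝓘(ℝ, E) 𝓘(ℝ, E) (fun x : M => g • x) w.proj
  have h5 : ∀ a b : E, A a + t • A b = A (a + t • b) := fun a b => by rw [map_add, map_smul]
  exact h5 _ _

theorem hessian_tangentSMul {L : TangentBundle 𝓘(ℝ, E) M → ℝ} (hL : IsInvariant G L) (g : G)
    (w : TangentBundle 𝓘(ℝ, E) M) (u v : TangentSpace 𝓘(ℝ, E) w.proj) :
    hessian L (tangentSMul E g w)
      (mfderiv 𝓘(ℝ, E) 𝓘(ℝ, E) (fun x : M => g • x) w.proj u)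
      (mfderiv 𝓘(ℝ, E) 𝓘(ℝ, E) (fun x : M => g • x) w.proj v) = hessian L w u v := by
  unfold hessian
  congr 1
  ext t
  refine Eq.trans ?_ (verticalDeriv_tangentSMul hL g ⟨w.proj, w.2 + t • u⟩ v)
  let A : E →L[ℝ] E := mfderiv 𝓘(ℝ, E) 𝓘(ℝ, E) (fun x : M => g • x) w.proj
  refine congrArg (fun a : E => verticalDeriv L ⟨g • w.proj, a⟩ (A v)) ?_
  have h5 : ∀ a b : E, A a + t • A b = A (a + t • b) := fun a b => by rw [map_add, map_smul]
  exact h5 _ _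

end Invariance

/-! ### Smoothness of the momentum and its derivative along vertical lifts. -/

section Momentum

set_option linter.unusedSectionVars false

variable {EG : Type*} [NormedAddCommGroup EG] [NormedSpace ℝ EG]
  {G : Type*} [TopologicalSpace G] [ChartedSpace EG G] [Group G] [LieGroup 𝓘(ℝ, EG) ∞ G]
  {E : Type*} [NormedAddCommGroup E] [NormedSpace ℝ E]
  {M : Type*} [TopologicalSpace M] [ChartedSpace E M] [IsManifold 𝓘(ℝ, E) ∞ M]
  [MulAction G M] [ContMDiffSMul 𝓘(ℝ, EG) 𝓘(ℝ, E) ∞ G M] {L : TangentBundle 𝓘(ℝ, E) M → ℝ}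

theorem contMDiff_fundamentalField_proj (ξ : GroupLieAlgebra 𝓘(ℝ, EG) G) :
    ContMDiff 𝓘(ℝ, E).tangent 𝓘(ℝ, E).tangent ∞ (fun w : TangentBundle 𝓘(ℝ, E) M =>
      (⟨w.proj, fundamentalField E ξ w.proj⟩ : TangentBundle 𝓘(ℝ, E) M)) :=
  (contMDiff_fundamentalField ξ).comp (contMDiff_proj (TangentSpace 𝓘(ℝ, E)))

theorem contMDiff_momentum (hL : ContMDiff 𝓘(ℝ, E).tangent 𝓘(ℝ, ℝ) ∞ L)
    (ξ : GroupLieAlgebra 𝓘(ℝ, EG) G) :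
    ContMDiff 𝓘(ℝ, E).tangent 𝓘(ℝ, ℝ) ∞ (fun w => momentum L w ξ) := fun w =>
  contMDiffAt_verticalDeriv hL contMDiffAt_id (contMDiff_fundamentalField_proj ξ w)

/-- The vertical lift of `v` to `w` is the velocity of a curve along which the momentum changes
at the rate given by the Hessian. -/
theorem exists_mfderiv_momentum_eq_hessian (hL : ContMDiff 𝓘(ℝ, E).tangent 𝓘(ℝ, ℝ) ∞ L)
    (w : TangentBundle 𝓘(ℝ, E) M) :
    ∃ A : E →L[ℝ] E × E, ∀ (v : E) (ξ : GroupLieAlgebra 𝓘(ℝ, EG) G),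
      mfderiv 𝓘(ℝ, E).tangent 𝓘(ℝ, ℝ) (fun w => momentum L w ξ) w (A v) =
        hessian L w v (fundamentalField E ξ w.proj) := by
  obtain ⟨m, a⟩ := w
  have h0 : ContMDiff 𝓘(ℝ, E) 𝓘(ℝ, E).tangent ∞
      (fun v : E => (⟨m, v⟩ : TangentBundle 𝓘(ℝ, E) M)) := contMDiff_mk_fibre m
  refine ⟨mfderiv 𝓘(ℝ, E) 𝓘(ℝ, E).tangent
    (fun v : E => (⟨m, v⟩ : TangentBundle 𝓘(ℝ, E) M)) a, fun v ξ => ?_⟩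
  have h1 : HasVelocityAt 𝓘(ℝ, E) (fun t : ℝ => (show E from a) + t • v) 0 v :=
    hasVelocityAt_iff_hasDerivAt.2 (by
      simpa using ((hasDerivAt_id (0 : ℝ)).smul_const v).const_add (show E from a))
  have e : ∀ a : E, a + (0 : ℝ) • v = a := by simp
  have h2 := h1.comp (e a) (h0.mdifferentiable (by simp) a)
  have h3 := h2.comp (x := (⟨m, a⟩ : TangentBundle 𝓘(ℝ, E) M))
    (congrArg (fun b : E => (⟨m, b⟩ : TangentBundle 𝓘(ℝ, E) M)) (e a))
    ((contMDiff_momentum hL ξ).mdifferentiable (by simp) _)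
  exact ((hasVelocityAt_iff_hasDerivAt (EX := ℝ)).1 h3).deriv.symm

end Momentum

/-! ### Inverse function theorem with an inverse smooth on a whole open set. -/

section InverseFunction

variable {E : Type*} [NormedAddCommGroup E] [NormedSpace ℝ E] [FiniteDimensional ℝ E]
  {V : Type*} [NormedAddCommGroup V] [NormedSpace ℝ V] [FiniteDimensional ℝ V]

/-- The inverse function theorem, as the existence of a smooth local coordinate system. -/
theorem exists_openPartialHomeomorph_of_bijective_fderiv {f : E → V} {T : Set E} (hT : IsOpen T)
    (hf : ContDiffOn ℝ ∞ f T) {x : E} (hx : x ∈ T) (hinj : Function.Injective (fderiv ℝ f x))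
    (hdim : Module.finrank ℝ E = Module.finrank ℝ V) :
    ∃ ψ : OpenPartialHomeomorph E V, x ∈ ψ.source ∧ ψ.source ⊆ T ∧ (∀ y, ψ y = f y) ∧
      ContDiffOn ℝ ∞ ψ.symm ψ.target := by
  have : CompleteSpace E := FiniteDimensional.complete ℝ E
  have hfx : ∀ y ∈ T, ContDiffAt ℝ ∞ f y := fun y hy => hf.contDiffAt (hT.mem_nhds hy)
  let f' : E ≃L[ℝ] V := (LinearEquiv.ofInjectiveOfFinrankEq
    (fderiv ℝ f x).toLinearMap hinj hdim).toContinuousLinearEquiv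
  have hf' : (f' : E →L[ℝ] V) = fderiv ℝ f x := by ext v; rfl
  have hd : HasFDerivAt f (f' : E →L[ℝ] V) x := by
    rw [hf']; exact ((hfx x hx).differentiableAt (by simp)).hasFDerivAt
  let ψ := (hfx x hx).toOpenPartialHomeomorph f hd (by simp)
  have hcont : ContinuousOn (fderiv ℝ f) T := hf.continuousOn_fderiv_of_isOpen hT (by simp)
  -- Restricting to the open set where the derivative is invertible makes the local inverse smooth
  -- at every point of its target, not only at the image of `x`.
  let U := ψ.source ∩ (T ∩ fderiv ℝ f ⁻¹' range ((↑) : (E ≃L[ℝ] V) → E →L[ℝ] V))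
  have hU : IsOpen U := ψ.open_source.inter
    (hcont.isOpen_inter_preimage hT (ContinuousLinearEquiv.isOpen))
  refine ⟨ψ.restrOpen U hU, ?_, ?_, fun y => rfl, ?_⟩
  · exact ⟨(hfx x hx).mem_toOpenPartialHomeomorph_source hd (by simp),
      (hfx x hx).mem_toOpenPartialHomeomorph_source hd (by simp), hx, f', hf'⟩
  · rintro y ⟨-, -, hy, -⟩
    exact hy
  · intro z hz
    have hz' := (ψ.restrOpen U hU).map_target hz
    obtain ⟨-, -, hy, B, hB⟩ := hz'
    refine ((ψ.restrOpen U hU).contDiffAt_symm (f₀' := B) hz ?_ (hfx _ hy)).contDiffWithinAt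
    rw [hB]
    exact ((hfx _ hy).differentiableAt (by simp)).hasFDerivAt

end InverseFunction

/-! ### Level sets of submersions as embedded submanifolds. -/

section Level

set_option linter.unusedSectionVars false

variable {E : Type*} [NormedAddCommGroup E] [NormedSpace ℝ E] [FiniteDimensional ℝ E]
  {H : Type*} [TopologicalSpace H] {I : ModelWithCorners ℝ E H} [I.Boundaryless]
  {X : Type*} [TopologicalSpace X] [ChartedSpace H X] [IsManifold I ∞ X]
  {D : Type*} [NormedAddCommGroup D] [NormedSpace ℝ D] [FiniteDimensional ℝ D]
  {F : Type*} [NormedAddCommGroup F] [NormedSpace ℝ F] [FiniteDimensional ℝ F]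

/-- Take for `q` a linear projection onto `ker A` followed by an isomorphism `ker A ≃ D`: on a
vector killed by `A` the projection is the identity. -/
theorem exists_injective_prod (A : E →L[ℝ] F) (hA : Function.Surjective A)
    (hdim : Module.finrank ℝ D + Module.finrank ℝ F = Module.finrank ℝ E) :
    ∃ q : E →L[ℝ] D, Function.Injective (q.prod A) := by
  have hk : Module.finrank ℝ A.toLinearMap.ker = Module.finrank ℝ D := by
    have h1 := A.toLinearMap.finrank_range_add_finrank_ker
    rw [LinearMap.range_eq_top.2 hA, finrank_top] at h1
    omega
  let e := LinearEquiv.ofFinrankEq _ _ hk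
  obtain ⟨p, hp⟩ := A.toLinearMap.ker.subtype.exists_leftInverse_of_injective
    (Submodule.ker_subtype _)
  refine ⟨LinearMap.toContinuousLinearMap (e.toLinearMap ∘ₗ p), ?_⟩
  rw [injective_iff_map_eq_zero]
  intro v hv
  have h1 : e (p v) = 0 := congrArg Prod.fst hv
  have h2 : A v = 0 := congrArg Prod.snd hv
  have h3 : p v = ⟨v, h2⟩ := DFunLike.congr_fun hp ⟨v, h2⟩
  rw [h3, LinearEquiv.map_eq_zero_iff] at h1
  exact congrArg Subtype.val h1

/-- A submersion is a coordinate projection in suitable smooth coordinates. -/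
theorem exists_coordinates_of_submersion {P : X → F} (hP : ContMDiff I 𝓘(ℝ, F) ∞ P) (x : X)
    (hs : Function.Surjective (mfderiv I 𝓘(ℝ, F) P x))
    (hdim : Module.finrank ℝ D + Module.finrank ℝ F = Module.finrank ℝ E) :
    ∃ Ψ : OpenPartialHomeomorph X (D × F), x ∈ Ψ.source ∧ (∀ y ∈ Ψ.source, (Ψ y).2 = P y) ∧
      ContMDiffOn I 𝓘(ℝ, D × F) ∞ Ψ Ψ.source ∧ ContMDiffOn 𝓘(ℝ, D × F) I ∞ Ψ.symm Ψ.target := by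
  -- Without boundary `I` is a homeomorphism, so the chart can be composed with it to take values in
  -- the vector space `E`, where the inverse function theorem applies.
  let C : OpenPartialHomeomorph X E := (chartAt H x).trans I.toHomeomorph.toOpenPartialHomeomorph
  have hCs : C.source = (extChartAt I x).source := by
    simp [C, extChartAt]
  have hCt : C.target = (extChartAt I x).target := by
    simp [C, extChartAt, OpenPartialHomeomorph.extend, I.range_eq_univ]
    rfl
  have hC1 : ContMDiffOn I 𝓘(ℝ, E) ∞ C C.source := by
    rw [hCs, extChartAt_source]
    exact contMDiffOn_extChartAt
  have hC2 : ContMDiffOn 𝓘(ℝ, E) I ∞ C.symm C.target := by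
    rw [hCt]
    exact contMDiffOn_extChartAt_symm x
  have hxC : x ∈ C.source := by rw [hCs]; exact mem_extChartAt_source x
  have hPC : ContDiffOn ℝ ∞ (P ∘ C.symm) C.target :=
    contMDiffOn_iff_contDiffOn.1 (hP.comp_contMDiffOn hC2)
  let A := fderiv ℝ (P ∘ C.symm) (C x)
  have hA : Function.Surjective A := by
    have h1 : mfderiv I 𝓘(ℝ, F) P x = A := by
      have h2 : MDifferentiableAt I 𝓘(ℝ, F) P x := hP.mdifferentiableAt (by simp)
      refine h2.mfderiv.trans ?_
      rw [I.range_eq_univ, fderivWithin_univ]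
      rfl
    rw [← h1]
    exact hs
  obtain ⟨q, hq⟩ := exists_injective_prod (D := D) A hA hdim
  have hd : HasFDerivAt (fun y => (q y, (P ∘ C.symm) y)) (q.prod A) (C x) :=
    q.hasFDerivAt.prodMk ((hPC.contDiffAt (C.open_target.mem_nhds
      (C.map_source hxC))).differentiableAt (by simp)).hasFDerivAt
  obtain ⟨ψ, hψx, hψT, hψ, hψs⟩ := exists_openPartialHomeomorph_of_bijective_fderiv C.open_target
    (q.contDiff.contDiffOn.prodMk hPC) (C.map_source hxC) (by rw [hd.fderiv]; exact hq)
    (by rw [Module.finrank_prod, hdim])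
  have hsm : ContDiffOn ℝ ∞ ψ C.target :=
    (q.contDiff.contDiffOn.prodMk hPC).congr fun y _ => hψ y
  refine ⟨C.trans ψ, ?_, ?_, ?_, ?_⟩
  · rw [OpenPartialHomeomorph.trans_source]
    exact ⟨hxC, hψx⟩
  · intro y hy
    rw [OpenPartialHomeomorph.trans_source] at hy
    rw [OpenPartialHomeomorph.coe_trans, Function.comp_apply, hψ]
    change P (C.symm (C y)) = P y
    rw [C.left_inv hy.1]
  · rw [OpenPartialHomeomorph.trans_source]
    exact hsm.contMDiffOn.comp (hC1.mono inter_subset_left) fun y hy => C.map_source hy.1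
  · rw [OpenPartialHomeomorph.trans_target]
    exact hC2.comp (hψs.contMDiffOn.mono inter_subset_left) fun y hy => hy.2

/-- The slice of a coordinate system given by a level set of the second component. -/
noncomputable def sliceChart {S : Set X} (Ψ : OpenPartialHomeomorph X (D × F))
    (hS : ∀ y ∈ Ψ.source, y ∈ S ↔ (Ψ y).2 = 0) (s₀ : S) : OpenPartialHomeomorph S D where
  toFun s := (Ψ s).1
  invFun u := open scoped Classical in
    if h : (u, (0 : F)) ∈ Ψ.target then
      ⟨Ψ.symm (u, 0), (hS _ (Ψ.map_target h)).2 (by rw [Ψ.right_inv h])⟩ else s₀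
  source := Subtype.val ⁻¹' Ψ.source
  target := {u | (u, (0 : F)) ∈ Ψ.target}
  map_source' s hs := by
    have h : ((Ψ s).1, (0 : F)) = Ψ s := Prod.ext rfl ((hS _ hs).1 s.2).symm
    change ((Ψ s).1, (0 : F)) ∈ Ψ.target
    rw [h]
    exact Ψ.map_source hs
  map_target' u hu := by
    rw [dif_pos (show (u, (0 : F)) ∈ Ψ.target from hu)]
    exact Ψ.map_target hu
  left_inv' s hs := by
    have h : ((Ψ s).1, (0 : F)) = Ψ s := Prod.ext rfl ((hS _ hs).1 s.2).symm
    have h' : ((Ψ s).1, (0 : F)) ∈ Ψ.target := by rw [h]; exact Ψ.map_source hs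
    rw [dif_pos h']
    apply Subtype.ext
    change Ψ.symm ((Ψ s).1, 0) = s
    rw [h, Ψ.left_inv hs]
  right_inv' u hu := by
    rw [dif_pos (show (u, (0 : F)) ∈ Ψ.target from hu)]
    change (Ψ (Ψ.symm (u, 0))).1 = u
    rw [Ψ.right_inv hu]
  open_source := Ψ.open_source.preimage continuous_subtype_val
  open_target := Ψ.open_target.preimage (Continuous.prodMk_left 0)
  continuousOn_toFun := continuous_fst.comp_continuousOn
    (Ψ.continuousOn.comp continuous_subtype_val.continuousOn fun _ hs => hs)
  continuousOn_invFun := by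
    rw [IsInducing.subtypeVal.continuousOn_iff]
    refine (Ψ.symm.continuousOn.comp (Continuous.prodMk_left (0 : F)).continuousOn
      (s := {u | (u, (0 : F)) ∈ Ψ.target}) fun u hu => hu).congr fun u hu => ?_
    simp only [Function.comp_apply]
    rw [dif_pos (show (u, (0 : F)) ∈ Ψ.target from hu)]

open scoped Classical in
theorem coe_sliceChart_symm {S : Set X} (Ψ : OpenPartialHomeomorph X (D × F))
    (hS : ∀ y ∈ Ψ.source, y ∈ S ↔ (Ψ y).2 = 0) (s₀ : S) {u : D}
    (hu : u ∈ (sliceChart Ψ hS s₀).target) :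
    ((sliceChart Ψ hS s₀).symm u : X) = Ψ.symm (u, 0) := by
  have hu' : (u, (0 : F)) ∈ Ψ.target := hu
  change ((if h : (u, (0 : F)) ∈ Ψ.target then
      ⟨Ψ.symm (u, 0), (hS _ (Ψ.map_target h)).2 (by rw [Ψ.right_inv h])⟩ else s₀ : S) : X) = _
  rw [dif_pos hu']

/-- A subset which is locally a slice of smooth coordinate systems is an embedded submanifold. -/
theorem exists_isSmoothEmbedding_of_slices {S : Set X}
    (hdim : S.Nonempty → Module.finrank ℝ D + Module.finrank ℝ F = Module.finrank ℝ E)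
    (hΨ : ∀ s ∈ S, ∃ Ψ : OpenPartialHomeomorph X (D × F), s ∈ Ψ.source ∧
      (∀ y ∈ Ψ.source, y ∈ S ↔ (Ψ y).2 = 0) ∧
      ContMDiffOn I 𝓘(ℝ, D × F) ∞ Ψ Ψ.source ∧ ContMDiffOn 𝓘(ℝ, D × F) I ∞ Ψ.symm Ψ.target) :
    ∃ _ : ChartedSpace D S, IsManifold 𝓘(ℝ, D) ∞ S ∧
      Manifold.IsSmoothEmbedding 𝓘(ℝ, D) I ∞ (Subtype.val : S → X) := by
  choose Ψ h1 h2 h3 h4 using fun s : S => hΨ s s.2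
  let φ : S → OpenPartialHomeomorph S D := fun s => sliceChart (Ψ s) (h2 s) s
  let cs : ChartedSpace D S :=
    { atlas := range φ
      chartAt := φ
      mem_chart_source := fun s => h1 s
      chart_mem_atlas := fun s => mem_range_self s }
  have hm : IsManifold 𝓘(ℝ, D) ∞ S := by
    refine isManifold_of_contDiffOn _ _ _ ?_
    rintro _ _ ⟨s, rfl⟩ ⟨t, rfl⟩
    simp only [modelWithCornersSelf_coe, modelWithCornersSelf_coe_symm, Function.id_comp,
      Function.comp_id, preimage_id, range_id, inter_univ]
    -- A transition map of slice charts is a transition map of the ambient coordinates, restricted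
    -- to `F`-component zero and projected to `D`.
    have hk : ContDiffOn ℝ ∞ (fun u : D => (Ψ t ((Ψ s).symm (u, (0 : F)))).1)
        ((φ s).symm.trans (φ t)).source := by
      rw [← contMDiffOn_iff_contDiffOn]
      have k1 : ContMDiffOn 𝓘(ℝ, D) I ∞ (fun u : D => (Ψ s).symm (u, (0 : F)))
          ((φ s).symm.trans (φ t)).source := by
        refine (h4 s).comp (t := (Ψ s).target)
          (f := fun u : D => (u, (0 : F))) ?_ fun u hu => hu.1
        exact (contDiff_id.prodMk contDiff_const).contMDiff.contMDiffOn
      refine contDiff_fst.contMDiff.comp_contMDiffOn ((h3 t).comp k1 fun u hu => ?_)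
      have := hu.2
      have hu1 : u ∈ (φ s).target := hu.1
      change (Ψ s).symm (u, 0) ∈ (Ψ t).source
      rw [← coe_sliceChart_symm (Ψ s) (h2 s) s hu1]
      exact this
    refine hk.congr fun u hu => ?_
    have hu1 : u ∈ (φ s).target := hu.1
    rw [← coe_sliceChart_symm (Ψ s) (h2 s) s hu1]
    rfl
  refine ⟨cs, hm, Manifold.IsImmersionOfComplement.isImmersion (F := F) fun s => ?_,
    IsEmbedding.subtypeVal⟩
  have hdim' := hdim ⟨s, s.2⟩
  let e : (D × F) ≃L[ℝ] E := ContinuousLinearEquiv.ofFinrankEq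
    (by rw [Module.finrank_prod, hdim'])
  -- The slice coordinates take values in `D × F`, whereas a chart of `X` must take values in `H`;
  -- `e` and the inverse of `I` convert, and the inclusion then reads `u ↦ e (u, 0)`.
  let cod : OpenPartialHomeomorph X H := (Ψ s).trans
    (e.toHomeomorph.trans I.toHomeomorph.symm).toOpenPartialHomeomorph
  have hIs : ContMDiff 𝓘(ℝ, E) I ∞ I.symm := by
    rw [← contMDiffOn_univ, ← I.range_eq_univ]
    exact I.contMDiffOn_symm
  refine Manifold.IsImmersionAtOfComplement.mk_of_charts e (φ s) cod (h1 s) ?_ ?_ ?_ ?_ ?_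
  · simpa [cod] using h1 s
  · exact IsManifold.chart_mem_maximalAtlas (I := 𝓘(ℝ, D)) (n := ∞) s
  · refine cod.mem_maximalAtlas_of_contMDiffOn ?_ ?_
    · have : cod.source = (Ψ s).source := by simp [cod]
      rw [this]
      exact (hIs.comp e.contDiff.contMDiff).comp_contMDiffOn (h3 s)
    · have : cod.target ⊆ (e.symm ∘ I) ⁻¹' (Ψ s).target := fun y hy => hy.2
      exact (h4 s).comp (e.symm.contDiff.contMDiff.comp I.contMDiff).contMDiffOn this
  · intro x hx
    have hx' : (x : X) ∈ (Ψ s).source := hx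
    simpa [cod] using hx'
  · intro u hu
    have hu1 : u ∈ (φ s).target := by simpa using hu
    have hu2 : (u, (0 : F)) ∈ (Ψ s).target := hu1
    have hk : (((φ s).symm u : S) : X) = (Ψ s).symm (u, 0) :=
      coe_sliceChart_symm (Ψ s) (h2 s) s hu1
    have hI : I (I.symm (e (u, 0))) = e (u, 0) :=
      I.right_inv (by rw [I.range_eq_univ]; trivial)
    simp [cod, hk, (Ψ s).right_inv hu2, hI]

end Level

/-! ### The level set of the momentum is a submanifold. -/

section MomentumLevel

set_option linter.unusedSectionVars false

variable {EG : Type*} [NormedAddCommGroup EG] [NormedSpace ℝ EG] [FiniteDimensional ℝ EG]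
  {G : Type*} [TopologicalSpace G] [ChartedSpace EG G] [Group G] [LieGroup 𝓘(ℝ, EG) ∞ G]
  {E : Type*} [NormedAddCommGroup E] [NormedSpace ℝ E] [FiniteDimensional ℝ E]
  {M : Type*} [TopologicalSpace M] [ChartedSpace E M] [IsManifold 𝓘(ℝ, E) ∞ M]
  [MulAction G M] [ContMDiffSMul 𝓘(ℝ, EG) 𝓘(ℝ, E) ∞ G M] {L : TangentBundle 𝓘(ℝ, E) M → ℝ}

/-- The derivative of the orbit map of `m` at the identity, as a linear map of model spaces. -/
noncomputable def fundamentalMap (G : Type*) [TopologicalSpace G] [ChartedSpace EG G] [Group G]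
    {M : Type*} [TopologicalSpace M] [ChartedSpace E M] [MulAction G M] (m : M) : EG →L[ℝ] E :=
  mfderiv 𝓘(ℝ, EG) 𝓘(ℝ, E) (fun g : G => g • m) 1

theorem exists_momentum_eq (hL : ContMDiff 𝓘(ℝ, E).tangent 𝓘(ℝ, ℝ) ∞ L)
    (w : TangentBundle 𝓘(ℝ, E) M) :
    ∃ B : EG →ₗ[ℝ] ℝ, ∀ ξ : GroupLieAlgebra 𝓘(ℝ, EG) G, momentum L w ξ = B ξ := by
  obtain ⟨B, hB⟩ := exists_verticalDeriv_eq hL w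
  exact ⟨(B ∘L fundamentalMap G w.proj).toLinearMap, fun ξ => hB _⟩

/-- The momentum is linear in `ξ`, so finitely many scalar equations, one per basis vector, cut out
the level set. -/
theorem mem_momentumLevel_iff (hL : ContMDiff 𝓘(ℝ, E).tangent 𝓘(ℝ, ℝ) ∞ L)
    (μ : Module.Dual ℝ (GroupLieAlgebra 𝓘(ℝ, EG) G)) {ι : Type*} (b : Module.Basis ι ℝ EG)
    (w : TangentBundle 𝓘(ℝ, E) M) :
    w ∈ momentumLevel L μ ↔
      ∀ i, momentum L w (show GroupLieAlgebra 𝓘(ℝ, EG) G from b i) = μ (b i) := by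
  obtain ⟨B, hB⟩ := exists_momentum_eq (EG := EG) (G := G) hL w
  refine ⟨fun h i => h (b i), fun h => ?_⟩
  let μ' : EG →ₗ[ℝ] ℝ := μ
  have h1 : B = μ' := b.ext fun i => (hB (b i)).symm.trans (h i)
  exact fun ξ => (hB ξ).trans (DFunLike.congr_fun h1 ξ)

/-- The momentum, in coordinates, relative to the value `μ`. -/
noncomputable def momentumMap (L : TangentBundle 𝓘(ℝ, E) M → ℝ)
    (μ : Module.Dual ℝ (GroupLieAlgebra 𝓘(ℝ, EG) G)) {ι : Type*} (b : Module.Basis ι ℝ EG)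
    (w : TangentBundle 𝓘(ℝ, E) M) : ι → ℝ := fun i =>
  momentum L w (show GroupLieAlgebra 𝓘(ℝ, EG) G from b i) - μ (b i)

variable {ι : Type*} [Fintype ι]

theorem contMDiff_momentumMap (hL : ContMDiff 𝓘(ℝ, E).tangent 𝓘(ℝ, ℝ) ∞ L)
    (μ : Module.Dual ℝ (GroupLieAlgebra 𝓘(ℝ, EG) G)) (b : Module.Basis ι ℝ EG) :
    ContMDiff 𝓘(ℝ, E).tangent 𝓘(ℝ, ι → ℝ) ∞ (momentumMap L μ b) :=
  contMDiff_pi_space.2 fun i => (contMDiff_momentum hL (b i)).sub contMDiff_const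

theorem mfderiv_momentumMap_apply (hL : ContMDiff 𝓘(ℝ, E).tangent 𝓘(ℝ, ℝ) ∞ L)
    (μ : Module.Dual ℝ (GroupLieAlgebra 𝓘(ℝ, EG) G)) (b : Module.Basis ι ℝ EG)
    (w : TangentBundle 𝓘(ℝ, E) M) (v : E × E) (i : ι) :
    (mfderiv 𝓘(ℝ, E).tangent 𝓘(ℝ, ι → ℝ) (momentumMap L μ b) w : E × E →L[ℝ] ι → ℝ) v i =
      (mfderiv 𝓘(ℝ, E).tangent 𝓘(ℝ, ℝ)
        (fun w => momentum L w (show GroupLieAlgebra 𝓘(ℝ, EG) G from b i)) w :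
        E × E →L[ℝ] ℝ) v := by
  have h1 : HasFDerivAt (fun y : ι → ℝ => y i + μ (b i))
      (ContinuousLinearMap.proj (R := ℝ) (φ := fun _ : ι => ℝ) i) (momentumMap L μ b w) :=
    (ContinuousLinearMap.proj (R := ℝ) (φ := fun _ : ι => ℝ) i).hasFDerivAt.add_const (μ (b i))
  have h2 := HasMFDerivAt.comp w h1.hasMFDerivAt
    ((contMDiff_momentumMap hL μ b).mdifferentiable (by simp) w).hasMFDerivAt
  have h3 : ((fun y : ι → ℝ => y i + μ (b i)) ∘ momentumMap L μ b) =
      fun w => momentum L w (show GroupLieAlgebra 𝓘(ℝ, EG) G from b i) := by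
    ext w
    exact sub_add_cancel _ _
  rw [h3] at h2
  exact (DFunLike.congr_fun h2.mfderiv v).symm

theorem hessian_fundamentalField_eq_zero (hL : ContMDiff 𝓘(ℝ, E).tangent 𝓘(ℝ, ℝ) ∞ L)
    (b : Module.Basis ι ℝ EG) (w : TangentBundle 𝓘(ℝ, E) M) (u : E)
    (h : ∀ i, hessian L w u (fundamentalField E
      (show GroupLieAlgebra 𝓘(ℝ, EG) G from b i) w.proj) = 0)
    (η : GroupLieAlgebra 𝓘(ℝ, EG) G) : hessian L w u (fundamentalField E η w.proj) = 0 := by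
  obtain ⟨B, hB, -⟩ := exists_hessian_eq hL w
  have h1 : ((B u) ∘L fundamentalMap G w.proj).toLinearMap = 0 :=
    b.ext fun i => (hB u _).symm.trans (h i)
  exact (hB u _).trans (DFunLike.congr_fun h1 η)

/-- Composing the derivative with the vertical lift of `ξ ↦ ξ̃` gives the Gram form `ξ ↦ (g(ξ̃,
b̃_i))_i`. It is injective by `hw`, hence bijective since both spaces have dimension `dim G`. -/
theorem surjective_mfderiv_momentumMap (hL : ContMDiff 𝓘(ℝ, E).tangent 𝓘(ℝ, ℝ) ∞ L)
    (μ : Module.Dual ℝ (GroupLieAlgebra 𝓘(ℝ, EG) G)) (b : Module.Basis ι ℝ EG)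
    (w : TangentBundle 𝓘(ℝ, E) M)
    (hw : ∀ ξ : GroupLieAlgebra 𝓘(ℝ, EG) G,
      (∀ η : GroupLieAlgebra 𝓘(ℝ, EG) G, hessian L w
        (fundamentalField E ξ w.proj) (fundamentalField E η w.proj) = 0) → ξ = 0) :
    Function.Surjective (mfderiv 𝓘(ℝ, E).tangent 𝓘(ℝ, ι → ℝ) (momentumMap L μ b) w) := by
  obtain ⟨A, hA⟩ := exists_mfderiv_momentum_eq_hessian (EG := EG) (G := G) hL w
  let D : E × E →L[ℝ] ι → ℝ := mfderiv 𝓘(ℝ, E).tangent 𝓘(ℝ, ι → ℝ) (momentumMap L μ b) w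
  let T : EG →ₗ[ℝ] ι → ℝ := (D ∘L A ∘L fundamentalMap G w.proj).toLinearMap
  have hT : Function.Injective T := by
    rw [injective_iff_map_eq_zero]
    intro ξ hξ
    refine hw ξ (hessian_fundamentalField_eq_zero hL b w _ fun i => ?_)
    refine (hA _ _).symm.trans ?_
    refine (mfderiv_momentumMap_apply hL μ b w _ i).symm.trans ?_
    exact congrFun hξ i
  have hdim : Module.finrank ℝ EG = Module.finrank ℝ (ι → ℝ) := by
    rw [Module.finrank_eq_card_basis b, Module.finrank_fintype_fun_eq_card]
  have hs := (LinearMap.injective_iff_surjective_of_finrank_eq_finrank hdim).1 hT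
  intro y
  obtain ⟨ξ, hξ⟩ := hs y
  exact ⟨A (fundamentalMap G w.proj ξ), hξ⟩

theorem injective_fundamentalMap (hL : ContMDiff 𝓘(ℝ, E).tangent 𝓘(ℝ, ℝ) ∞ L)
    (w : TangentBundle 𝓘(ℝ, E) M)
    (hw : ∀ ξ : GroupLieAlgebra 𝓘(ℝ, EG) G,
      (∀ η : GroupLieAlgebra 𝓘(ℝ, EG) G, hessian L w
        (fundamentalField E ξ w.proj) (fundamentalField E η w.proj) = 0) → ξ = 0) :
    Function.Injective (fundamentalMap G w.proj : EG → E) := by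
  rw [injective_iff_map_eq_zero]
  intro ξ hξ
  obtain ⟨B, hB, -⟩ := exists_hessian_eq hL w
  refine hw ξ fun η => (hB _ _).trans ?_
  have h1 : B (fundamentalMap G w.proj ξ) = 0 := by rw [hξ, map_zero]
  exact DFunLike.congr_fun h1 _

/-- The regular level sets of the momentum are embedded submanifolds of codimension `dim G`. -/
theorem exists_isSmoothEmbedding_momentumLevel (hL : ContMDiff 𝓘(ℝ, E).tangent 𝓘(ℝ, ℝ) ∞ L)
    (hreg : ∀ (w : TangentBundle 𝓘(ℝ, E) M) (ξ : GroupLieAlgebra 𝓘(ℝ, EG) G),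
      (∀ η : GroupLieAlgebra 𝓘(ℝ, EG) G, hessian L w
        (fundamentalField E ξ w.proj) (fundamentalField E η w.proj) = 0) → ξ = 0)
    (μ : Module.Dual ℝ (GroupLieAlgebra 𝓘(ℝ, EG) G)) {d : ℕ}
    (hd : d = 2 * Module.finrank ℝ E - Module.finrank ℝ EG) :
    ∃ _ : ChartedSpace (EuclideanSpace ℝ (Fin d)) (momentumLevel L μ),
      IsManifold 𝓘(ℝ, EuclideanSpace ℝ (Fin d)) ∞ (momentumLevel L μ) ∧
      Manifold.IsSmoothEmbedding 𝓘(ℝ, EuclideanSpace ℝ (Fin d)) 𝓘(ℝ, E).tangent ∞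
        (Subtype.val : momentumLevel L μ → TangentBundle 𝓘(ℝ, E) M) := by
  let b := Module.finBasis ℝ EG
  -- A point `w` is required: injectivity of `ξ ↦ ξ̃` there gives `dim G ≤ dim M`, so the truncated
  -- subtraction defining `d` is exact.
  have hdim : ∀ w : TangentBundle 𝓘(ℝ, E) M,
      Module.finrank ℝ (EuclideanSpace ℝ (Fin d)) +
        Module.finrank ℝ (Fin (Module.finrank ℝ EG) → ℝ) = Module.finrank ℝ (E × E) := by
    intro w
    have h1 := LinearMap.finrank_le_finrank_of_injective
      (f := (fundamentalMap G w.proj : EG →L[ℝ] E).toLinearMap)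
      (injective_fundamentalMap hL w (hreg w))
    rw [finrank_euclideanSpace_fin, Module.finrank_fin_fun, Module.finrank_prod]
    omega
  refine exists_isSmoothEmbedding_of_slices (F := Fin (Module.finrank ℝ EG) → ℝ)
    (fun ⟨w, _⟩ => hdim w) fun w hw => ?_
  obtain ⟨Ψ, h1, h2, h3, h4⟩ := exists_coordinates_of_submersion
    (D := EuclideanSpace ℝ (Fin d)) (contMDiff_momentumMap hL μ b) w
    (surjective_mfderiv_momentumMap hL μ b w (hreg w)) (hdim w)
  refine ⟨Ψ, h1, fun y hy => ?_, h3, h4⟩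
  rw [h2 y hy, mem_momentumLevel_iff hL μ b]
  exact ⟨fun h => funext fun i => sub_eq_zero.2 (h i), fun h i => sub_eq_zero.1 (congrFun h i)⟩

end MomentumLevel

/-! ### Freeness and properness of the isotropy action. -/

section Topology

set_option linter.unusedSectionVars false

variable {EG : Type*} [NormedAddCommGroup EG] [NormedSpace ℝ EG] [FiniteDimensional ℝ EG]
  {G : Type*} [TopologicalSpace G] [ChartedSpace EG G] [Group G] [LieGroup 𝓘(ℝ, EG) ∞ G]
  {E : Type*} [NormedAddCommGroup E] [NormedSpace ℝ E]
  {M : Type*} [TopologicalSpace M] [ChartedSpace E M] [IsManifold 𝓘(ℝ, E) ∞ M]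
  [MulAction G M] [ContMDiffSMul 𝓘(ℝ, EG) 𝓘(ℝ, E) ∞ G M] {L : TangentBundle 𝓘(ℝ, E) M → ℝ}

theorem eq_one_of_isotropyAction_eq (hfree : ∀ (g : G) (m : M), g • m = m → g = 1)
    (hinv : IsInvariant G L) (μ : Module.Dual ℝ (GroupLieAlgebra 𝓘(ℝ, EG) G)) :
    letI := isotropyAction L hinv μ
    ∀ (k : isotropyGroup μ) (n : momentumLevel L μ), k • n = n → k = 1 := by
  intro k n hk
  exact Subtype.ext (hfree k n.1.proj (congrArg (fun x : momentumLevel L μ => x.1.proj) hk))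

theorem properSMul_isotropyAction [T2Space M] [ProperSMul G M] (hinv : IsInvariant G L)
    (μ : Module.Dual ℝ (GroupLieAlgebra 𝓘(ℝ, EG) G)) :
    letI := isotropyAction L hinv μ
    ProperSMul (isotropyGroup μ) (momentumLevel L μ) := by
  let _ := isotropyAction L hinv μ
  have h1 : T2Space (TangentBundle 𝓘(ℝ, E) M) := t2Space_tangentBundle
  have h2 : ContinuousSMul (isotropyGroup μ) (momentumLevel L μ) := by
    refine ⟨Continuous.subtype_mk (f := fun p : isotropyGroup μ × momentumLevel L μ =>
      tangentSMul E (p.1 : G) p.2.1) ?_ _⟩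
    exact (contMDiff_tangentSMul (EG := EG)).continuous.comp
      ((continuous_subtype_val.comp continuous_fst).prodMk
        (continuous_subtype_val.comp continuous_snd))
  have h3 : Continuous fun n : momentumLevel L μ => n.1.proj :=
    (FiberBundle.continuous_proj E (TangentSpace 𝓘(ℝ, E))).comp continuous_subtype_val
  exact properSMul_of_equivariant (isClosed_isotropyGroup μ) h3 fun k n => rfl

end Topology

/-! ### Lifting curves and maps through a smooth embedding. -/

section Embedded

set_option linter.unusedSectionVars false

variable {E : Type*} [NormedAddCommGroup E] [NormedSpace ℝ E]
  {H : Type*} [TopologicalSpace H] {I : ModelWithCorners ℝ E H}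
  {X : Type*} [TopologicalSpace X] [ChartedSpace H X] [IsManifold I ∞ X]
  {F : Type*} [NormedAddCommGroup F] [NormedSpace ℝ F]
  {S : Type*} [TopologicalSpace S] [ChartedSpace F S] [IsManifold 𝓘(ℝ, F) ∞ S] {ι : S → X}

/-- An immersion has a smooth local left inverse. -/
theorem exists_local_retraction {n : S} (h : Manifold.IsImmersionAt 𝓘(ℝ, F) I ∞ ι n) :
    ∃ (r : X → S) (U : Set X), IsOpen U ∧ ι n ∈ U ∧ ContMDiffOn I 𝓘(ℝ, F) ∞ r U ∧
      ∀ᶠ x in 𝓝 n, r (ι x) = x := by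
  -- In immersion charts the map is `u ↦ equiv (u, 0)`; `g` reads off the first component, which
  -- recovers the source coordinate.
  let g : X → F := fun x => (h.equiv.symm (h.codChart.extend I x)).1
  have hg : ContMDiffOn I 𝓘(ℝ, F) ∞ g h.codChart.source :=
    (contDiff_fst.comp h.equiv.symm.contDiff).contMDiff.comp_contMDiffOn
      (fun x hx => (h.codChart.contMDiffAt_extend h.codChart_mem_maximalAtlas hx).contMDiffWithinAt)
  have key : ∀ x ∈ h.domChart.source, g (ι x) = h.domChart x := by
    intro x hx
    have h1 : h.domChart.extend 𝓘(ℝ, F) x ∈ (h.domChart.extend 𝓘(ℝ, F)).target :=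
      (h.domChart.extend 𝓘(ℝ, F)).map_source (by rwa [h.domChart.extend_source])
    have h2 := h.writtenInCharts h1
    have h3 : (h.domChart.extend 𝓘(ℝ, F)).symm (h.domChart.extend 𝓘(ℝ, F) x) = x :=
      (h.domChart.extend 𝓘(ℝ, F)).left_inv (by rwa [h.domChart.extend_source])
    simp only [Function.comp_apply] at h2
    rw [h3] at h2
    simp only [g]
    rw [h2, ContinuousLinearEquiv.symm_apply_apply]
    rfl
  refine ⟨fun x => h.domChart.symm (g x), h.codChart.source ∩ g ⁻¹' h.domChart.target,
    hg.continuousOn.isOpen_inter_preimage h.codChart.open_source h.domChart.open_target,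
    ⟨h.mem_codChart_source, ?_⟩, ?_, ?_⟩
  · rw [mem_preimage, key n h.mem_domChart_source]
    exact h.domChart.map_source h.mem_domChart_source
  · exact (contMDiffOn_symm_of_mem_maximalAtlas h.domChart_mem_maximalAtlas).comp
      (hg.mono inter_subset_left) fun x hx => hx.2
  · filter_upwards [h.domChart.open_source.mem_nhds h.mem_domChart_source] with x hx
    rw [key x hx, h.domChart.left_inv hx]

theorem mfderiv_retraction_apply {n : S} (hι : MDifferentiableAt 𝓘(ℝ, F) I ι n) {r : X → S}
    (hr : MDifferentiableAt I 𝓘(ℝ, F) r (ι n)) (h : ∀ᶠ x in 𝓝 n, r (ι x) = x) (v : F) :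
    (mfderiv I 𝓘(ℝ, F) r (ι n) : E →L[ℝ] F) ((mfderiv 𝓘(ℝ, F) I ι n : F →L[ℝ] E) v) = v := by
  have h1 := hr.hasMFDerivAt.comp n hι.hasMFDerivAt
  have h2 : HasMFDerivAt 𝓘(ℝ, F) 𝓘(ℝ, F) (r ∘ ι) n
      (ContinuousLinearMap.id ℝ (TangentSpace 𝓘(ℝ, F) n)) :=
    (hasMFDerivAt_id n).congr_of_eventuallyEq h
  exact DFunLike.congr_fun (hasMFDerivAt_unique h1 h2) v

theorem injective_mfderiv_of_isSmoothEmbedding (hι : Manifold.IsSmoothEmbedding 𝓘(ℝ, F) I ∞ ι) (n : S) :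
    Function.Injective (mfderiv 𝓘(ℝ, F) I ι n : F →L[ℝ] E) := by
  obtain ⟨r, U, hU, hnU, hr, h⟩ := exists_local_retraction (hι.1.isImmersionAt n)
  exact Function.LeftInverse.injective (mfderiv_retraction_apply
    (hι.1.contMDiff.mdifferentiable (by simp) n)
    ((hr.contMDiffAt (hU.mem_nhds hnU)).mdifferentiableAt (by simp)) h)

/-- Near `t` the curve equals `r ∘ ι ∘ γ` for a smooth local left inverse `r`; the continuity of `γ`
needed for this comes from the topological embedding. -/
theorem exists_hasVelocityAt_of_isSmoothEmbedding
    (hι : Manifold.IsSmoothEmbedding 𝓘(ℝ, F) I ∞ ι) {γ : ℝ → S} {t : ℝ} {n : S} (hn : γ t = n)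
    {V : E} (hV : HasVelocityAt I (fun s => ι (γ s)) t V) :
    ∃ v : F, HasVelocityAt 𝓘(ℝ, F) γ t v ∧ (mfderiv 𝓘(ℝ, F) I ι n : F →L[ℝ] E) v = V := by
  subst hn
  obtain ⟨r, U, hU, hnU, hr, h⟩ := exists_local_retraction (hι.1.isImmersionAt (γ t))
  have hc : ContinuousAt γ t := hι.2.continuousAt_iff.2 hV.continuousAt
  have h1 := (hV.comp (x := ι (γ t)) rfl
    ((hr.contMDiffAt (hU.mem_nhds hnU)).mdifferentiableAt (by simp))).congr_of_eventuallyEq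
      (γ' := γ) ((hc.eventually h).mono fun s hs => hs.symm)
  refine ⟨_, h1, ?_⟩
  exact (h1.comp rfl (hι.1.contMDiff.mdifferentiable (by simp) (γ t))).unique hV

theorem contMDiffAt_of_comp_isSmoothEmbedding
    (hι : Manifold.IsSmoothEmbedding 𝓘(ℝ, F) I ∞ ι) {EY : Type*} [NormedAddCommGroup EY]
    [NormedSpace ℝ EY] {HY : Type*} [TopologicalSpace HY] {J : ModelWithCorners ℝ EY HY}
    {Y : Type*} [TopologicalSpace Y] [ChartedSpace HY Y] [IsManifold J ∞ Y] {f : Y → S} {y : Y}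
    (hf : ContMDiffAt J I ∞ (fun y => ι (f y)) y) : ContMDiffAt J 𝓘(ℝ, F) ∞ f y := by
  have hc : ContinuousAt f y := hι.2.continuousAt_iff.2 hf.continuousAt
  exact (ContMDiffAt.iff_comp_isImmersionAt (hι.1.isImmersionAt (f y))).2 ⟨hc, hf⟩

/-- A map into the tangent bundle of a submanifold is smooth if it is smooth as a map into the
tangent bundle of the ambient manifold. -/
theorem contMDiffAt_of_comp_tangentMap
    (hι : Manifold.IsSmoothEmbedding 𝓘(ℝ, F) I ∞ ι) {EY : Type*} [NormedAddCommGroup EY]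
    [NormedSpace ℝ EY] {HY : Type*} [TopologicalSpace HY] {J : ModelWithCorners ℝ EY HY}
    {Y : Type*} [TopologicalSpace Y] [ChartedSpace HY Y] {f : Y → TangentBundle 𝓘(ℝ, F) S} {y : Y}
    (hf : ContMDiffAt J I.tangent ∞ (fun y => tangentMap 𝓘(ℝ, F) I ι (f y)) y) :
    ContMDiffAt J 𝓘(ℝ, F).tangent ∞ f y := by
  obtain ⟨r, U, hU, hnU, hr, h⟩ := exists_local_retraction (hι.1.isImmersionAt (f y).proj)
  have hιd := hι.1.contMDiff.mdifferentiable (n := ∞) (by simp)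
  have hc : ContinuousAt (fun y => (f y).proj) y := by
    rw [hι.2.continuousAt_iff]
    exact ((FiberBundle.continuous_proj E (TangentSpace I)).continuousAt.comp hf.continuousAt :)
  have h1 : ContMDiffAt I.tangent 𝓘(ℝ, F).tangent ∞ (tangentMap I 𝓘(ℝ, F) r)
      (tangentMap 𝓘(ℝ, F) I ι (f y)) := by
    have h2 := hr.contMDiffOn_tangentMapWithin (m := ∞) (by simp) hU.uniqueMDiffOn
    have h3 : IsOpen (π E (TangentSpace I) ⁻¹' U) :=
      hU.preimage (FiberBundle.continuous_proj E (TangentSpace I))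
    refine ((h2.congr fun p hp => ?_).contMDiffAt (h3.mem_nhds hnU))
    exact (tangentMapWithin_eq_tangentMap (hU.uniqueMDiffOn _ hp)
      ((hr.contMDiffAt (hU.mem_nhds hp)).mdifferentiableAt (by simp))).symm
  -- Near `y` the map `f` equals `Tr ∘ Tι ∘ f`, by differentiating `r ∘ ι = id`.
  refine (h1.comp y hf).congr_of_eventuallyEq ?_
  have hcU : ∀ᶠ x in 𝓝 (f y).proj, ι x ∈ U :=
    hι.2.continuous.continuousAt.eventually (hU.mem_nhds hnU)
  filter_upwards [hc.eventually h.eventually_nhds, hc.eventually hcU] with z hz hzU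
  have h4 := mfderiv_retraction_apply (hιd (f z).proj)
    ((hr.contMDiffAt (hU.mem_nhds hzU)).mdifferentiableAt (by simp)) hz (f z).2
  have h5 : ∀ (n : S) (v w : F), r (ι n) = n → w = v →
      (⟨n, v⟩ : TangentBundle 𝓘(ℝ, F) S) = ⟨r (ι n), w⟩ := by
    rintro n v w hn rfl
    have : ∀ n', n' = n → (⟨n, w⟩ : TangentBundle 𝓘(ℝ, F) S) = ⟨n', w⟩ := by rintro _ rfl; rfl
    exact this _ hn
  exact h5 _ _ _ hz.self_of_nhds h4

end Embedded

/-! ### Differentiability of a continuous curve from that of its image. -/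

section Immersion

set_option linter.unusedSectionVars false

variable {EX : Type*} [NormedAddCommGroup EX] [NormedSpace ℝ EX] [FiniteDimensional ℝ EX]
  {X : Type*} [TopologicalSpace X] [ChartedSpace EX X] [IsManifold 𝓘(ℝ, EX) ∞ X]
  {EZ : Type*} [NormedAddCommGroup EZ] [NormedSpace ℝ EZ] [FiniteDimensional ℝ EZ]
  {Z : Type*} [TopologicalSpace Z] [ChartedSpace EZ Z] [IsManifold 𝓘(ℝ, EZ) ∞ Z]

/-- A continuous curve is differentiable where its image under an immersion is. -/
theorem exists_hasVelocityAt_of_injective_mfderiv {f : X → Z} {γ : ℝ → X} {t : ℝ} {x : X}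
    (hx : γ t = x) (hf : ContMDiffAt 𝓘(ℝ, EX) 𝓘(ℝ, EZ) ∞ f x)
    (hinj : Function.Injective (mfderiv 𝓘(ℝ, EX) 𝓘(ℝ, EZ) f x)) (hγ : ContinuousAt γ t) {V : EZ}
    (hV : HasVelocityAt 𝓘(ℝ, EZ) (fun s => f (γ s)) t V) :
    ∃ v : EX, HasVelocityAt 𝓘(ℝ, EX) γ t v := by
  subst hx
  have : CompleteSpace EX := FiniteDimensional.complete ℝ EX
  let φ := extChartAt 𝓘(ℝ, EX) (γ t)
  let χ := extChartAt 𝓘(ℝ, EZ) (f (γ t))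
  have hφs : ContMDiffAt 𝓘(ℝ, EX) 𝓘(ℝ, EX) ∞ φ.symm (φ (γ t)) :=
    (contMDiffOn_extChartAt_symm (γ t)).contMDiffAt (extChartAt_target_mem_nhds (γ t))
  have hφφ : φ.symm (φ (γ t)) = γ t := extChartAt_to_inv (γ t)
  have hχ : ContMDiffAt 𝓘(ℝ, EZ) 𝓘(ℝ, EZ) ∞ χ (f (γ t)) := contMDiffAt_extChartAt
  have h1 : ContMDiffAt 𝓘(ℝ, EX) 𝓘(ℝ, EZ) ∞ (χ ∘ f ∘ φ.symm) (φ (γ t)) := by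
    refine ContMDiffAt.comp_of_eq hχ (ContMDiffAt.comp_of_eq hf hφs hφφ) ?_
    rw [Function.comp_apply, hφφ]
  let D := fderiv ℝ (χ ∘ f ∘ φ.symm) (φ (γ t))
  have hD : Function.Injective D := by
    have h2 : mfderiv 𝓘(ℝ, EX) 𝓘(ℝ, EZ) f (γ t) = D := by
      refine (hf.mdifferentiableAt (by simp)).mfderiv.trans ?_
      rw [ModelWithCorners.range_eq_univ, fderivWithin_univ]
      rfl
    rw [← h2]
    exact hinj
  -- Composing with a linear left inverse of the derivative yields a self-map `k` of `EX` with
  -- derivative the identity, hence locally invertible; the curve is then a smooth function of its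
  -- image.
  obtain ⟨q, hq⟩ := D.toLinearMap.exists_leftInverse_of_injective (LinearMap.ker_eq_bot.2 hD)
  let q' : EZ →L[ℝ] EX := LinearMap.toContinuousLinearMap q
  let k : EX → EX := q' ∘ χ ∘ f ∘ φ.symm
  have hk : ContDiffAt ℝ ∞ k (φ (γ t)) := q'.contDiff.contDiffAt.comp _ h1.contDiffAt
  have hkd : HasFDerivAt k ((ContinuousLinearEquiv.refl ℝ EX : EX ≃L[ℝ] EX) : EX →L[ℝ] EX)
      (φ (γ t)) := by
    have h3 := q'.hasFDerivAt.comp (φ (γ t))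
      (h1.contDiffAt.differentiableAt (by simp)).hasFDerivAt
    refine h3.congr_fderiv ?_
    ext v
    exact DFunLike.congr_fun hq v
  have hks := hk.hasStrictFDerivAt' hkd (by simp)
  have hl := hk.to_localInverse hkd (by simp)
  have hleft := hks.eventually_left_inverse
  let l : EX → EX := hks.localInverse k _ _
  have hcφ : ContinuousAt (fun s => φ (γ s)) t := (continuousAt_extChartAt (γ t)).comp hγ
  have hsrc : ∀ᶠ s in 𝓝 t, γ s ∈ φ.source := hγ.eventually (extChartAt_source_mem_nhds (γ t))
  have hγ' : ∀ᶠ s in 𝓝 t, γ s = φ.symm (l (q' (χ (f (γ s))))) := by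
    filter_upwards [hcφ.eventually hleft, hsrc] with s h4 h5
    have h6 : k (φ (γ s)) = q' (χ (f (γ s))) := by
      simp only [k, Function.comp_apply]
      rw [φ.left_inv h5]
    rw [← h6]
    exact (φ.left_inv h5).symm.trans (congrArg φ.symm h4.symm)
  have hk0 : k (φ (γ t)) = q' (χ (f (γ t))) := by
    simp only [k, Function.comp_apply]
    rw [hφφ]
  have hlc : ContMDiffAt 𝓘(ℝ, EX) 𝓘(ℝ, EX) ∞ l (q' (χ (f (γ t)))) := by
    rw [← hk0]; exact hl.contMDiffAt
  have hl0 : l (q' (χ (f (γ t)))) = φ (γ t) := by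
    rw [← hk0]; exact hleft.self_of_nhds
  have hmain : ContMDiffAt 𝓘(ℝ, EZ) 𝓘(ℝ, EX) ∞ (fun z => φ.symm (l (q' (χ z)))) (f (γ t)) :=
    ContMDiffAt.comp_of_eq hφs (ContMDiffAt.comp (f (γ t)) hlc
      (q'.contDiff.contMDiff.contMDiffAt.comp (f (γ t)) hχ)) hl0
  exact ⟨_, (hV.comp (x := f (γ t)) rfl (hmain.mdifferentiableAt (by simp))).congr_of_eventuallyEq
    hγ'⟩

end Immersion

/-! ### Smooth dependence of solutions of linear systems. -/

section Det

variable {EY : Type*} [NormedAddCommGroup EY] [NormedSpace ℝ EY] {HY : Type*} [TopologicalSpace HY]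
  {J : ModelWithCorners ℝ EY HY} {Y : Type*} [TopologicalSpace Y] [ChartedSpace HY Y]
  {n : Type*} [Fintype n] [DecidableEq n]

theorem contDiff_det : ContDiff ℝ ∞ (fun A : n → n → ℝ => Matrix.det (Matrix.of A)) := by
  simp only [Matrix.det_apply', Matrix.of_apply]
  refine ContDiff.sum fun σ _ => contDiff_const.mul (contDiff_prod fun i _ => ?_)
  fun_prop

theorem contMDiffAt_det {A : Y → Matrix n n ℝ} {y : Y}
    (hA : ∀ i j, ContMDiffAt J 𝓘(ℝ, ℝ) ∞ (fun y => A y i j) y) :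
    ContMDiffAt J 𝓘(ℝ, ℝ) ∞ (fun y => (A y).det) y := by
  have h : ContMDiffAt J 𝓘(ℝ, n → n → ℝ) ∞ (fun y i j => A y i j) y :=
    contMDiffAt_pi_space.2 fun i => contMDiffAt_pi_space.2 fun j => hA i j
  exact ContMDiffAt.comp (I' := 𝓘(ℝ, n → n → ℝ)) (M' := n → n → ℝ)
    (g := fun A : n → n → ℝ => Matrix.det (Matrix.of A)) (f := fun y i j => A y i j) y (contDiff_det (n := n)).contMDiff.contMDiffAt h

/-- Cramer's rule expresses each component as a quotient of determinants, which are polynomial in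
the entries. -/
theorem contMDiffAt_inv_mulVec {A : Y → Matrix n n ℝ} {c : Y → n → ℝ} {y : Y}
    (hA : ∀ i j, ContMDiffAt J 𝓘(ℝ, ℝ) ∞ (fun y => A y i j) y)
    (hc : ∀ i, ContMDiffAt J 𝓘(ℝ, ℝ) ∞ (fun y => c y i) y) (hdet : (A y).det ≠ 0) (i : n) :
    ContMDiffAt J 𝓘(ℝ, ℝ) ∞ (fun y => ((A y)⁻¹.mulVec (c y)) i) y := by
  have h1 : ∀ y, ((A y)⁻¹.mulVec (c y)) i = (A y).det⁻¹ * ((A y).updateCol i (c y)).det := by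
    intro y
    rw [Matrix.inv_def, Ring.inverse_eq_inv', Matrix.smul_mulVec, ← Matrix.cramer_eq_adjugate_mulVec,
      Pi.smul_apply, Matrix.cramer_apply, smul_eq_mul]
  simp only [h1]
  refine ((contMDiffAt_det hA).inv₀ hdet).mul (contMDiffAt_det fun k j => ?_)
  by_cases h : j = i
  · subst h
    simpa using hc k
  · simpa [Matrix.updateCol_ne h] using hA k j

end Det

/-! ### The component of a vector along the isotropy directions. -/

section IsotropyComponent

set_option linter.unusedSectionVars false

variable {EG : Type*} [NormedAddCommGroup EG] [NormedSpace ℝ EG] [FiniteDimensional ℝ EG]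
  {G : Type*} [TopologicalSpace G] [ChartedSpace EG G] [Group G] [LieGroup 𝓘(ℝ, EG) ∞ G]
  {E : Type*} [NormedAddCommGroup E] [NormedSpace ℝ E]
  {M : Type*} [TopologicalSpace M] [ChartedSpace E M] [IsManifold 𝓘(ℝ, E) ∞ M]
  [MulAction G M] [ContMDiffSMul 𝓘(ℝ, EG) 𝓘(ℝ, E) ∞ G M] {L : TangentBundle 𝓘(ℝ, E) M → ℝ}
  (μ : Module.Dual ℝ (GroupLieAlgebra 𝓘(ℝ, EG) G))

/-- The Hessian, as a function on the model space. -/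
noncomputable def modelHessian (L : TangentBundle 𝓘(ℝ, E) M → ℝ) (w : TangentBundle 𝓘(ℝ, E) M)
    (u v : E) : ℝ :=
  hessian L w u v

theorem exists_modelHessian_eq (hL : ContMDiff 𝓘(ℝ, E).tangent 𝓘(ℝ, ℝ) ∞ L)
    (w : TangentBundle 𝓘(ℝ, E) M) :
    ∃ B : E →L[ℝ] E →L[ℝ] ℝ, (∀ u v : E, modelHessian L w u v = B u v) ∧ ∀ u v, B u v = B v u :=
  exists_hessian_eq hL w

/-- The isotropy algebra, as a subspace of the model space. -/
noncomputable def isotropySpace : Submodule ℝ EG := isotropySubmodule μ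

/-- A basis of the isotropy algebra. -/
noncomputable def isotropyBasis :
    Module.Basis (Fin (Module.finrank ℝ (isotropySpace μ))) ℝ (isotropySpace μ) :=
  Module.finBasis ℝ (isotropySpace μ)

/-- The matrix of the Hessian on the isotropy algebra. -/
noncomputable def isotropyGram (L : TangentBundle 𝓘(ℝ, E) M → ℝ) (w : TangentBundle 𝓘(ℝ, E) M) :
    Matrix (Fin (Module.finrank ℝ (isotropySpace μ))) (Fin (Module.finrank ℝ (isotropySpace μ))) ℝ :=
  fun i j => modelHessian L w (fundamentalMap G w.proj (isotropyBasis μ i : EG))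
    (fundamentalMap G w.proj (isotropyBasis μ j : EG))

/-- The element of the isotropy algebra whose fundamental vector is the component of `u` along
the isotropy directions with respect to the Hessian. -/
noncomputable def isotropyComponent (L : TangentBundle 𝓘(ℝ, E) M → ℝ)
    (w : TangentBundle 𝓘(ℝ, E) M) (u : E) : EG :=
  ∑ i, ((isotropyGram μ L w)⁻¹.mulVec
    (fun i => modelHessian L w (fundamentalMap G w.proj (isotropyBasis μ i : EG)) u)) i •
      (isotropyBasis μ i : EG)

theorem isotropyComponent_mem (w : TangentBundle 𝓘(ℝ, E) M) (u : E) :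
    isotropyComponent μ L w u ∈ isotropySpace μ :=
  Submodule.sum_mem _ fun i _ => Submodule.smul_mem _ _ (isotropyBasis μ i).2

theorem exists_isotropyComponent_eq (hL : ContMDiff 𝓘(ℝ, E).tangent 𝓘(ℝ, ℝ) ∞ L)
    (w : TangentBundle 𝓘(ℝ, E) M) :
    ∃ T : E →L[ℝ] EG, ∀ u, isotropyComponent μ L w u = T u := by
  obtain ⟨B, hB, -⟩ := exists_modelHessian_eq hL w
  refine ⟨∑ i, (∑ j, (isotropyGram μ L w)⁻¹ i j •
    B (fundamentalMap G w.proj (isotropyBasis μ j : EG))).smulRight (isotropyBasis μ i : EG),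
    fun u => ?_⟩
  simp [isotropyComponent, Matrix.mulVec, dotProduct, hB]

variable {μ} {w : TangentBundle 𝓘(ℝ, E) M}

theorem hessian_isotropy_ext (hL : ContMDiff 𝓘(ℝ, E).tangent 𝓘(ℝ, ℝ) ∞ L) {u u' : E}
    (h : ∀ i, modelHessian L w (fundamentalMap G w.proj (isotropyBasis μ i : EG)) u =
      modelHessian L w (fundamentalMap G w.proj (isotropyBasis μ i : EG)) u')
    {η : EG} (hη : η ∈ isotropySpace μ) :
    modelHessian L w (fundamentalMap G w.proj η) u = modelHessian L w (fundamentalMap G w.proj η) u' := by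
  obtain ⟨B, hB, -⟩ := exists_modelHessian_eq hL w
  let T : E → isotropySpace μ →ₗ[ℝ] ℝ := fun u =>
    ((B.flip u) ∘L fundamentalMap G w.proj).toLinearMap ∘ₗ (isotropySpace μ).subtype
  have h1 : T u = T u' := (isotropyBasis μ).ext fun i => by
    exact (hB _ u).symm.trans ((h i).trans (hB _ u'))
  exact (hB _ u).trans ((DFunLike.congr_fun h1 ⟨η, hη⟩).trans (hB _ u').symm)

theorem hessian_fundamentalMap_sum (hL : ContMDiff 𝓘(ℝ, E).tangent 𝓘(ℝ, ℝ) ∞ L)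
    (a : Fin (Module.finrank ℝ (isotropySpace μ)) → ℝ)
    (i : Fin (Module.finrank ℝ (isotropySpace μ))) :
    modelHessian L w (fundamentalMap G w.proj (isotropyBasis μ i : EG))
      (fundamentalMap G w.proj (∑ j, a j • (isotropyBasis μ j : EG))) =
        (isotropyGram μ L w).mulVec a i := by
  obtain ⟨B, hB, -⟩ := exists_modelHessian_eq hL w
  simp [isotropyGram, Matrix.mulVec, dotProduct, hB, mul_comm]

theorem eq_zero_of_hessian_isotropy (hL : ContMDiff 𝓘(ℝ, E).tangent 𝓘(ℝ, ℝ) ∞ L)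
    (hw : ∀ ξ ∈ isotropyAlgebra μ, (∀ η ∈ isotropyAlgebra μ, hessian L w
      (fundamentalField E ξ w.proj) (fundamentalField E η w.proj) = 0) → ξ = 0)
    {ξ : EG} (hξ : ξ ∈ isotropySpace μ)
    (h : ∀ η ∈ isotropySpace μ,
      modelHessian L w (fundamentalMap G w.proj η) (fundamentalMap G w.proj ξ) = 0) : ξ = 0 := by
  obtain ⟨B, hB, hs⟩ := exists_modelHessian_eq hL w
  refine hw ξ hξ fun η hη => ?_
  exact (hB _ _).trans ((hs _ _).trans ((hB _ _).symm.trans (h η hη)))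

/-- A null vector of the Gram matrix is the coordinate vector of an element of `𝔤_μ` orthogonal to
all of `𝔤_μ`, which is zero by `hw`. -/
theorem det_isotropyGram_ne_zero (hL : ContMDiff 𝓘(ℝ, E).tangent 𝓘(ℝ, ℝ) ∞ L)
    (hw : ∀ ξ ∈ isotropyAlgebra μ, (∀ η ∈ isotropyAlgebra μ, hessian L w
      (fundamentalField E ξ w.proj) (fundamentalField E η w.proj) = 0) → ξ = 0) :
    (isotropyGram μ L w).det ≠ 0 := by
  intro hdet
  obtain ⟨a, ha, h⟩ := Matrix.exists_mulVec_eq_zero_iff.2 hdet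
  obtain ⟨B, hB, -⟩ := exists_modelHessian_eq hL w
  have h1 : ∑ j, a j • (isotropyBasis μ j : EG) = 0 := by
    refine eq_zero_of_hessian_isotropy hL hw
      (Submodule.sum_mem _ fun i _ => Submodule.smul_mem _ _ (isotropyBasis μ i).2) fun η hη => ?_
    refine (hessian_isotropy_ext hL (u' := 0) (fun i => ?_) hη).trans ?_
    · rw [hessian_fundamentalMap_sum hL, h]
      exact ((hB _ 0).trans (map_zero _)).symm
    · exact (hB _ 0).trans (map_zero _)
  have h2 : ∑ j, a j • isotropyBasis μ j = 0 := Subtype.ext (by simpa using h1)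
  exact ha (funext fun i => Fintype.linearIndependent_iff.1 (isotropyBasis μ).linearIndependent a h2 i)

theorem hessian_isotropyComponent (hL : ContMDiff 𝓘(ℝ, E).tangent 𝓘(ℝ, ℝ) ∞ L)
    (hw : ∀ ξ ∈ isotropyAlgebra μ, (∀ η ∈ isotropyAlgebra μ, hessian L w
      (fundamentalField E ξ w.proj) (fundamentalField E η w.proj) = 0) → ξ = 0) (u : E) {η : EG}
    (hη : η ∈ isotropySpace μ) :
    modelHessian L w (fundamentalMap G w.proj η)
      (fundamentalMap G w.proj (isotropyComponent μ L w u)) =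
        modelHessian L w (fundamentalMap G w.proj η) u := by
  refine hessian_isotropy_ext hL (fun i => ?_) hη
  rw [isotropyComponent, hessian_fundamentalMap_sum hL, Matrix.mulVec_mulVec,
    Matrix.mul_nonsing_inv _ (isUnit_iff_ne_zero.2 (det_isotropyGram_ne_zero hL hw)),
    Matrix.one_mulVec]

/-- The difference of two solutions in `𝔤_μ` is orthogonal to `𝔤_μ`. This is what makes the
connection fix vectors tangent to the orbit. -/
theorem isotropyComponent_unique (hL : ContMDiff 𝓘(ℝ, E).tangent 𝓘(ℝ, ℝ) ∞ L)
    (hw : ∀ ξ ∈ isotropyAlgebra μ, (∀ η ∈ isotropyAlgebra μ, hessian L w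
      (fundamentalField E ξ w.proj) (fundamentalField E η w.proj) = 0) → ξ = 0) {u : E} {ξ : EG}
    (hξ : ξ ∈ isotropySpace μ) (h : ∀ η ∈ isotropySpace μ,
      modelHessian L w (fundamentalMap G w.proj η) (fundamentalMap G w.proj ξ) =
        modelHessian L w (fundamentalMap G w.proj η) u) : isotropyComponent μ L w u = ξ := by
  obtain ⟨B, hB, -⟩ := exists_modelHessian_eq hL w
  refine sub_eq_zero.1 (eq_zero_of_hessian_isotropy hL hw
    (Submodule.sub_mem _ (isotropyComponent_mem μ w u) hξ) fun η hη => ?_)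
  have h1 := (hessian_isotropyComponent hL hw u hη).trans (h η hη).symm
  have h2 : B (fundamentalMap G w.proj η) (fundamentalMap G w.proj (isotropyComponent μ L w u)) =
    B (fundamentalMap G w.proj η) (fundamentalMap G w.proj ξ) :=
    (hB _ _).symm.trans (h1.trans (hB _ _))
  refine (hB _ _).trans ?_
  rw [map_sub, map_sub, h2, sub_self]

theorem isotropyComponent_eq_zero_iff (hL : ContMDiff 𝓘(ℝ, E).tangent 𝓘(ℝ, ℝ) ∞ L)
    (hw : ∀ ξ ∈ isotropyAlgebra μ, (∀ η ∈ isotropyAlgebra μ, hessian L w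
      (fundamentalField E ξ w.proj) (fundamentalField E η w.proj) = 0) → ξ = 0) (u : E) :
    isotropyComponent μ L w u = 0 ↔ ∀ η ∈ isotropySpace μ,
      modelHessian L w (fundamentalMap G w.proj η) u = 0 := by
  obtain ⟨B, hB, -⟩ := exists_modelHessian_eq hL w
  have h0 : ∀ η : EG, modelHessian L w (fundamentalMap G w.proj η) (fundamentalMap G w.proj (0 : EG)) = 0 :=
    fun η => (hB _ _).trans (by rw [map_zero, map_zero])
  refine ⟨fun h η hη => ?_, fun h =>
    isotropyComponent_unique hL hw (Submodule.zero_mem _) fun η hη => (h0 η).trans (h η hη).symm⟩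
  rw [← hessian_isotropyComponent hL hw u hη, h]
  exact h0 η

variable {EY : Type*} [NormedAddCommGroup EY] [NormedSpace ℝ EY] {HY : Type*} [TopologicalSpace HY]
  {J : ModelWithCorners ℝ EY HY} {Y : Type*} [TopologicalSpace Y] [ChartedSpace HY Y]

theorem contMDiffAt_isotropyComponent (hL : ContMDiff 𝓘(ℝ, E).tangent 𝓘(ℝ, ℝ) ∞ L)
    {f : Y → TangentBundle 𝓘(ℝ, E) M} {u : Y → E} {y : Y}
    (hw : ∀ ξ ∈ isotropyAlgebra μ, (∀ η ∈ isotropyAlgebra μ, hessian L (f y)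
      (fundamentalField E ξ (f y).proj) (fundamentalField E η (f y).proj) = 0) → ξ = 0)
    (hf : ContMDiffAt J 𝓘(ℝ, E).tangent ∞ f y)
    (hu : ContMDiffAt J 𝓘(ℝ, E).tangent ∞
      (fun y => (⟨(f y).proj, u y⟩ : TangentBundle 𝓘(ℝ, E) M)) y) :
    ContMDiffAt J 𝓘(ℝ, EG) ∞ (fun y => isotropyComponent μ L (f y) (u y)) y := by
  have he : ∀ i, ContMDiffAt J 𝓘(ℝ, E).tangent ∞ (fun y => (⟨(f y).proj,
      fundamentalMap (E := E) G (f y).proj (isotropyBasis μ i : EG)⟩ : TangentBundle 𝓘(ℝ, E) M)) y := fun i =>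
    ContMDiffAt.comp y (contMDiff_fundamentalField_proj (EG := EG) (G := G)
      (isotropyBasis μ i : EG)).contMDiffAt hf
  refine contMDiffAt_finsetSum fun i _ => ContMDiffAt.comp y
    (ContinuousLinearMap.toSpanSingleton ℝ (isotropyBasis μ i : EG)).contDiff.contMDiff.contMDiffAt
    ?_
  exact contMDiffAt_inv_mulVec (fun i j => contMDiffAt_hessian hL hf (he i) (he j))
    (fun i => contMDiffAt_hessian hL hf (he i) hu) (det_isotropyGram_ne_zero hL hw) i

end IsotropyComponent

/-! ### Orbit tangent spaces and construction of the connection. -/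

section MechanicalConnection

set_option linter.unusedSectionVars false

variable {EG : Type*} [NormedAddCommGroup EG] [NormedSpace ℝ EG] [FiniteDimensional ℝ EG]
  {G : Type*} [TopologicalSpace G] [ChartedSpace EG G] [Group G] [LieGroup 𝓘(ℝ, EG) ∞ G]
  {E : Type*} [NormedAddCommGroup E] [NormedSpace ℝ E] [FiniteDimensional ℝ E]
  {M : Type*} [TopologicalSpace M] [ChartedSpace E M] [IsManifold 𝓘(ℝ, E) ∞ M]
  [MulAction G M] [ContMDiffSMul 𝓘(ℝ, EG) 𝓘(ℝ, E) ∞ G M]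
  {F : Type*} [NormedAddCommGroup F] [NormedSpace ℝ F]
  {L : TangentBundle 𝓘(ℝ, E) M → ℝ} (hinv : IsInvariant G L)
  {μ : Module.Dual ℝ (GroupLieAlgebra 𝓘(ℝ, EG) G)}
  [ChartedSpace F (momentumLevel L μ)] [IsManifold 𝓘(ℝ, F) ∞ (momentumLevel L μ)]

/-- The derivative at the identity of the orbit map of `w`, as a linear map of model spaces. -/
noncomputable def tangentFundamentalMap (G : Type*) [TopologicalSpace G] [ChartedSpace EG G]
    [Group G] [MulAction G M] (w : TangentBundle 𝓘(ℝ, E) M) : EG →L[ℝ] E × E :=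
  mfderiv 𝓘(ℝ, EG) 𝓘(ℝ, E).tangent (fun g : G => tangentSMul E g w) 1

/-- The derivative of the inclusion of the level set. -/
noncomputable def inclusionDeriv (n : momentumLevel L μ) : F →L[ℝ] E × E :=
  mfderiv 𝓘(ℝ, F) 𝓘(ℝ, E).tangent (Subtype.val : momentumLevel L μ → TangentBundle 𝓘(ℝ, E) M) n

/-- The derivative of the projection of the level set to the base. -/
noncomputable def projDeriv (n : momentumLevel L μ) : F →L[ℝ] E :=
  mfderiv 𝓘(ℝ, F) 𝓘(ℝ, E) (fun x : momentumLevel L μ => x.1.proj) n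

theorem contMDiff_proj_momentumLevel
    (hι : Manifold.IsSmoothEmbedding 𝓘(ℝ, F) 𝓘(ℝ, E).tangent ∞
      (Subtype.val : momentumLevel L μ → TangentBundle 𝓘(ℝ, E) M)) :
    ContMDiff 𝓘(ℝ, F) 𝓘(ℝ, E) ∞ (fun x : momentumLevel L μ => x.1.proj) :=
  (contMDiff_proj (TangentSpace 𝓘(ℝ, E))).comp hι.1.contMDiff

theorem projDeriv_eq
    (hι : Manifold.IsSmoothEmbedding 𝓘(ℝ, F) 𝓘(ℝ, E).tangent ∞
      (Subtype.val : momentumLevel L μ → TangentBundle 𝓘(ℝ, E) M))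
    (n : momentumLevel L μ) (v : F) :
    projDeriv n v = (mfderiv 𝓘(ℝ, E).tangent 𝓘(ℝ, E)
      (fun w : TangentBundle 𝓘(ℝ, E) M => w.proj) n.1 : E × E →L[ℝ] E) (inclusionDeriv n v) :=
  mfderiv_comp_apply (I := 𝓘(ℝ, F)) (I' := 𝓘(ℝ, E).tangent) (I'' := 𝓘(ℝ, E))
    (f := (Subtype.val : momentumLevel L μ → TangentBundle 𝓘(ℝ, E) M))
    (g := fun w : TangentBundle 𝓘(ℝ, E) M => w.proj) n
    ((contMDiff_proj (TangentSpace 𝓘(ℝ, E)) (n := ∞)).mdifferentiable (by simp) _)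
    (hι.1.contMDiff.mdifferentiable (by simp) n) v

theorem projDeriv_of_inclusionDeriv
    (hι : Manifold.IsSmoothEmbedding 𝓘(ℝ, F) 𝓘(ℝ, E).tangent ∞
      (Subtype.val : momentumLevel L μ → TangentBundle 𝓘(ℝ, E) M))
    {n : momentumLevel L μ} {v : F} {ξ : EG}
    (h : inclusionDeriv n v = tangentFundamentalMap G n.1 ξ) :
    projDeriv n v = fundamentalMap G n.1.proj ξ := by
  rw [projDeriv_eq hι, h]
  exact mfderiv_proj_tangentFundamentalField (G := G) ξ n.1

/-- A curve in `G_μ` with velocity `ξ` moves `n` inside `N_μ`; its velocity in `TM` is the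
fundamental vector of `ξ`, and it lifts to `N_μ` through the embedding. -/
theorem exists_mem_orbitTangent
    (hι : Manifold.IsSmoothEmbedding 𝓘(ℝ, F) 𝓘(ℝ, E).tangent ∞
      (Subtype.val : momentumLevel L μ → TangentBundle 𝓘(ℝ, E) M))
    (n : momentumLevel L μ) {ξ : EG} (hξ : ξ ∈ isotropySpace μ) :
    letI := isotropyAction L hinv μ
    ∃ v : F, v ∈ orbitTangent (F := F) (isotropyGroup μ) n ∧
      inclusionDeriv n v = tangentFundamentalMap G n.1 ξ := by
  let _ := isotropyAction L hinv μ
  obtain ⟨γ, h0, hmem, hγ⟩ := exists_curve_isotropyGroup μ hξ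
  have hc0 : (⟨γ 0, hmem 0⟩ : isotropyGroup μ) • n = n := by
    have : (⟨γ 0, hmem 0⟩ : isotropyGroup μ) = 1 := Subtype.ext h0
    rw [this, one_smul]
  obtain ⟨v, hv, hv'⟩ := exists_hasVelocityAt_of_isSmoothEmbedding hι
    (γ := fun t => (⟨γ t, hmem t⟩ : isotropyGroup μ) • n) (t := 0) hc0 (hγ.tangentSMul h0 n.1)
  exact ⟨v, ⟨_, hc0, fun t => ⟨_, rfl⟩, hv⟩, hv'⟩

/-- The curve in the orbit is `g t • n`, where nothing is known in advance about the dependence of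
`g t` on `t`. Its regularity at `0` is recovered from the projected curve `g t • m` in `M`, using
the orbit map of `G` on `M`. -/
theorem exists_inclusionDeriv_of_mem_orbitTangent [T2Space M] [ProperSMul G M]
    (hfree : ∀ (g : G) (m : M), g • m = m → g = 1)
    (hι : Manifold.IsSmoothEmbedding 𝓘(ℝ, F) 𝓘(ℝ, E).tangent ∞
      (Subtype.val : momentumLevel L μ → TangentBundle 𝓘(ℝ, E) M))
    (n : momentumLevel L μ)
    (hinj : Function.Injective (fundamentalMap (E := E) G n.1.proj : EG → E)) {v : F} :
    letI := isotropyAction L hinv μ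
    v ∈ orbitTangent (F := F) (isotropyGroup μ) n →
      ∃ ξ : EG, ξ ∈ isotropySpace μ ∧ inclusionDeriv n v = tangentFundamentalMap G n.1 ξ := by
  let _ := isotropyAction L hinv μ
  rintro ⟨γ, h0, horb, hv⟩
  choose g hg using horb
  have hv' : HasVelocityAt 𝓘(ℝ, F) γ 0 v := hv
  have hg' : ∀ t, ((g t : G) • n.1.proj) = (γ t).1.proj := fun t =>
    congrArg (fun x : momentumLevel L μ => x.1.proj) (hg t)
  have hg0 : (g 0 : G) = 1 := hfree _ n.1.proj (by rw [hg' 0, h0])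
  have h1 := hv'.comp h0 ((contMDiff_proj_momentumLevel hι).mdifferentiable (by simp) n)
  have h2 : HasVelocityAt 𝓘(ℝ, E) (fun t => (g t : G) • n.1.proj) 0 (projDeriv n v) :=
    h1.congr_of_eventuallyEq (Eventually.of_forall hg')
  -- Freeness and properness make the orbit map an embedding, so `g` inherits continuity at `0`;
  -- injectivity of the derivative of the orbit map then gives a velocity.
  have hc : ContinuousAt (fun t => (g t : G)) 0 :=
    (isClosedEmbedding_orbitMap hfree n.1.proj).isInducing.continuousAt_iff.2 h2.continuousAt
  have ho : ContMDiff 𝓘(ℝ, EG) 𝓘(ℝ, E) ∞ (fun a : G => a • n.1.proj) :=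
    ContMDiff.smul contMDiff_id contMDiff_const
  obtain ⟨ξ, hξ⟩ := exists_hasVelocityAt_of_injective_mfderiv hg0 (ho 1) hinj hc h2
  refine ⟨ξ, mem_isotropyAlgebra_of_hasVelocityAt μ hg0
    (Eventually.of_forall fun t => (g t).2) hξ, ?_⟩
  have h3 := (hξ.tangentSMul hg0 n.1).congr_of_eventuallyEq
    (γ' := fun t => (γ t).1) (Eventually.of_forall fun t => congrArg Subtype.val (hg t).symm)
  exact (hv'.comp h0 (hι.1.contMDiff.mdifferentiable (by simp) n)).unique h3

theorem contMDiff_isotropyAction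
    (hι : Manifold.IsSmoothEmbedding 𝓘(ℝ, F) 𝓘(ℝ, E).tangent ∞
      (Subtype.val : momentumLevel L μ → TangentBundle 𝓘(ℝ, E) M)) (k : isotropyGroup μ) :
    letI := isotropyAction L hinv μ
    ContMDiff 𝓘(ℝ, F) 𝓘(ℝ, F) ∞ (fun n : momentumLevel L μ => k • n) := by
  let _ := isotropyAction L hinv μ
  exact fun n => contMDiffAt_of_comp_isSmoothEmbedding hι
    (((contMDiff_tangentSMul_right EG (k : G)).comp hι.1.contMDiff) n)

/-- The derivative of the action of an element of the isotropy group on the level set. -/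
noncomputable def smulDeriv (k : isotropyGroup μ) (n : momentumLevel L μ) : F →L[ℝ] F :=
  letI := isotropyAction L hinv μ
  mfderiv 𝓘(ℝ, F) 𝓘(ℝ, F) (fun x : momentumLevel L μ => k • x) n

theorem smulDeriv_mem_orbitTangent
    (hι : Manifold.IsSmoothEmbedding 𝓘(ℝ, F) 𝓘(ℝ, E).tangent ∞
      (Subtype.val : momentumLevel L μ → TangentBundle 𝓘(ℝ, E) M))
    (k : isotropyGroup μ) (n : momentumLevel L μ) {v : F} :
    letI := isotropyAction L hinv μ
    v ∈ orbitTangent (F := F) (isotropyGroup μ) n →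
      smulDeriv hinv k n v ∈ orbitTangent (F := F) (isotropyGroup μ) (k • n) := by
  let _ := isotropyAction L hinv μ
  rintro ⟨γ, h0, horb, hv⟩
  have hv' : HasVelocityAt 𝓘(ℝ, F) γ 0 v := hv
  refine ⟨fun t => k • γ t, congrArg (k • ·) h0, fun t => ?_,
    hv'.comp h0 ((contMDiff_isotropyAction hinv hι k).mdifferentiable (by simp) n)⟩
  obtain ⟨a, ha⟩ := horb t
  -- Conjugation, because `k • a • n` has to be written as a translate of `k • n`.
  refine ⟨k * a * k⁻¹, ?_⟩
  change (k * a * k⁻¹) • k • n = k • γ t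
  rw [← ha, mul_smul, inv_smul_smul, mul_smul]

theorem projDeriv_smulDeriv
    (hι : Manifold.IsSmoothEmbedding 𝓘(ℝ, F) 𝓘(ℝ, E).tangent ∞
      (Subtype.val : momentumLevel L μ → TangentBundle 𝓘(ℝ, E) M))
    (k : isotropyGroup μ) (n : momentumLevel L μ) (v : F) :
    letI := isotropyAction L hinv μ
    projDeriv (k • n) (smulDeriv hinv k n v) =
      (mfderiv 𝓘(ℝ, E) 𝓘(ℝ, E) (fun m : M => (k : G) • m) n.1.proj : E →L[ℝ] E)
        (projDeriv n v) := by
  let _ := isotropyAction L hinv μ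
  have hp := (contMDiff_proj_momentumLevel hι).mdifferentiable (n := ∞) (by simp)
  have h1 := mfderiv_comp_apply (I := 𝓘(ℝ, F)) (I' := 𝓘(ℝ, F)) (I'' := 𝓘(ℝ, E))
    (f := fun x : momentumLevel L μ => k • x) (g := fun x : momentumLevel L μ => x.1.proj) n
    (hp _) ((contMDiff_isotropyAction hinv hι k).mdifferentiable (by simp) n) v
  have h2 := mfderiv_comp_apply (I := 𝓘(ℝ, F)) (I' := 𝓘(ℝ, E)) (I'' := 𝓘(ℝ, E))
    (f := fun x : momentumLevel L μ => x.1.proj) (g := fun m : M => (k : G) • m) n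
    (mdifferentiable_smul EG (k : G) _) (hp n) v
  exact h1.symm.trans h2

theorem isHorizontal_iff (n : momentumLevel L μ) (W : F) :
    IsHorizontal (F := F) L μ n W ↔
      ∀ η ∈ isotropySpace μ, modelHessian L n.1 (fundamentalMap G n.1.proj η) (projDeriv n W) = 0 :=
  Iff.rfl

/-- Every `η ∈ 𝔤_μ` is `Ad k η'` with `η' = Ad k⁻¹ η` again in `𝔤_μ`, so `η̃` at the translated
point is the image of `η̃'`, and invariance of the Hessian moves the pairing back to `n`. -/
theorem isHorizontal_smulDeriv
    (hι : Manifold.IsSmoothEmbedding 𝓘(ℝ, F) 𝓘(ℝ, E).tangent ∞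
      (Subtype.val : momentumLevel L μ → TangentBundle 𝓘(ℝ, E) M))
    (k : isotropyGroup μ) (n : momentumLevel L μ) {W : F} (hW : IsHorizontal (F := F) L μ n W) :
    letI := isotropyAction L hinv μ
    IsHorizontal (F := F) L μ (k • n) (smulDeriv hinv k n W : F) := by
  let _ := isotropyAction L hinv μ
  rw [isHorizontal_iff] at hW ⊢
  intro η hη
  rw [projDeriv_smulDeriv hinv hι]
  let η' : GroupLieAlgebra 𝓘(ℝ, EG) G := Ad ((k : G)⁻¹) η
  have h1 : η' ∈ isotropyAlgebra μ := Ad_mem_isotropyAlgebra μ (inv_mem k.2) hη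
  have h2 := mfderiv_fundamentalField (E := E) (k : G) η' n.1.proj
  have h3 : Ad (k : G) η' = η :=
    (Ad_mul (k : G) (k : G)⁻¹ η).symm.trans
      ((congrArg (fun g : G => Ad g (show GroupLieAlgebra 𝓘(ℝ, EG) G from η))
        (mul_inv_cancel (k : G))).trans (Ad_one η))
  rw [h3] at h2
  have h4 := hessian_tangentSMul hinv (k : G) n.1 (fundamentalField E η' n.1.proj) (projDeriv n W)
  exact (congrArg (fun a : E => modelHessian L (tangentSMul E (k : G) n.1) a
    ((mfderiv 𝓘(ℝ, E) 𝓘(ℝ, E) (fun m : M => (k : G) • m) n.1.proj : E →L[ℝ] E)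
        (projDeriv n W))) h2.symm).trans (h4.trans (hW η' h1))

/-- The mechanical connection, pointwise. -/
theorem exists_mechanicalConnection (hinv : IsInvariant G L)
    (hL : ContMDiff 𝓘(ℝ, E).tangent 𝓘(ℝ, ℝ) ∞ L)
    (hι : Manifold.IsSmoothEmbedding 𝓘(ℝ, F) 𝓘(ℝ, E).tangent ∞
      (Subtype.val : momentumLevel L μ → TangentBundle 𝓘(ℝ, E) M)) (n : momentumLevel L μ) :
    ∃ Ω : F →L[ℝ] F, ∀ W, inclusionDeriv n (Ω W) =
      tangentFundamentalMap G n.1 (isotropyComponent μ L n.1 (projDeriv n W)) := by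
  obtain ⟨T, hT⟩ := exists_isotropyComponent_eq μ hL n.1
  obtain ⟨q, hq⟩ := (inclusionDeriv (F := F) n).toLinearMap.exists_leftInverse_of_injective
    (LinearMap.ker_eq_bot.2 (injective_mfderiv_of_isSmoothEmbedding hι n))
  -- Any linear left inverse `q` of the derivative of the inclusion will do, since it is only
  -- applied to fundamental vectors of `𝔤_μ`, which are tangent to `N_μ`.
  refine ⟨LinearMap.toContinuousLinearMap q ∘L tangentFundamentalMap G n.1 ∘L T ∘L projDeriv n,
    fun W => ?_⟩
  obtain ⟨v, -, hv⟩ := exists_mem_orbitTangent hinv hι n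
    (isotropyComponent_mem μ (L := L) n.1 (projDeriv n W))
  rw [← hv]
  congr 1
  change q (tangentFundamentalMap G n.1 (T (projDeriv n W))) = v
  rw [← hT, ← hv]
  exact DFunLike.congr_fun hq v

variable {Ω : momentumLevel L μ → F →L[ℝ] F}

theorem contMDiff_mechanicalConnection (hL : ContMDiff 𝓘(ℝ, E).tangent 𝓘(ℝ, ℝ) ∞ L)
    (hμ : ∀ w ∈ momentumLevel L μ, ∀ ξ ∈ isotropyAlgebra μ,
      (∀ η ∈ isotropyAlgebra μ, hessian L w
        (fundamentalField E ξ w.proj) (fundamentalField E η w.proj) = 0) → ξ = 0)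
    (hι : Manifold.IsSmoothEmbedding 𝓘(ℝ, F) 𝓘(ℝ, E).tangent ∞
      (Subtype.val : momentumLevel L μ → TangentBundle 𝓘(ℝ, E) M))
    (hΩ : ∀ n W, inclusionDeriv n (Ω n W) =
      tangentFundamentalMap G n.1 (isotropyComponent μ L n.1 (projDeriv n W))) :
    ContMDiff 𝓘(ℝ, F).tangent 𝓘(ℝ, F).tangent ∞
      (fun W : TangentBundle 𝓘(ℝ, F) (momentumLevel L μ) =>
        (⟨W.proj, Ω W.proj W.2⟩ : TangentBundle 𝓘(ℝ, F) (momentumLevel L μ))) := by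
  intro W₀
  have hp : ContMDiff 𝓘(ℝ, F).tangent 𝓘(ℝ, E).tangent ∞
      (fun W : TangentBundle 𝓘(ℝ, F) (momentumLevel L μ) => W.proj.1) :=
    hι.1.contMDiff.comp (contMDiff_proj (TangentSpace 𝓘(ℝ, F)))
  have hu : ContMDiff 𝓘(ℝ, F).tangent 𝓘(ℝ, E).tangent ∞
      (fun W : TangentBundle 𝓘(ℝ, F) (momentumLevel L μ) =>
        (⟨W.proj.1.proj, projDeriv (F := F) W.proj W.2⟩ : TangentBundle 𝓘(ℝ, E) M)) :=
    (contMDiff_proj_momentumLevel hι).contMDiff_tangentMap (m := ∞) (by simp)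
  have hξ : ContMDiffAt 𝓘(ℝ, F).tangent 𝓘(ℝ, EG) ∞
      (fun W : TangentBundle 𝓘(ℝ, F) (momentumLevel L μ) =>
        isotropyComponent μ L W.proj.1 (projDeriv (F := F) W.proj W.2)) W₀ :=
    contMDiffAt_isotropyComponent hL (hμ _ W₀.proj.2) (hp W₀) (hu W₀)
  refine contMDiffAt_of_comp_tangentMap hι ?_
  refine (ContMDiffAt.comp W₀ (contMDiff_tangentFundamentalField (G := G) (EG := EG)
    (W₀.proj.1, isotropyComponent μ L W₀.proj.1 (projDeriv (F := F) W₀.proj W₀.2)))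
    ((hp W₀).prodMk hξ)).congr_of_eventuallyEq (Eventually.of_forall fun W => ?_)
  exact congrArg (fun v : E × E => (⟨W.proj.1, v⟩ :
    TangentBundle 𝓘(ℝ, E).tangent (TangentBundle 𝓘(ℝ, E) M))) (hΩ W.proj W.2)

end MechanicalConnection

/-- Two idempotents with the same range and the same kernel agree. -/
theorem eq_of_range_eq_of_ker_eq {V : Type*} [AddCommGroup V] [Module ℝ V] {P Q : V →ₗ[ℝ] V}
    (hP : ∀ v, P (P v) = P v) (hQ : ∀ v, Q (Q v) = Q v) (hr : range P = range Q)
    (hk : ∀ v, P v = 0 ↔ Q v = 0) : P = Q := by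
  ext v
  obtain ⟨u, hu⟩ : P v ∈ range Q := hr ▸ mem_range_self v
  have h1 : Q (P v) = P v := by rw [← hu, hQ]
  have h2 : Q (v - P v) = 0 := (hk _).1 (by rw [map_sub, hP, sub_self])
  rw [map_sub, h1, sub_eq_zero] at h2
  exact h2.symm

/-! ### Existence and uniqueness of the mechanical connection. -/

section MechanicalConnection

set_option linter.unusedSectionVars false

variable {EG : Type*} [NormedAddCommGroup EG] [NormedSpace ℝ EG] [FiniteDimensional ℝ EG]
  {G : Type*} [TopologicalSpace G] [ChartedSpace EG G] [Group G] [LieGroup 𝓘(ℝ, EG) ∞ G]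
  {E : Type*} [NormedAddCommGroup E] [NormedSpace ℝ E] [FiniteDimensional ℝ E]
  {M : Type*} [TopologicalSpace M] [ChartedSpace E M] [IsManifold 𝓘(ℝ, E) ∞ M]
  [T2Space M] [MulAction G M] [ContMDiffSMul 𝓘(ℝ, EG) 𝓘(ℝ, E) ∞ G M] [ProperSMul G M]
  {F : Type*} [NormedAddCommGroup F] [NormedSpace ℝ F]
  {L : TangentBundle 𝓘(ℝ, E) M → ℝ}
  {μ : Module.Dual ℝ (GroupLieAlgebra 𝓘(ℝ, EG) G)}

/-- The horizontal vectors on a level set of the momentum are those of a unique principal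
connection. -/
theorem existsUnique_mechanicalConnection
    (hfree : ∀ (g : G) (m : M), g • m = m → g = 1)
    (hL : ContMDiff 𝓘(ℝ, E).tangent 𝓘(ℝ, ℝ) ∞ L) (hinv : IsInvariant G L)
    (hreg : ∀ (w : TangentBundle 𝓘(ℝ, E) M) (ξ : GroupLieAlgebra 𝓘(ℝ, EG) G),
      (∀ η : GroupLieAlgebra 𝓘(ℝ, EG) G, hessian L w
        (fundamentalField E ξ w.proj) (fundamentalField E η w.proj) = 0) → ξ = 0)
    (hμ : ∀ w ∈ momentumLevel L μ, ∀ ξ ∈ isotropyAlgebra μ,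
      (∀ η ∈ isotropyAlgebra μ, hessian L w
        (fundamentalField E ξ w.proj) (fundamentalField E η w.proj) = 0) → ξ = 0)
    [ChartedSpace F (momentumLevel L μ)] [IsManifold 𝓘(ℝ, F) ∞ (momentumLevel L μ)]
    (hι : Manifold.IsSmoothEmbedding 𝓘(ℝ, F) 𝓘(ℝ, E).tangent ∞
      (Subtype.val : momentumLevel L μ → TangentBundle 𝓘(ℝ, E) M)) :
    letI := isotropyAction L hinv μ
    ∃! Ω : ∀ n : momentumLevel L μ, TangentSpace 𝓘(ℝ, F) n →L[ℝ] TangentSpace 𝓘(ℝ, F) n,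
      IsPrincipalConnection (isotropyGroup μ) Ω ∧
        ∀ (n : momentumLevel L μ) (W : TangentSpace 𝓘(ℝ, F) n),
          Ω n W = 0 ↔ IsHorizontal L μ n W := by
  let _ := isotropyAction L hinv μ
  choose Ω hΩ using exists_mechanicalConnection (F := F) hinv hL hι
  have hinj : ∀ n : momentumLevel L μ, Function.Injective (inclusionDeriv (F := F) n) :=
    fun n => injective_mfderiv_of_isSmoothEmbedding hι n
  have hfund : ∀ n : momentumLevel L μ,
      Function.Injective (fundamentalMap (E := E) G n.1.proj : EG → E) :=
    fun n => injective_fundamentalMap hL n.1 (hreg n.1)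
  have hfix : ∀ (n : momentumLevel L μ) (v : F),
      v ∈ orbitTangent (F := F) (isotropyGroup μ) n → Ω n v = v := by
    intro n v hv
    obtain ⟨ξ, hξ, h⟩ := exists_inclusionDeriv_of_mem_orbitTangent hinv hfree hι n (hfund n) hv
    refine hinj n ((hΩ n v).trans ?_)
    rw [isotropyComponent_unique hL (hμ _ n.2) hξ fun η _ => by
      rw [projDeriv_of_inclusionDeriv hι h], h]
  have hmem : ∀ (n : momentumLevel L μ) (W : F),
      Ω n W ∈ orbitTangent (F := F) (isotropyGroup μ) n := by
    intro n W
    obtain ⟨v, hv, h⟩ := exists_mem_orbitTangent (F := F) hinv hι n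
      (isotropyComponent_mem μ (L := L) n.1 (projDeriv n W))
    have : Ω n W = v := hinj n ((hΩ n W).trans h.symm)
    rw [this]
    exact hv
  have hker : ∀ (n : momentumLevel L μ) (W : F), Ω n W = 0 ↔ IsHorizontal (F := F) L μ n W := by
    intro n W
    rw [isHorizontal_iff, ← isotropyComponent_eq_zero_iff hL (hμ _ n.2)]
    constructor
    · intro h
      refine hfund n ?_
      -- Projecting `Ω n W = 0` to `M` gives `ξ̃ = 0` for the isotropy component `ξ`, and freeness
      -- at the infinitesimal level, `hfund`, gives `ξ = 0`.
      rw [← projDeriv_of_inclusionDeriv hι (hΩ n W), h, map_zero, map_zero]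
    · intro h
      refine hinj n ?_
      rw [hΩ, h, map_zero, map_zero]
  have hproj : ∀ (n : momentumLevel L μ) (W : F), Ω n (Ω n W) = Ω n W :=
    fun n W => hfix n _ (hmem n W)
  have hrange : ∀ n : momentumLevel L μ,
      range (Ω n) = orbitTangent (F := F) (isotropyGroup μ) n := fun n =>
    Subset.antisymm (range_subset_iff.2 (hmem n)) fun v hv => ⟨v, hfix n v hv⟩
  refine ⟨Ω, ⟨⟨contMDiff_mechanicalConnection hL hμ hι hΩ, hproj, hrange, fun k n W => ?_⟩, hker⟩,
    ?_⟩
  · let D : F →L[ℝ] F := smulDeriv hinv k n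
    have h1 : Ω (k • n) (D (Ω n W)) = D (Ω n W) :=
      hfix _ _ (smulDeriv_mem_orbitTangent hinv hι k n (hmem n W))
    have h2 : ∀ W' : F, Ω n W' = 0 → Ω (k • n) (D W') = 0 := fun W' h =>
      (hker _ _).2 (isHorizontal_smulDeriv hinv hι k n ((hker n W').1 h))
    have h3 : ∀ W' : F, D (Ω n W') = Ω (k • n) (D W') := by
      intro W'
      -- The difference is horizontal and stays so under `D`, while `D (Ω n W')` is tangent to the
      -- orbit and hence fixed by `Ω (k • n)`.
      have h4 := h2 (W' - Ω n W') (by rw [map_sub, hproj, sub_self])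
      rw [map_sub, map_sub, sub_eq_zero] at h4
      rw [h4]
      exact (hfix _ _ (smulDeriv_mem_orbitTangent hinv hι k n (hmem n W'))).symm
    exact h3 W
  · rintro Ω' ⟨hc, hk⟩
    funext n
    let P : F →L[ℝ] F := Ω' n
    have h1 : P.toLinearMap = (Ω n).toLinearMap := by
      refine eq_of_range_eq_of_ker_eq (hc.projection n) (hproj n) ?_ fun v =>
        (hk n v).trans (hker n v).symm
      exact (hc.image n).trans (hrange n).symm
    exact ContinuousLinearMap.coe_injective h1

end MechanicalConnection

end Routh

theorem mainTheorem4
    {EG : Type*} [NormedAddCommGroup EG] [NormedSpace ℝ EG] [FiniteDimensional ℝ EG]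
    {G : Type*} [TopologicalSpace G] [ChartedSpace EG G] [Group G] [LieGroup 𝓘(ℝ, EG) ∞ G]
    [T2Space G] [ConnectedSpace G]
    {E : Type*} [NormedAddCommGroup E] [NormedSpace ℝ E] [FiniteDimensional ℝ E]
    {M : Type*} [TopologicalSpace M] [ChartedSpace E M] [IsManifold 𝓘(ℝ, E) ∞ M]
    [T2Space M] [SecondCountableTopology M]
    [MulAction G M] [ContMDiffSMul 𝓘(ℝ, EG) 𝓘(ℝ, E) ∞ G M]
    -- the action is free and proper
    (hfree : ∀ (g : G) (m : M), g • m = m → g = 1) [ProperSMul G M]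
    -- an invariant regular Lagrangian
    (L : TangentBundle 𝓘(ℝ, E) M → ℝ)
    (hsmooth : ContMDiff 𝓘(ℝ, E).tangent 𝓘(ℝ, ℝ) ∞ L)
    (hinv : Routh.IsInvariant G L)
    (hreg : ∀ (w : TangentBundle 𝓘(ℝ, E) M) (u : TangentSpace 𝓘(ℝ, E) w.proj),
      (∀ v, Routh.hessian L w u v = 0) → u = 0)
    -- the matrix of the Hessian on the fundamental vector fields is non-singular
    (hreg' : ∀ (w : TangentBundle 𝓘(ℝ, E) M) (ξ : GroupLieAlgebra 𝓘(ℝ, EG) G),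
      (∀ η : GroupLieAlgebra 𝓘(ℝ, EG) G, Routh.hessian L w
        (Routh.fundamentalField E ξ w.proj) (Routh.fundamentalField E η w.proj) = 0) → ξ = 0)
    (μ : Module.Dual ℝ (GroupLieAlgebra 𝓘(ℝ, EG) G))
    -- the restriction of the Hessian to `N_μ × 𝔤_μ` is non-singular
    (hμ : ∀ w ∈ Routh.momentumLevel L μ, ∀ ξ ∈ Routh.isotropyAlgebra μ,
      (∀ η ∈ Routh.isotropyAlgebra μ, Routh.hessian L w
        (Routh.fundamentalField E ξ w.proj) (Routh.fundamentalField E η w.proj) = 0) → ξ = 0)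
    (d : ℕ) (hd : d = 2 * Module.finrank ℝ E - Module.finrank ℝ EG) :
    letI := Routh.isotropyAction L hinv μ
    -- the closed subgroup `G_μ` acts freely and properly on `N_μ`
    (IsClosed (Routh.isotropyGroup μ : Set G) ∧
      (∀ (k : Routh.isotropyGroup μ) (n : Routh.momentumLevel L μ), k • n = n → k = 1) ∧
      ProperSMul (Routh.isotropyGroup μ) (Routh.momentumLevel L μ)) ∧
    -- `N_μ` is an embedded submanifold of `TM` of codimension `dim G`
    (∃ _ : ChartedSpace (EuclideanSpace ℝ (Fin d)) (Routh.momentumLevel L μ),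
      IsManifold 𝓘(ℝ, EuclideanSpace ℝ (Fin d)) ∞ (Routh.momentumLevel L μ) ∧
      Manifold.IsSmoothEmbedding 𝓘(ℝ, EuclideanSpace ℝ (Fin d)) 𝓘(ℝ, E).tangent ∞
        (Subtype.val : Routh.momentumLevel L μ → TangentBundle 𝓘(ℝ, E) M)) ∧
    -- and for its structure of an embedded submanifold:
    ∀ [ChartedSpace (EuclideanSpace ℝ (Fin d)) (Routh.momentumLevel L μ)]
      [IsManifold 𝓘(ℝ, EuclideanSpace ℝ (Fin d)) ∞ (Routh.momentumLevel L μ)],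
      Manifold.IsSmoothEmbedding 𝓘(ℝ, EuclideanSpace ℝ (Fin d)) 𝓘(ℝ, E).tangent ∞
        (Subtype.val : Routh.momentumLevel L μ → TangentBundle 𝓘(ℝ, E) M) →
      -- `G_μ` acts by diffeomorphisms, and
      (∀ k : Routh.isotropyGroup μ,
        ContMDiff 𝓘(ℝ, EuclideanSpace ℝ (Fin d)) 𝓘(ℝ, EuclideanSpace ℝ (Fin d)) ∞
          (fun n : Routh.momentumLevel L μ => k • n)) ∧
      -- the horizontal vectors are those of a unique principal `G_μ`-connection
      ∃! Ω : ∀ n : Routh.momentumLevel L μ,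
          TangentSpace 𝓘(ℝ, EuclideanSpace ℝ (Fin d)) n →L[ℝ]
            TangentSpace 𝓘(ℝ, EuclideanSpace ℝ (Fin d)) n,
        Routh.IsPrincipalConnection (Routh.isotropyGroup μ) Ω ∧
        ∀ (n : Routh.momentumLevel L μ) (W : TangentSpace 𝓘(ℝ, EuclideanSpace ℝ (Fin d)) n),
          Ω n W = 0 ↔ Routh.IsHorizontal L μ n W := by
  refine ⟨⟨Routh.isClosed_isotropyGroup μ, Routh.eq_one_of_isotropyAction_eq hfree hinv μ,
    Routh.properSMul_isotropyAction hinv μ⟩,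
    Routh.exists_isSmoothEmbedding_momentumLevel hsmooth hreg' μ hd, ?_⟩
  intro _ _ hι
  exact ⟨Routh.contMDiff_isotropyAction hinv hι,
    Routh.existsUnique_mechanicalConnection hfree hsmooth hinv hreg' hμ hι⟩
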